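/- Let $m,r,n$ be positive integers with $r\mid m$, put $q=m/r$, and let $K$ be a field containing a primitive $m$-th root of unity (so $\operatorname{char}K\nmid m$). Let $G=G(m,r,n)\subset \mathbf{GL}_n(K)$ be the group of monomial matrices whose nonzero entries are $m$-th roots of unity with product an $(m/r)$-th root of unity, let $G'=G(r,r,n)$, and let $\pi\colon G\to G'$ be the homomorphism that raises every matrix entry to the $q$-th power. For a finite group $\Gamma$ of matrices acting on $\mathfrak h=K^n$, with set $\mathcal S$ of reflections (the $s\in\Gamma$ with $\operatorname{rank}(1-s)=1$), write $(1-s)x=(\alpha_s^\vee,x)\alpha_s$ for $x\in\mathfrak h^*$, $s\in\mathcal S$. For a conjugation invariant parameter $c\colon \mathcal S\to K$, let $\mathbf H_c(\Gamma)$ be the rational Cherednik algebra with $\hbar=0$: the quotient of $K[\Gamma]\ltimes T(\mathfrak h\oplus\mathfrak h^*)$ by $[x,x']=0$, $[y,y']=0$, $[y,x]=-\sum_{s\in\mathcal S}c_s(y,\alpha_s)(x,\alpha_s^\vee)s$. For a representation $\sigma$ of $\Gamma$, the Verma module $M_c(\Gamma,\mathfrak h,\sigma)=\operatorname{Sym}(\mathfrak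 h^*)\otimes_K\sigma$ is the $\mathbf H_c(\Gamma)$-module on which $\mathfrak h^*$ acts by multiplication, $\Gamma$ acts diagonally and $y\in\mathfrak h$ acts by the Dunkl operator $D_y(f\otimes v)=-\sum_{s}c_s\frac{(y,\alpha_s)}{\alpha_s}(1-s)f\otimes sv$. Put $\overline c_s=c_{s^{-1}}$. The contravariant form is the unique bilinear form $\beta_c\colon M_c(\Gamma,\mathfrak h,\sigma)\times M_{\overline c}(\Gamma,\mathfrak h^*,\sigma^*)\to K$ with $\beta_c(xf_1,f_2)=\beta_c(f_1,xf_2)$, $\beta_c(f_1,yf_2)=\beta_c(yf_1,f_2)$ and $\beta_c(v,w)=w(v)$ for $x\in\mathfrak h^*$, $y\in\mathfrak h$, $v\in\sigma$, $w\in\sigma^*$. Let $c$ be a generic parameter for $G$, i.e. its values on the distinct conjugacy classes of reflections of $G$ are algebraically independent over the prime subfield of $K$. Let $c'$ be the parameter for $G'$ given by $c'_{\pi(s)}=c_s$ for all reflections $s$ of $G$ such that $\pi(s)$ is a reflection of $G'$. Let $\tau'$ be an irreducible representation of $G'$ over $K$ and $\tau=\tau'\circ\pi$. Write $A=\operatorname{Sym}(\mathfrak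 h^*)=K[x_1,\dots,x_n]$ and $M=A\otimes_K\tau$, which underlies both $M_c(G,\mathfrak h,\tau)$ and $M_{c'}(G',\mathfrak h,\tau')$. Let $J^1\subset M$ be the kernel of the contravariant form on $M_{c'}(G',\mathfrak h,\tau')$, and let $J^q$ be the $A$-submodule of $M$ generated by the elements obtained from those of $J^1$ by substituting $x_i\mapsto x_i^q$ for all $i$. Then $J^1$ and $J^q$ are graded subspaces of $M$, $J^q$ is an $\mathbf H_c(G)$-submodule of $M_c(G,\mathfrak h,\tau)$, and $M/J^q$ is an irreducible $\mathbf H_c(G)$-module. Moreover, if $h^1(t)$ is the Hilbert series of $M/J^1$, then the Hilbert series of $M/J^q$ is $h^1(t^q)\,(1+t+\cdots+t^{q-1})^n$. -/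

import Mathlib

open scoped TensorProduct

noncomputable section

namespace Cherednik

section General

variable {K : Type*} [Field K] {G : Type*} [Group G] {n : ℕ}

/-- `s` acts on `𝔥 = Kⁿ` as a reflection: `1 - s` has rank one. -/
def IsReflection (ρ : G →* Matrix (Fin n) (Fin n) K) (s : G) : Prop :=
  (1 - ρ s).rank = 1

/-- The set of reflections of a finite group. -/
def reflections [Finite G] (ρ : G →* Matrix (Fin n) (Fin n) K) : Finset G :=
  (Set.toFinite {s : G | IsReflection ρ s}).toFinset

/-- The contragredient of a matrix representation: the action on `𝔥*` in the dual basis. -/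
def dualRep (ρ : G →* Matrix (Fin n) (Fin n) K) : G →* Matrix (Fin n) (Fin n) K where
  toFun g := (ρ g⁻¹).transpose
  map_one' := by simp
  map_mul' g h := by simp [Matrix.transpose_mul]

/-- The linear form `∑ aⱼ xⱼ`, as an element of `Sym(𝔥*) = K[x₁, …, xₙ]`. -/
def linForm (a : Fin n → K) : MvPolynomial (Fin n) K :=
  ∑ l, MvPolynomial.C (a l) * MvPolynomial.X l

/-- The action of `G` on `Sym(𝔥*)`, determined by `g · xⱼ = xⱼ ∘ g⁻¹`. -/
def polyAct (ρ : G →* Matrix (Fin n) (Fin n) K) (g : G) :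
    MvPolynomial (Fin n) K →ₐ[K] MvPolynomial (Fin n) K :=
  MvPolynomial.aeval fun j => linForm ((ρ g⁻¹) j)

theorem exists_root (ρ : G →* Matrix (Fin n) (Fin n) K) {s : G} (hs : IsReflection ρ s) :
    ∃ ab : (Fin n → K) × (Fin n → K), 1 - ρ s⁻¹ = Matrix.vecMulVec ab.2 ab.1 := by
  have h1 : ∃ a b : Fin n → K, 1 - ρ s = Matrix.vecMulVec b a := by
    unfold IsReflection at hs
    rw [Matrix.rank_eq_finrank_span_cols] at hs
    obtain ⟨v, -, hv⟩ := finrank_eq_one_iff'.mp hs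
    have hcol : ∀ j, ∃ t : K, t • (v : Fin n → K) = (1 - ρ s).col j := fun j => by
      obtain ⟨t, ht⟩ := hv ⟨(1 - ρ s).col j, Submodule.subset_span ⟨j, rfl⟩⟩
      exact ⟨t, congrArg Subtype.val ht⟩
    choose a ha using hcol
    refine ⟨a, v, ?_⟩
    ext i j
    have := congrFun (ha j) i
    simp only [Pi.smul_apply, smul_eq_mul, Matrix.col_apply] at this
    rw [← this, Matrix.vecMulVec_apply, mul_comm]
  obtain ⟨a, b, hab⟩ := h1
  refine ⟨(a, -(ρ s⁻¹).mulVec b), ?_⟩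
  have h2 : 1 - ρ s⁻¹ = -(ρ s⁻¹ * (1 - ρ s)) := by
    rw [mul_sub, ← map_mul]; simp
  rw [h2, hab, Matrix.mul_vecMulVec, Matrix.neg_vecMulVec]

open Classical in
/-- Coordinates `(yᵢ, αₛ)` of the root `αₛ ∈ 𝔥*` of a reflection `s`. -/
def root (ρ : G →* Matrix (Fin n) (Fin n) K) (s : G) : Fin n → K :=
  if hs : IsReflection ρ s then (exists_root ρ hs).choose.1 else 0

open Classical in
/-- Coordinates `(xⱼ, αₛ^∨)` of the coroot `αₛ^∨ ∈ 𝔥` of a reflection `s`; by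
`one_sub_eq_root` we have `(1 - s) x = (αₛ^∨, x) αₛ` for `x ∈ 𝔥*`. -/
def coroot (ρ : G →* Matrix (Fin n) (Fin n) K) (s : G) : Fin n → K :=
  if hs : IsReflection ρ s then (exists_root ρ hs).choose.2 else 0

theorem one_sub_eq_root (ρ : G →* Matrix (Fin n) (Fin n) K) {s : G} (hs : IsReflection ρ s) :
    1 - ρ s⁻¹ = Matrix.vecMulVec (coroot ρ s) (root ρ s) := by
  rw [root, coroot, dif_pos hs, dif_pos hs]
  exact (exists_root ρ hs).choose_spec

theorem root_ne_zero (ρ : G →* Matrix (Fin n) (Fin n) K) {s : G}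
    (hs : IsReflection ρ s) : root ρ s ≠ 0 := by
  intro h
  have h1 := one_sub_eq_root ρ hs
  rw [h, Matrix.vecMulVec_zero, sub_eq_zero] at h1
  have h2 : ρ s = 1 := by
    have := map_mul ρ s s⁻¹
    rw [← h1, mul_inv_cancel, map_one, mul_one] at this
    exact this.symm
  unfold IsReflection at hs
  rw [h2, sub_self, Matrix.rank_zero] at hs
  exact zero_ne_one hs

theorem coeff_linForm (a : Fin n → K) (i : Fin n) :
    MvPolynomial.coeff (Finsupp.single i 1) (linForm a) = a i := by
  classical
  simp [linForm, MvPolynomial.coeff_sum, MvPolynomial.coeff_C_mul, MvPolynomial.coeff_X,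
    Finsupp.single_left_inj]

theorem linForm_root_ne_zero (ρ : G →* Matrix (Fin n) (Fin n) K) {s : G}
    (hs : IsReflection ρ s) : linForm (root ρ s) ≠ 0 := by
  intro h
  refine root_ne_zero ρ hs (funext fun i => ?_)
  rw [← coeff_linForm (root ρ s) i, h]
  simp

theorem X_sub_polyAct_X (ρ : G →* Matrix (Fin n) (Fin n) K) {s : G} (hs : IsReflection ρ s)
    (j : Fin n) : (MvPolynomial.X j : MvPolynomial (Fin n) K) - polyAct ρ s (MvPolynomial.X j) =
      MvPolynomial.C (coroot ρ s j) * linForm (root ρ s) := by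
  have h := one_sub_eq_root ρ hs
  have h2 : ρ s⁻¹ = 1 - Matrix.vecMulVec (coroot ρ s) (root ρ s) := by rw [← h]; abel
  rw [polyAct, MvPolynomial.aeval_X, h2]
  simp [linForm, Matrix.sub_apply, Matrix.vecMulVec_apply, sub_mul, Finset.sum_sub_distrib,
    Finset.mul_sum, mul_assoc, Matrix.one_apply]

theorem linForm_root_dvd (ρ : G →* Matrix (Fin n) (Fin n) K) {s : G} (hs : IsReflection ρ s)
    (f : MvPolynomial (Fin n) K) : linForm (root ρ s) ∣ f - polyAct ρ s f := by
  induction f using MvPolynomial.induction_on with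
  | C a => simp [polyAct]
  | add p q hp hq =>
    rw [map_add, add_sub_add_comm]
    exact dvd_add hp hq
  | mul_X p j hp =>
    have h : p * MvPolynomial.X j - polyAct ρ s (p * MvPolynomial.X j) =
        (p - polyAct ρ s p) * MvPolynomial.X j +
          polyAct ρ s p * (MvPolynomial.X j - polyAct ρ s (MvPolynomial.X j)) := by
      rw [map_mul]; ring
    rw [h, X_sub_polyAct_X ρ hs]
    exact dvd_add (hp.mul_right _) ((Dvd.intro_left _ rfl).mul_left _)

open Classical in
/-- The operator `f ↦ (f - s · f) / αₛ` on `Sym(𝔥*)` for a reflection `s`. -/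
def divDiff (ρ : G →* Matrix (Fin n) (Fin n) K) (s : G) :
    MvPolynomial (Fin n) K →ₗ[K] MvPolynomial (Fin n) K :=
  if hs : IsReflection ρ s then
    { toFun := fun f => (linForm_root_dvd ρ hs f).choose
      map_add' := fun f g => by
        refine mul_left_cancel₀ (linForm_root_ne_zero ρ hs) ?_
        rw [mul_add, ← (linForm_root_dvd ρ hs _).choose_spec,
          ← (linForm_root_dvd ρ hs f).choose_spec, ← (linForm_root_dvd ρ hs g).choose_spec, map_add]
        ring
      map_smul' := fun t f => by
        refine mul_left_cancel₀ (linForm_root_ne_zero ρ hs) ?_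
        rw [RingHom.id_apply, mul_smul_comm, ← (linForm_root_dvd ρ hs _).choose_spec,
          ← (linForm_root_dvd ρ hs f).choose_spec, map_smul, smul_sub] }
  else 0

theorem root_mul_divDiff (ρ : G →* Matrix (Fin n) (Fin n) K) {s : G} (hs : IsReflection ρ s)
    (f : MvPolynomial (Fin n) K) :
    linForm (root ρ s) * divDiff ρ s f = f - polyAct ρ s f := by
  rw [divDiff, dif_pos hs]
  exact (linForm_root_dvd ρ hs f).choose_spec.symm

theorem polyAct_X (ρ : G →* Matrix (Fin n) (Fin n) K) (g : G) (j : Fin n) :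
    polyAct ρ g (MvPolynomial.X j) = linForm ((ρ g⁻¹) j) := by
  rw [polyAct, MvPolynomial.aeval_X]

theorem polyAct_linForm (ρ : G →* Matrix (Fin n) (Fin n) K) (g : G) (a : Fin n → K) :
    polyAct ρ g (linForm a) = linForm (Matrix.vecMul a (ρ g⁻¹)) := by
  simp only [linForm, map_sum, map_mul, polyAct_X, Matrix.vecMul, dotProduct, Finset.sum_mul,
    Finset.mul_sum]
  rw [Finset.sum_comm]
  refine Finset.sum_congr rfl fun l _ => Finset.sum_congr rfl fun j _ => ?_
  rw [polyAct, MvPolynomial.algHom_C, MvPolynomial.algebraMap_eq, mul_assoc]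

theorem polyAct_mul (ρ : G →* Matrix (Fin n) (Fin n) K) (g h : G) :
    polyAct ρ (g * h) = (polyAct ρ g).comp (polyAct ρ h) := by
  refine MvPolynomial.algHom_ext fun j => ?_
  rw [AlgHom.comp_apply, polyAct_X, polyAct_X, polyAct_linForm]
  congr 1
  rw [mul_inv_rev, map_mul]
  rfl

theorem polyAct_one (ρ : G →* Matrix (Fin n) (Fin n) K) : polyAct ρ 1 = AlgHom.id K _ := by
  refine MvPolynomial.algHom_ext fun j => ?_
  rw [polyAct_X]
  simp [linForm, Matrix.one_apply]

theorem isReflection_conj (ρ : G →* Matrix (Fin n) (Fin n) K) {s : G} (g : G)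
    (hs : IsReflection ρ s) : IsReflection ρ (g * s * g⁻¹) := by
  have key : ∀ g s : G, (1 - ρ (g * s * g⁻¹)).rank ≤ (1 - ρ s).rank := fun g s => by
    have h : 1 - ρ (g * s * g⁻¹) = ρ g * (1 - ρ s) * ρ g⁻¹ := by
      rw [mul_sub, sub_mul, mul_one, ← map_mul, ← map_mul, ← map_mul, mul_inv_cancel, map_one]
    rw [h]
    exact (Matrix.rank_mul_le_left _ _).trans (Matrix.rank_mul_le_right _ _)
  refine le_antisymm ((key g s).trans hs.le) ?_
  have := key g⁻¹ (g * s * g⁻¹)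
  rw [show g⁻¹ * (g * s * g⁻¹) * g⁻¹⁻¹ = s by group, hs] at this
  exact this

theorem isReflection_dualRep_inv (ρ : G →* Matrix (Fin n) (Fin n) K) {s : G}
    (hs : IsReflection ρ s) : IsReflection (dualRep ρ) s⁻¹ := by
  unfold IsReflection at *
  have h : 1 - dualRep ρ s⁻¹ = (1 - ρ s).transpose := by
    simp [dualRep, Matrix.transpose_sub]
  rw [h, Matrix.rank_transpose, hs]

theorem dualRep_dualRep (ρ : G →* Matrix (Fin n) (Fin n) K) : dualRep (dualRep ρ) = ρ := by
  ext g : 1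
  simp [dualRep]

theorem exists_root_conj (ρ : G →* Matrix (Fin n) (Fin n) K) {s : G} (g : G)
    (hs : IsReflection ρ s) :
    ∃ t : K, root ρ (g * s * g⁻¹) = t • Matrix.vecMul (root ρ s) (ρ g⁻¹) := by
  have hs' := isReflection_conj ρ g hs
  have h1 := one_sub_eq_root ρ hs'
  have h2 : 1 - ρ (g * s * g⁻¹)⁻¹ = ρ g * (1 - ρ s⁻¹) * ρ g⁻¹ := by
    rw [mul_sub, sub_mul, mul_one, ← map_mul, ← map_mul, ← map_mul, mul_inv_cancel, map_one]
    congr 2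
    group
  rw [h2, one_sub_eq_root ρ hs, Matrix.mul_vecMulVec, Matrix.vecMulVec_mul] at h1
  have hb : coroot ρ (g * s * g⁻¹) ≠ 0 := by
    intro h
    rw [h, Matrix.zero_vecMulVec] at h1
    have h3 : 1 - ρ (g * s * g⁻¹)⁻¹ = 0 := by
      rw [one_sub_eq_root ρ hs', h, Matrix.zero_vecMulVec]
    have h4 : ρ (g * s * g⁻¹) = 1 := by
      have := map_mul ρ (g * s * g⁻¹) (g * s * g⁻¹)⁻¹
      rw [← sub_eq_zero.mp h3, mul_inv_cancel, map_one, mul_one] at this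
      exact this.symm
    unfold IsReflection at hs'
    rw [h4, sub_self, Matrix.rank_zero] at hs'
    exact zero_ne_one hs'
  obtain ⟨j, hj⟩ := Function.ne_iff.mp hb
  refine ⟨(coroot ρ (g * s * g⁻¹) j)⁻¹ * (ρ g).mulVec (coroot ρ s) j, funext fun l => ?_⟩
  have := congrFun (congrFun h1 j) l
  rw [Matrix.vecMulVec_apply, Matrix.vecMulVec_apply] at this
  rw [Pi.smul_apply, smul_eq_mul, mul_assoc (coroot ρ (g * s * g⁻¹) j)⁻¹, this,
    inv_mul_cancel_left₀ hj]

theorem linForm_smul (t : K) (a : Fin n → K) : linForm (t • a) = t • linForm a := by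
  simp [linForm, Finset.smul_sum, MvPolynomial.smul_eq_C_mul, mul_assoc]

theorem polyAct_divDiff (ρ : G →* Matrix (Fin n) (Fin n) K) {s : G} (g : G)
    (hs : IsReflection ρ s) (i : Fin n) (f : MvPolynomial (Fin n) K) :
    root ρ s i • polyAct ρ g (divDiff ρ s f) =
      ∑ l, (ρ g l i * root ρ (g * s * g⁻¹) l) • divDiff ρ (g * s * g⁻¹) (polyAct ρ g f) := by
  have hs' := isReflection_conj ρ g hs
  obtain ⟨t, ht⟩ := exists_root_conj ρ g hs
  refine mul_left_cancel₀ (linForm_root_ne_zero ρ hs') ?_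
  rw [← Finset.sum_smul, mul_smul_comm, mul_smul_comm, root_mul_divDiff ρ hs']
  have h1 : ∑ l, ρ g l i * root ρ (g * s * g⁻¹) l = t * root ρ s i := by
    have : ∑ l, ρ g l i * root ρ (g * s * g⁻¹) l =
        Matrix.vecMul (root ρ (g * s * g⁻¹)) (ρ g) i := by
      simp [Matrix.vecMul, dotProduct, mul_comm]
    rw [this, ht, Matrix.smul_vecMul, Matrix.vecMul_vecMul, ← map_mul, inv_mul_cancel, map_one,
      Matrix.vecMul_one, Pi.smul_apply, smul_eq_mul]
  have h2 : polyAct ρ (g * s * g⁻¹) (polyAct ρ g f) = polyAct ρ g (polyAct ρ s f) := by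
    rw [← AlgHom.comp_apply, ← AlgHom.comp_apply, ← polyAct_mul, ← polyAct_mul]
    congr 2
    group
  rw [h1, h2, ← map_sub, ← root_mul_divDiff ρ hs, map_mul, polyAct_linForm, ht, linForm_smul,
    smul_mul_assoc, smul_smul, mul_comm]

theorem divDiff_X_mul (ρ : G →* Matrix (Fin n) (Fin n) K) {s : G} (hs : IsReflection ρ s)
    (j : Fin n) (f : MvPolynomial (Fin n) K) :
    divDiff ρ s (MvPolynomial.X j * f) =
      MvPolynomial.X j * divDiff ρ s f + coroot ρ s j • polyAct ρ s f := by
  refine mul_left_cancel₀ (linForm_root_ne_zero ρ hs) ?_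
  rw [root_mul_divDiff ρ hs, mul_add, mul_left_comm, root_mul_divDiff ρ hs, map_mul,
    MvPolynomial.smul_eq_C_mul]
  linear_combination polyAct ρ s f * X_sub_polyAct_X ρ hs j

theorem divDiff_one (ρ : G →* Matrix (Fin n) (Fin n) K) {s : G} (hs : IsReflection ρ s) :
    divDiff ρ s 1 = 0 := by
  refine mul_left_cancel₀ (linForm_root_ne_zero ρ hs) ?_
  rw [root_mul_divDiff ρ hs, map_one, sub_self, mul_zero]

/-- Generators of the rational Cherednik algebra: the elements of `G`, the dual bases
`x₁, …, xₙ` of `𝔥*` and `y₁, …, yₙ` of `𝔥 = Kⁿ`. -/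
inductive Gen (G : Type*) (n : ℕ)
  | g : G → Gen G n
  | x : Fin n → Gen G n
  | y : Fin n → Gen G n

/-- The defining relations of `H_{0,c}(G, 𝔥)`: those of `K[G] ⋉ T(𝔥 ⊕ 𝔥*)` together with
`[x, x'] = 0`, `[y, y'] = 0` and `[y, x] = -∑ₛ cₛ (y, αₛ) (x, αₛ^∨) s`. -/
inductive Rel [Finite G] (ρ : G →* Matrix (Fin n) (Fin n) K) (c : ConjClasses G → K) :
    FreeAlgebra K (Gen G n) → FreeAlgebra K (Gen G n) → Prop
  | one : Rel ρ c (FreeAlgebra.ι K (.g 1)) 1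
  | mul (g h : G) : Rel ρ c (FreeAlgebra.ι K (.g g) * FreeAlgebra.ι K (.g h))
      (FreeAlgebra.ι K (.g (g * h)))
  | gx (g : G) (j : Fin n) : Rel ρ c (FreeAlgebra.ι K (.g g) * FreeAlgebra.ι K (.x j))
      ((∑ l, ρ g⁻¹ j l • FreeAlgebra.ι K (.x l)) * FreeAlgebra.ι K (.g g))
  | gy (g : G) (i : Fin n) : Rel ρ c (FreeAlgebra.ι K (.g g) * FreeAlgebra.ι K (.y i))
      ((∑ l, ρ g l i • FreeAlgebra.ι K (.y l)) * FreeAlgebra.ι K (.g g))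
  | xx (i j : Fin n) : Rel ρ c (FreeAlgebra.ι K (.x i) * FreeAlgebra.ι K (.x j))
      (FreeAlgebra.ι K (.x j) * FreeAlgebra.ι K (.x i))
  | yy (i j : Fin n) : Rel ρ c (FreeAlgebra.ι K (.y i) * FreeAlgebra.ι K (.y j))
      (FreeAlgebra.ι K (.y j) * FreeAlgebra.ι K (.y i))
  | yx (i j : Fin n) : Rel ρ c
      (FreeAlgebra.ι K (.y i) * FreeAlgebra.ι K (.x j) -
        FreeAlgebra.ι K (.x j) * FreeAlgebra.ι K (.y i))
      (-∑ s ∈ reflections ρ,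
        (c (ConjClasses.mk s) * root ρ s i * coroot ρ s j) • FreeAlgebra.ι K (.g s))

/-- The rational Cherednik algebra `H_{0,c}(G, 𝔥)` (that is, `ħ = 0`) of a finite group `G` acting
on `𝔥 = Kⁿ` by `ρ`. The parameter `cₛ` of a reflection `s` is the value of `c` at the conjugacy
class of `s`; the values of `c` at other conjugacy classes play no role. -/
def CherednikAlgebra [Finite G] (ρ : G →* Matrix (Fin n) (Fin n) K) (c : ConjClasses G → K) :
    Type _ :=
  RingQuot (Rel ρ c)

instance [Finite G] (ρ : G →* Matrix (Fin n) (Fin n) K) (c : ConjClasses G → K) :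
    Ring (CherednikAlgebra ρ c) :=
  inferInstanceAs (Ring (RingQuot (Rel ρ c)))

instance [Finite G] (ρ : G →* Matrix (Fin n) (Fin n) K) (c : ConjClasses G → K) :
    Algebra K (CherednikAlgebra ρ c) :=
  inferInstanceAs (Algebra K (RingQuot (Rel ρ c)))

/-- A generator, viewed as an element of the Cherednik algebra. -/
def CherednikAlgebra.of [Finite G] (ρ : G →* Matrix (Fin n) (Fin n) K) (c : ConjClasses G → K)
    (a : Gen G n) : CherednikAlgebra ρ c :=
  RingQuot.mkAlgHom K (Rel ρ c) (FreeAlgebra.ι K a)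

variable {V : Type*} [AddCommGroup V] [Module K V]

/-- Multiplication by `xⱼ` on `Sym(𝔥*) ⊗ τ`. -/
def mulOp (K : Type*) [Field K] {n : ℕ} (V : Type*) [AddCommGroup V] [Module K V] (j : Fin n) :
    Module.End K (MvPolynomial (Fin n) K ⊗[K] V) :=
  Algebra.lsmul K K (MvPolynomial (Fin n) K ⊗[K] V) (MvPolynomial.X j : MvPolynomial (Fin n) K)

/-- The diagonal action of `g ∈ G` on `Sym(𝔥*) ⊗ τ`. -/
def groupOp (ρ : G →* Matrix (Fin n) (Fin n) K) (τ : Representation K G V) (g : G) :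
    Module.End K (MvPolynomial (Fin n) K ⊗[K] V) :=
  TensorProduct.map (polyAct ρ g).toLinearMap (τ g)

/-- The Dunkl operator `Dᵢ` on `Sym(𝔥*) ⊗ τ` (with `ħ = 0`):
`Dᵢ (f ⊗ v) = -∑ₛ cₛ ((yᵢ, αₛ) / αₛ) (1 - s) f ⊗ s v`. -/
def dunkl [Finite G] (ρ : G →* Matrix (Fin n) (Fin n) K) (c : ConjClasses G → K)
    (τ : Representation K G V) (i : Fin n) :
    Module.End K (MvPolynomial (Fin n) K ⊗[K] V) :=
  -∑ s ∈ reflections ρ,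
    (c (ConjClasses.mk s) * root ρ s i) • TensorProduct.map (divDiff ρ s) (τ s)

theorem mem_reflections [Finite G] {ρ : G →* Matrix (Fin n) (Fin n) K} {s : G} :
    s ∈ reflections ρ ↔ IsReflection ρ s := by
  simp [reflections]

theorem mulOp_tmul (j : Fin n) (f : MvPolynomial (Fin n) K) (v : V) :
    mulOp K V j (f ⊗ₜ[K] v) = (MvPolynomial.X j * f) ⊗ₜ[K] v := rfl

theorem verma_induction {p : MvPolynomial (Fin n) K ⊗[K] V → Prop} (h1 : ∀ v, p (1 ⊗ₜ v))
    (hadd : ∀ F H, p F → p H → p (F + H)) (hX : ∀ j F, p F → p (mulOp K V j F)) (F) : p F := by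
  induction F using TensorProduct.induction_on with
  | zero => simpa using h1 0
  | add F H hF hH => exact hadd F H hF hH
  | tmul f v =>
    induction f using MvPolynomial.induction_on with
    | C a =>
      have : (MvPolynomial.C a : MvPolynomial (Fin n) K) ⊗ₜ[K] v = 1 ⊗ₜ (a • v) := by
        rw [← TensorProduct.smul_tmul, MvPolynomial.smul_eq_C_mul, mul_one]
      rw [this]
      exact h1 _
    | add f g hf hg => rw [TensorProduct.add_tmul]; exact hadd _ _ hf hg
    | mul_X f j hf => rw [mul_comm, ← mulOp_tmul]; exact hX _ _ hf

theorem verma_end_ext {W : Type*} [AddCommGroup W] [Module K W]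
    {S T : MvPolynomial (Fin n) K ⊗[K] V →ₗ[K] W}
    (h : ∀ f v, S (f ⊗ₜ v) = T (f ⊗ₜ v)) : S = T :=
  TensorProduct.ext' h

theorem mulOp_comm (i j : Fin n) : mulOp K V i * mulOp K V j = mulOp K V j * mulOp K V i := by
  rw [mulOp, mulOp, ← map_mul, ← map_mul, mul_comm]

theorem groupOp_one (ρ : G →* Matrix (Fin n) (Fin n) K) (τ : Representation K G V) :
    groupOp ρ τ 1 = 1 := by
  refine verma_end_ext fun f v => ?_
  simp [groupOp, polyAct_one]

theorem groupOp_mul (ρ : G →* Matrix (Fin n) (Fin n) K) (τ : Representation K G V) (g h : G) :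
    groupOp ρ τ g * groupOp ρ τ h = groupOp ρ τ (g * h) := by
  refine verma_end_ext fun f v => ?_
  simp [groupOp, polyAct_mul]

theorem groupOp_mulOp (ρ : G →* Matrix (Fin n) (Fin n) K) (τ : Representation K G V) (g : G)
    (j : Fin n) : groupOp ρ τ g * mulOp K V j =
      (∑ l, ρ g⁻¹ j l • mulOp K V l) * groupOp ρ τ g := by
  refine verma_end_ext fun f v => ?_
  simp only [Module.End.mul_apply, mulOp_tmul, groupOp, TensorProduct.map_tmul, LinearMap.sum_apply,
    LinearMap.smul_apply, AlgHom.toLinearMap_apply, map_mul, polyAct_X, linForm, Finset.sum_mul,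
    TensorProduct.sum_tmul, MvPolynomial.smul_eq_C_mul, TensorProduct.smul_tmul', mul_assoc]

theorem groupOp_dunkl [Finite G] (ρ : G →* Matrix (Fin n) (Fin n) K) (c : ConjClasses G → K)
    (τ : Representation K G V) (g : G) (i : Fin n) : groupOp ρ τ g * dunkl ρ c τ i =
      (∑ l, ρ g l i • dunkl ρ c τ l) * groupOp ρ τ g := by
  refine verma_end_ext fun f v => ?_
  simp only [Module.End.mul_apply, dunkl, LinearMap.neg_apply, LinearMap.sum_apply,
    LinearMap.smul_apply, map_neg, map_sum, map_smul, TensorProduct.map_tmul, groupOp,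
    AlgHom.toLinearMap_apply, smul_neg, Finset.smul_sum, Finset.sum_neg_distrib]
  rw [Finset.sum_comm, neg_inj]
  refine Finset.sum_equiv (MulAut.conj g).toEquiv ?_ ?_
  · intro s
    simp only [mem_reflections, MulEquiv.toEquiv_eq_coe, EquivLike.coe_coe, MulAut.conj_apply]
    refine ⟨isReflection_conj ρ g, fun h => ?_⟩
    have := isReflection_conj ρ g⁻¹ h
    rwa [show g⁻¹ * (g * s * g⁻¹) * g⁻¹⁻¹ = s by group] at this
  · intro s hs
    rw [mem_reflections] at hs
    simp only [MulEquiv.toEquiv_eq_coe, EquivLike.coe_coe, MulAut.conj_apply]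
    have hc : ConjClasses.mk (g * s * g⁻¹) = ConjClasses.mk s :=
      ConjClasses.mk_eq_mk_iff_isConj.mpr (isConj_iff.mpr ⟨g⁻¹, by group⟩)
    have hτ : τ (g * s * g⁻¹) (τ g v) = τ g (τ s v) := by
      rw [← Module.End.mul_apply, ← Module.End.mul_apply, ← map_mul, ← map_mul]
      congr 2
      group
    rw [hc, hτ, mul_smul, TensorProduct.smul_tmul', polyAct_divDiff ρ g hs,
      TensorProduct.sum_tmul, Finset.smul_sum]
    refine Finset.sum_congr rfl fun l _ => ?_
    rw [← TensorProduct.smul_tmul', smul_smul, smul_smul]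
    congr 1
    ring

theorem dunkl_mulOp [Finite G] (ρ : G →* Matrix (Fin n) (Fin n) K) (c : ConjClasses G → K)
    (τ : Representation K G V) (i j : Fin n) :
    dunkl ρ c τ i * mulOp K V j - mulOp K V j * dunkl ρ c τ i =
      -∑ s ∈ reflections ρ,
        (c (ConjClasses.mk s) * root ρ s i * coroot ρ s j) • groupOp ρ τ s := by
  refine verma_end_ext fun f v => ?_
  simp only [LinearMap.sub_apply, Module.End.mul_apply, dunkl, LinearMap.neg_apply,
    LinearMap.sum_apply, LinearMap.smul_apply, map_neg, map_sum, map_smul, TensorProduct.map_tmul,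
    groupOp, AlgHom.toLinearMap_apply, mulOp_tmul]
  rw [sub_neg_eq_add, neg_add_eq_sub, ← neg_sub, ← Finset.sum_sub_distrib, neg_inj]
  refine Finset.sum_congr rfl fun s hs => ?_
  rw [divDiff_X_mul ρ (mem_reflections.mp hs), TensorProduct.add_tmul, smul_add,
    add_sub_cancel_left, ← TensorProduct.smul_tmul', smul_smul]

theorem dunkl_one_tmul [Finite G] (ρ : G →* Matrix (Fin n) (Fin n) K) (c : ConjClasses G → K)
    (τ : Representation K G V) (i : Fin n) (v : V) : dunkl ρ c τ i (1 ⊗ₜ v) = 0 := by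
  simp only [dunkl, LinearMap.neg_apply, LinearMap.sum_apply, LinearMap.smul_apply,
    TensorProduct.map_tmul, neg_eq_zero]
  refine Finset.sum_eq_zero fun s hs => ?_
  rw [divDiff_one ρ (mem_reflections.mp hs), TensorProduct.zero_tmul, smul_zero]

theorem groupOp_dunkl_eq_add [Finite G] (ρ : G →* Matrix (Fin n) (Fin n) K)
    (c : ConjClasses G → K) (τ : Representation K G V) {s : G} (hs : IsReflection ρ s)
    (i : Fin n) :
    groupOp ρ τ s * dunkl ρ c τ i = dunkl ρ c τ i * groupOp ρ τ s +
      root ρ s i • ((∑ l, (ρ s).mulVec (coroot ρ s) l • dunkl ρ c τ l) * groupOp ρ τ s) := by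
  have h : ∀ l, ρ s l i = (1 : Matrix (Fin n) (Fin n) K) l i +
      root ρ s i * (ρ s).mulVec (coroot ρ s) l := fun l => by
    have h1 : ρ s = 1 + ρ s * (1 - ρ s⁻¹) := by
      rw [mul_sub, ← map_mul]; simp
    rw [one_sub_eq_root ρ hs, Matrix.mul_vecMulVec] at h1
    conv_lhs => rw [h1]
    rw [Matrix.add_apply, Matrix.vecMulVec_apply, mul_comm (root ρ s i)]
  rw [groupOp_dunkl, ← smul_mul_assoc, Finset.smul_sum, ← add_mul]
  congr 1
  simp only [h, add_smul, Finset.sum_add_distrib, mul_smul]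
  simp [Matrix.one_apply]

theorem commute_aux {E : Type*} [Ring E] {Di Dk X Ri Rk : E} (hi : Di * X - X * Di = -Ri)
    (hk : Dk * X - X * Dk = -Rk) (key : Rk * Di + Dk * Ri = Ri * Dk + Di * Rk) :
    (Di * Dk - Dk * Di) * X = X * (Di * Dk - Dk * Di) := by
  have e1 : (Di * Dk - Dk * Di) * X - X * (Di * Dk - Dk * Di) =
      Di * (Dk * X - X * Dk) + (Di * X - X * Di) * Dk
        - (Dk * (Di * X - X * Di) + (Dk * X - X * Dk) * Di) := by noncomm_ring
  have e2 : (Di * Dk - Dk * Di) * X - X * (Di * Dk - Dk * Di) =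
      (Rk * Di + Dk * Ri) - (Ri * Dk + Di * Rk) := by
    rw [e1, hi, hk]; noncomm_ring
  rw [key, sub_self] at e2
  exact sub_eq_zero.mp e2

theorem commute_aux_smul {E : Type*} [Ring E] [Algebra K E] {T Di Dk S : E} {ri rk : K}
    (hi : T * Di = Di * T + ri • S) (hk : T * Dk = Dk * T + rk • S) (t b : K) :
    (t * rk * b) • T * Di + Dk * (t * ri * b) • T =
      (t * ri * b) • T * Dk + Di * (t * rk * b) • T := by
  rw [smul_mul_assoc, smul_mul_assoc, mul_smul_comm, mul_smul_comm, hi, hk]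
  module

theorem dunkl_comm [Finite G] (ρ : G →* Matrix (Fin n) (Fin n) K) (c : ConjClasses G → K)
    (τ : Representation K G V) (i k : Fin n) :
    dunkl ρ c τ i * dunkl ρ c τ k = dunkl ρ c τ k * dunkl ρ c τ i := by
  have hX : ∀ j, (dunkl ρ c τ i * dunkl ρ c τ k - dunkl ρ c τ k * dunkl ρ c τ i) * mulOp K V j =
      mulOp K V j * (dunkl ρ c τ i * dunkl ρ c τ k - dunkl ρ c τ k * dunkl ρ c τ i) := fun j => by
    refine commute_aux (E := Module.End K (MvPolynomial (Fin n) K ⊗[K] V))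
      (Di := dunkl ρ c τ i) (Dk := dunkl ρ c τ k) (X := mulOp K V j)
      (dunkl_mulOp ρ c τ i j) (dunkl_mulOp ρ c τ k j) ?_
    rw [Finset.sum_mul, Finset.sum_mul, Finset.mul_sum, Finset.mul_sum, ← Finset.sum_add_distrib,
      ← Finset.sum_add_distrib]
    exact Finset.sum_congr rfl fun s hs => commute_aux_smul
      (E := Module.End K (MvPolynomial (Fin n) K ⊗[K] V)) (T := groupOp ρ τ s)
      (Di := dunkl ρ c τ i) (Dk := dunkl ρ c τ k)
      (groupOp_dunkl_eq_add ρ c τ (mem_reflections.mp hs) i)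
      (groupOp_dunkl_eq_add ρ c τ (mem_reflections.mp hs) k) _ _
  rw [← sub_eq_zero]
  refine LinearMap.ext fun F => ?_
  rw [LinearMap.zero_apply]
  induction F using verma_induction with
  | h1 v => simp [dunkl_one_tmul]
  | hadd F H hF hH => rw [map_add, hF, hH, add_zero]
  | hX j F hF => rw [← Module.End.mul_apply, hX, Module.End.mul_apply, hF, map_zero]

/-- The operator on `Sym(𝔥*) ⊗ τ` by which a generator of the Cherednik algebra acts. -/
def genOp [Finite G] (ρ : G →* Matrix (Fin n) (Fin n) K) (c : ConjClasses G → K)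
    (τ : Representation K G V) : Gen G n → Module.End K (MvPolynomial (Fin n) K ⊗[K] V)
  | .g g => groupOp ρ τ g
  | .x j => mulOp K V j
  | .y i => dunkl ρ c τ i

theorem genOp_rel [Finite G] (ρ : G →* Matrix (Fin n) (Fin n) K) (c : ConjClasses G → K)
    (τ : Representation K G V) {a b : FreeAlgebra K (Gen G n)} (h : Rel ρ c a b) :
    FreeAlgebra.lift K (genOp ρ c τ) a = FreeAlgebra.lift K (genOp ρ c τ) b := by
  induction h with
  | one => simp [genOp, groupOp_one]
  | mul g h => simp [genOp, groupOp_mul]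
  | gx g j => simp [genOp, groupOp_mulOp]
  | gy g i => simp [genOp, groupOp_dunkl ρ c τ g i]
  | xx i j => simp [genOp, mulOp_comm i j]
  | yy i j => simp [genOp, dunkl_comm ρ c τ i j]
  | yx i j => simp [genOp, dunkl_mulOp ρ c τ i j]

/-- The action of `H_{0,c}(G, 𝔥)` on `Sym(𝔥*) ⊗ τ`: `x ∈ 𝔥*` acts by multiplication, `g ∈ G` acts
diagonally and `y ∈ 𝔥` acts by the Dunkl operator. -/
def vermaAction [Finite G] (ρ : G →* Matrix (Fin n) (Fin n) K) (c : ConjClasses G → K)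
    (τ : Representation K G V) :
    CherednikAlgebra ρ c →ₐ[K] Module.End K (MvPolynomial (Fin n) K ⊗[K] V) :=
  RingQuot.liftAlgHom K ⟨FreeAlgebra.lift K (genOp ρ c τ), fun _ _ h => genOp_rel ρ c τ h⟩

theorem vermaAction_of [Finite G] (ρ : G →* Matrix (Fin n) (Fin n) K) (c : ConjClasses G → K)
    (τ : Representation K G V) (a : Gen G n) :
    vermaAction ρ c τ (CherednikAlgebra.of ρ c a) = genOp ρ c τ a := by
  exact (RingQuot.liftAlgHom_mkAlgHom_apply _ _ _ _).trans (FreeAlgebra.lift_ι_apply _ _)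

/-- The Verma module `M_{0,c}(G, 𝔥, τ) = Sym(𝔥*) ⊗ τ`. That it is the module induced from the
`K[G] ⋉ Sym(𝔥)`-module `τ` is the content of `Verma.existsUnique_hom`. -/
@[nolint unusedArguments]
def Verma [Finite G] (_ρ : G →* Matrix (Fin n) (Fin n) K) (_c : ConjClasses G → K)
    (_τ : Representation K G V) : Type _ :=
  MvPolynomial (Fin n) K ⊗[K] V

instance [Finite G] (ρ : G →* Matrix (Fin n) (Fin n) K) (c : ConjClasses G → K)
    (τ : Representation K G V) : AddCommGroup (Verma ρ c τ) :=
  inferInstanceAs (AddCommGroup (MvPolynomial (Fin n) K ⊗[K] V))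

instance [Finite G] (ρ : G →* Matrix (Fin n) (Fin n) K) (c : ConjClasses G → K)
    (τ : Representation K G V) : Module K (Verma ρ c τ) :=
  inferInstanceAs (Module K (MvPolynomial (Fin n) K ⊗[K] V))

/-- An element of `Sym(𝔥*) ⊗ τ`, viewed as an element of the Verma module. -/
def Verma.of [Finite G] (ρ : G →* Matrix (Fin n) (Fin n) K) (c : ConjClasses G → K)
    (τ : Representation K G V) : MvPolynomial (Fin n) K ⊗[K] V ≃ₗ[K] Verma ρ c τ :=
  LinearEquiv.refl K _

instance [Finite G] (ρ : G →* Matrix (Fin n) (Fin n) K) (c : ConjClasses G → K)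
    (τ : Representation K G V) : Module (CherednikAlgebra ρ c) (Verma ρ c τ) :=
  Module.compHom (MvPolynomial (Fin n) K ⊗[K] V) (vermaAction ρ c τ).toRingHom

theorem Verma.of_smul [Finite G] (ρ : G →* Matrix (Fin n) (Fin n) K) (c : ConjClasses G → K)
    (τ : Representation K G V) (a : Gen G n) (F : MvPolynomial (Fin n) K ⊗[K] V) :
    CherednikAlgebra.of ρ c a • Verma.of ρ c τ F = Verma.of ρ c τ (genOp ρ c τ a F) := by
  rw [← vermaAction_of]
  rfl

/-- Evaluation of polynomials at pairwise commuting elements of an algebra. -/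
def commEval {E : Type*} [Ring E] [Algebra K E] (d : Fin n → E)
    (hd : ∀ i j, d i * d j = d j * d i) : MvPolynomial (Fin n) K →ₐ[K] E :=
  letI : IsMulCommutative (Algebra.adjoin K (Set.range d)) :=
    Algebra.isMulCommutative_adjoin K (by rintro _ ⟨i, rfl⟩ _ ⟨j, rfl⟩; exact hd i j)
  letI : CommRing (Algebra.adjoin K (Set.range d)) :=
    { (inferInstance : Ring (Algebra.adjoin K (Set.range d))) with
      mul_comm := fun a b => mul_comm' a b }
  (Algebra.adjoin K (Set.range d)).val.comp
    (MvPolynomial.aeval fun i => ⟨d i, Algebra.subset_adjoin ⟨i, rfl⟩⟩)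

theorem commEval_X {E : Type*} [Ring E] [Algebra K E] (d : Fin n → E)
    (hd : ∀ i j, d i * d j = d j * d i) (i : Fin n) :
    commEval d hd (MvPolynomial.X i : MvPolynomial (Fin n) K) = d i := by
  simp [commEval]

theorem CherednikAlgebra.lift_rel [Finite G] (ρ : G →* Matrix (Fin n) (Fin n) K)
    (c : ConjClasses G → K) {a b : FreeAlgebra K (Gen G n)} (h : Rel ρ c a b) :
    FreeAlgebra.lift K (CherednikAlgebra.of ρ c) a =
      FreeAlgebra.lift K (CherednikAlgebra.of ρ c) b := by
  have h1 : FreeAlgebra.lift K (CherednikAlgebra.of ρ c) = RingQuot.mkAlgHom K (Rel ρ c) :=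
    FreeAlgebra.hom_ext (funext fun a => FreeAlgebra.lift_ι_apply _ _)
  rw [h1]
  exact RingQuot.mkAlgHom_rel K h

theorem CherednikAlgebra.induction [Finite G] {ρ : G →* Matrix (Fin n) (Fin n) K}
    {c : ConjClasses G → K} {p : CherednikAlgebra ρ c → Prop}
    (hK : ∀ t, p (algebraMap K _ t)) (hof : ∀ a, p (CherednikAlgebra.of ρ c a))
    (hadd : ∀ a b, p a → p b → p (a + b)) (hmul : ∀ a b, p a → p b → p (a * b)) (h) : p h := by
  obtain ⟨h, rfl⟩ := RingQuot.mkAlgHom_surjective K (Rel ρ c) h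
  induction h using FreeAlgebra.induction with
  | grade0 t => rw [AlgHom.commutes]; exact hK t
  | grade1 a => exact hof a
  | mul a b ha hb => rw [map_mul]; exact hmul _ _ ha hb
  | add a b ha hb => rw [map_add]; exact hadd _ _ ha hb

instance [Finite G] (ρ : G →* Matrix (Fin n) (Fin n) K) (c : ConjClasses G → K)
    (τ : Representation K G V) : IsScalarTower K (CherednikAlgebra ρ c) (Verma ρ c τ) where
  smul_assoc t h F := by
    change vermaAction ρ c τ (t • h) F = t • vermaAction ρ c τ h F
    rw [map_smul]
    rfl

/-- Frobenius reciprocity: the Verma module is induced from the `K[G] ⋉ Sym(𝔥)`-module `τ`. -/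
theorem Verma.existsUnique_hom [Finite G] (ρ : G →* Matrix (Fin n) (Fin n) K)
    (c : ConjClasses G → K) (τ : Representation K G V) {N : Type*} [AddCommGroup N] [Module K N]
    [Module (CherednikAlgebra ρ c) N] [IsScalarTower K (CherednikAlgebra ρ c) N]
    (φ : V →ₗ[K] N) (hg : ∀ g v, CherednikAlgebra.of ρ c (.g g) • φ v = φ (τ g v))
    (hy : ∀ i v, CherednikAlgebra.of ρ c (.y i) • φ v = 0) :
    ∃! Φ : Verma ρ c τ →ₗ[CherednikAlgebra ρ c] N, ∀ v, Φ (Verma.of ρ c τ (1 ⊗ₜ v)) = φ v := by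
  have rx := fun i j => CherednikAlgebra.lift_rel ρ c (Rel.xx i j)
  have rg := fun g j => CherednikAlgebra.lift_rel ρ c (Rel.gx g j)
  have ry := fun i j => CherednikAlgebra.lift_rel ρ c (Rel.yx i j)
  simp only [map_mul, map_sum, map_smul, map_sub, map_neg, FreeAlgebra.lift_ι_apply] at rx rg ry
  let L := Algebra.lsmul K K N (A := CherednikAlgebra ρ c)
  let xev : MvPolynomial (Fin n) K →ₐ[K] Module.End K N :=
    commEval (fun j => L (CherednikAlgebra.of ρ c (.x j))) fun i j => by
      rw [← map_mul, ← map_mul, rx]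
  let Φ : MvPolynomial (Fin n) K ⊗[K] V →ₗ[K] N :=
    TensorProduct.lift ((LinearMap.lcomp K N φ).comp xev.toLinearMap)
  have hΦ : ∀ f v, Φ (f ⊗ₜ v) = xev f (φ v) := fun f v => rfl
  have h1 : ∀ v, Φ (1 ⊗ₜ v) = φ v := fun v => by rw [hΦ, map_one, Module.End.one_apply]
  have hx : ∀ j F, Φ (mulOp K V j F) = CherednikAlgebra.of ρ c (.x j) • Φ F := fun j F => by
    induction F using TensorProduct.induction_on with
    | zero => simp
    | add F H hF hH => rw [map_add, map_add, hF, hH, map_add, smul_add]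
    | tmul f v =>
      rw [mulOp_tmul, hΦ, hΦ, map_mul, Module.End.mul_apply]
      simp only [xev, commEval_X]
      rfl
  have hG : ∀ g F, Φ (groupOp ρ τ g F) = CherednikAlgebra.of ρ c (.g g) • Φ F := fun g F => by
    induction F using verma_induction with
    | h1 v =>
      have : groupOp ρ τ g (1 ⊗ₜ v) = 1 ⊗ₜ τ g v := by simp [groupOp]
      rw [this, h1, h1, hg]
    | hadd F H hF hH => simp only [map_add, smul_add, hF, hH]
    | hX j F hF =>
      have e := congrArg (· F) (groupOp_mulOp ρ τ g j)
      simp only [Module.End.mul_apply, LinearMap.sum_apply, LinearMap.smul_apply] at e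
      rw [e, hx, ← mul_smul, rg, mul_smul, ← hF, Finset.sum_smul, map_sum]
      refine Finset.sum_congr rfl fun l _ => ?_
      rw [map_smul, hx, smul_assoc]
  have hD : ∀ i F, Φ (dunkl ρ c τ i F) = CherednikAlgebra.of ρ c (.y i) • Φ F := fun i F => by
    induction F using verma_induction with
    | h1 v => rw [dunkl_one_tmul, map_zero, h1, hy]
    | hadd F H hF hH => simp only [map_add, smul_add, hF, hH]
    | hX j F hF =>
      have e := congrArg (· F) (dunkl_mulOp ρ c τ i j)
      simp only [Module.End.mul_apply, LinearMap.sum_apply, LinearMap.smul_apply,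
        LinearMap.sub_apply, LinearMap.neg_apply] at e
      rw [sub_eq_iff_eq_add] at e
      have e' := ry i j
      rw [sub_eq_iff_eq_add] at e'
      rw [e, hx, ← mul_smul, e', map_add, add_smul, hx, mul_smul, hF, map_neg, neg_smul, map_sum,
        Finset.sum_smul]
      congr 2
      refine Finset.sum_congr rfl fun s _ => ?_
      rw [map_smul, hG, smul_assoc]
  have hgen : ∀ a F, Φ (genOp ρ c τ a F) = CherednikAlgebra.of ρ c a • Φ F := fun a F => by
    cases a with
    | g g => exact hG g F
    | x j => exact hx j F
    | y i => exact hD i F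
  have hall : ∀ (h : CherednikAlgebra ρ c) F, Φ (vermaAction ρ c τ h F) = h • Φ F := fun h => by
    induction h using CherednikAlgebra.induction with
    | hK t => intro F; rw [AlgHom.commutes, Module.algebraMap_end_apply, map_smul, algebraMap_smul]
    | hof a => intro F; rw [vermaAction_of, hgen]
    | hadd a b ha hb => intro F; rw [map_add, LinearMap.add_apply, map_add, ha, hb, add_smul]
    | hmul a b ha hb => intro F; rw [map_mul, Module.End.mul_apply, ha, hb, mul_smul]
  refine ⟨{ toFun := fun F => Φ F, map_add' := fun F H => map_add Φ F H,
            map_smul' := fun h F => hall h F }, h1, fun Ψ hΨ => ?_⟩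
  refine LinearMap.ext fun F => ?_
  change Ψ (Verma.of ρ c τ F) = Φ F
  induction F using verma_induction with
  | h1 v => rw [hΨ, h1]
  | hadd F H hF hH => rw [map_add, map_add, hF, hH, map_add]
  | hX j F hF =>
    have e := Verma.of_smul ρ c τ (.x j) F
    change _ = Verma.of ρ c τ (mulOp K V j F) at e
    rw [← e, map_smul, hF, hx]

/-- The constant term `Sym(𝔥*) ⊗ τ → τ`. -/
def constTerm (K : Type*) [Field K] (n : ℕ) (V : Type*) [AddCommGroup V] [Module K V] :
    MvPolynomial (Fin n) K ⊗[K] V →ₗ[K] V :=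
  (TensorProduct.lid K V).toLinearMap.comp
    (TensorProduct.map (MvPolynomial.aeval (0 : Fin n → K)).toLinearMap LinearMap.id)

/-- `P ↦ P(D₁, …, Dₙ)`, the action of `Sym(𝔥)` on `Sym(𝔥*) ⊗ τ`. -/
def dunklEval [Finite G] (ρ : G →* Matrix (Fin n) (Fin n) K) (c : ConjClasses G → K)
    (τ : Representation K G V) :
    MvPolynomial (Fin n) K →ₐ[K] Module.End K (MvPolynomial (Fin n) K ⊗[K] V) :=
  commEval (dunkl ρ c τ) (dunkl_comm ρ c τ)

/-- The parameter `c̄` with `c̄ₛ = c_{s⁻¹}`. -/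
def barParam (c : ConjClasses G → K) : ConjClasses G → K :=
  Quotient.lift (fun g : G => c (ConjClasses.mk g⁻¹)) (by
    rintro a b h
    obtain ⟨g, rfl⟩ := isConj_iff.mp h
    exact congrArg c (ConjClasses.mk_eq_mk_iff_isConj.mpr (isConj_iff.mpr ⟨g, by group⟩)))

/-- The contravariant form `M_c(G, 𝔥, τ) × M_c̄(G, 𝔥*, τ*) → K`, given by
`β (F, P ⊗ w) = w ((P(D₁, …, Dₙ) F)(0))` for `P ∈ Sym(𝔥)` and `w ∈ τ*`;
`isContravariantForm_iff` shows that this is the unique contravariant form. -/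
def contravariantForm [Finite G] (ρ : G →* Matrix (Fin n) (Fin n) K) (c : ConjClasses G → K)
    (τ : Representation K G V) :
    (MvPolynomial (Fin n) K ⊗[K] V) →ₗ[K]
      (MvPolynomial (Fin n) K ⊗[K] Module.Dual K V) →ₗ[K] K :=
  LinearMap.flip (TensorProduct.lift (LinearMap.mk₂ K
    (fun P (w : Module.Dual K V) =>
      (w.comp (constTerm K n V)).comp (dunklEval ρ c τ P))
    (fun P Q w => by rw [map_add, LinearMap.comp_add])
    (fun t P w => by rw [map_smul, LinearMap.comp_smul])
    (fun P w w' => by rw [LinearMap.add_comp, LinearMap.add_comp])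
    (fun t P w => by rw [LinearMap.smul_comp, LinearMap.smul_comp])))

/-- The characterization of the contravariant form. On `M_c̄(G, 𝔥*, τ*) = Sym(𝔥) ⊗ τ*`, the
elements of `𝔥` act by multiplication and those of `𝔥*` by Dunkl operators. -/
structure IsContravariantForm [Finite G] (ρ : G →* Matrix (Fin n) (Fin n) K)
    (c : ConjClasses G → K) (τ : Representation K G V)
    (β : (MvPolynomial (Fin n) K ⊗[K] V) →ₗ[K]
      (MvPolynomial (Fin n) K ⊗[K] Module.Dual K V) →ₗ[K] K) : Prop where
  x_left : ∀ j F H, β (mulOp K V j F) H = β F (dunkl (dualRep ρ) (barParam c) τ.dual j H)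
  y_right : ∀ i F H, β F (mulOp K (Module.Dual K V) i H) = β (dunkl ρ c τ i F) H
  one_one : ∀ (v : V) (w : Module.Dual K V), β (1 ⊗ₜ v) (1 ⊗ₜ w) = w v

theorem contravariantForm_tmul [Finite G] (ρ : G →* Matrix (Fin n) (Fin n) K)
    (c : ConjClasses G → K) (τ : Representation K G V) (F : MvPolynomial (Fin n) K ⊗[K] V)
    (P : MvPolynomial (Fin n) K) (w : Module.Dual K V) :
    contravariantForm ρ c τ F (P ⊗ₜ w) = w (constTerm K n V (dunklEval ρ c τ P F)) := rfl

theorem contravariantForm_mulOp_right [Finite G] (ρ : G →* Matrix (Fin n) (Fin n) K)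
    (c : ConjClasses G → K) (τ : Representation K G V) (i : Fin n)
    (F : MvPolynomial (Fin n) K ⊗[K] V) (H : MvPolynomial (Fin n) K ⊗[K] Module.Dual K V) :
    contravariantForm ρ c τ F (mulOp K (Module.Dual K V) i H) =
      contravariantForm ρ c τ (dunkl ρ c τ i F) H := by
  induction H using TensorProduct.induction_on with
  | zero => simp
  | add H H' h h' => rw [map_add, map_add, h, h', map_add]
  | tmul P w =>
    rw [mulOp_tmul, contravariantForm_tmul, contravariantForm_tmul, mul_comm, map_mul,
      dunklEval, commEval_X, Module.End.mul_apply]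

theorem constTerm_groupOp (ρ : G →* Matrix (Fin n) (Fin n) K) (τ : Representation K G V) (g : G)
    (F : MvPolynomial (Fin n) K ⊗[K] V) :
    constTerm K n V (groupOp ρ τ g F) = τ g (constTerm K n V F) := by
  induction F using TensorProduct.induction_on with
  | zero => simp
  | add H H' h h' => rw [map_add, map_add, h, h', map_add, map_add]
  | tmul f v =>
    have h : ∀ f, (MvPolynomial.aeval (0 : Fin n → K)) (polyAct ρ g f) =
        (MvPolynomial.aeval (0 : Fin n → K)) f := fun f => by
      rw [← AlgHom.comp_apply]
      congr 1
      refine MvPolynomial.algHom_ext fun j => ?_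
      rw [AlgHom.comp_apply, polyAct_X]
      simp [linForm]
    simp only [constTerm, groupOp, TensorProduct.map_tmul, LinearMap.comp_apply,
      AlgHom.toLinearMap_apply, LinearMap.id_apply, LinearEquiv.coe_coe, TensorProduct.lid_tmul, h,
      map_smul]

theorem contravariantForm_groupOp [Finite G] (ρ : G →* Matrix (Fin n) (Fin n) K)
    (c : ConjClasses G → K) (τ : Representation K G V) (g : G)
    (F : MvPolynomial (Fin n) K ⊗[K] V) (H : MvPolynomial (Fin n) K ⊗[K] Module.Dual K V) :
    contravariantForm ρ c τ (groupOp ρ τ g F) (groupOp (dualRep ρ) τ.dual g H) =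
      contravariantForm ρ c τ F H := by
  induction H using verma_induction generalizing F with
  | h1 w =>
    have : groupOp (dualRep ρ) τ.dual g (1 ⊗ₜ w) = 1 ⊗ₜ τ.dual g w := by
      simp [groupOp]
    rw [this, contravariantForm_tmul, contravariantForm_tmul, map_one, Module.End.one_apply,
      Module.End.one_apply, constTerm_groupOp, Representation.dual_apply,
      Module.Dual.transpose_apply, LinearMap.comp_apply, ← Module.End.mul_apply, ← map_mul,
      inv_mul_cancel, map_one, Module.End.one_apply]
  | hadd H H' h h' => simp only [map_add, h, h']
  | hX i H h =>
    have hρ : ∀ l, dualRep ρ g⁻¹ i l = ρ g l i := fun l => by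
      simp [dualRep]
    have h1 := congrArg (· H) (groupOp_mulOp (dualRep ρ) τ.dual g i)
    have h2 := congrArg (· F) (groupOp_dunkl ρ c τ g i)
    simp only [Module.End.mul_apply, LinearMap.sum_apply, LinearMap.smul_apply, hρ] at h1 h2
    rw [h1, contravariantForm_mulOp_right, ← h, h2]
    simp only [map_sum, map_smul, LinearMap.sum_apply, LinearMap.smul_apply,
      contravariantForm_mulOp_right]

theorem contravariantForm_groupOp_left [Finite G] (ρ : G →* Matrix (Fin n) (Fin n) K)
    (c : ConjClasses G → K) (τ : Representation K G V) (g : G)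
    (F : MvPolynomial (Fin n) K ⊗[K] V) (H : MvPolynomial (Fin n) K ⊗[K] Module.Dual K V) :
    contravariantForm ρ c τ (groupOp ρ τ g F) H =
      contravariantForm ρ c τ F (groupOp (dualRep ρ) τ.dual g⁻¹ H) := by
  rw [← contravariantForm_groupOp ρ c τ g F, ← Module.End.mul_apply, groupOp_mul, mul_inv_cancel,
    groupOp_one, Module.End.one_apply]

theorem constTerm_mulOp (j : Fin n) (F : MvPolynomial (Fin n) K ⊗[K] V) :
    constTerm K n V (mulOp K V j F) = 0 := by
  induction F using TensorProduct.induction_on with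
  | zero => simp
  | add H H' h h' => rw [map_add, map_add, h, h', add_zero]
  | tmul f v => simp [mulOp_tmul, constTerm]

theorem contravariantForm_mulOp_left [Finite G] (ρ : G →* Matrix (Fin n) (Fin n) K)
    (c : ConjClasses G → K) (τ : Representation K G V) (j : Fin n)
    (F : MvPolynomial (Fin n) K ⊗[K] V) (H : MvPolynomial (Fin n) K ⊗[K] Module.Dual K V) :
    contravariantForm ρ c τ (mulOp K V j F) H =
      contravariantForm ρ c τ F (dunkl (dualRep ρ) (barParam c) τ.dual j H) := by
  induction H using verma_induction generalizing F with
  | h1 w =>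
    rw [dunkl_one_tmul, map_zero, contravariantForm_tmul, map_one, Module.End.one_apply,
      constTerm_mulOp, map_zero]
  | hadd H H' h h' => simp only [map_add, h, h']
  | hX i H h =>
    have h1 := congrArg (· F) (dunkl_mulOp ρ c τ i j)
    have h2 := congrArg (· H) (dunkl_mulOp (dualRep ρ) (barParam c) τ.dual j i)
    simp only [Module.End.mul_apply, LinearMap.sum_apply, LinearMap.smul_apply,
      LinearMap.sub_apply, LinearMap.neg_apply] at h1 h2
    rw [sub_eq_iff_eq_add] at h1 h2
    rw [contravariantForm_mulOp_right, h1, h2, map_add, map_add, contravariantForm_mulOp_right,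
      LinearMap.add_apply, h]
    congr 1
    simp only [map_neg, map_sum, map_smul, LinearMap.neg_apply, LinearMap.sum_apply,
      LinearMap.smul_apply, contravariantForm_groupOp_left]
    rw [neg_inj]
    refine Finset.sum_equiv (Equiv.inv G) ?_ ?_
    · intro s
      simp only [mem_reflections, Equiv.inv_apply]
      refine ⟨isReflection_dualRep_inv ρ, fun hs => ?_⟩
      have := isReflection_dualRep_inv (dualRep ρ) hs
      rwa [dualRep_dualRep, inv_inv] at this
    · intro s hs
      rw [mem_reflections] at hs
      have hr : root (dualRep ρ) s⁻¹ j * coroot (dualRep ρ) s⁻¹ i =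
          root ρ s i * coroot ρ s j := by
        have e1 := congrFun (congrFun (one_sub_eq_root ρ hs) j) i
        have e2 := congrFun (congrFun
          (one_sub_eq_root (dualRep ρ) (isReflection_dualRep_inv ρ hs)) i) j
        have e3 : (1 - dualRep ρ s⁻¹⁻¹) = (1 - ρ s⁻¹).transpose := by
          simp [dualRep, Matrix.transpose_sub]
        rw [e3, Matrix.transpose_apply, e1, Matrix.vecMulVec_apply, Matrix.vecMulVec_apply] at e2
        rw [mul_comm, ← e2, mul_comm]
      have hc : barParam c (ConjClasses.mk s⁻¹) = c (ConjClasses.mk s) := by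
        change c (ConjClasses.mk s⁻¹⁻¹) = _
        rw [inv_inv]
      rw [Equiv.inv_apply, mul_assoc, mul_assoc, hr, hc]

/-- Existence and uniqueness of the contravariant form. -/
theorem isContravariantForm_iff [Finite G] (ρ : G →* Matrix (Fin n) (Fin n) K)
    (c : ConjClasses G → K) (τ : Representation K G V)
    (β : (MvPolynomial (Fin n) K ⊗[K] V) →ₗ[K]
      (MvPolynomial (Fin n) K ⊗[K] Module.Dual K V) →ₗ[K] K) :
    IsContravariantForm ρ c τ β ↔ β = contravariantForm ρ c τ := by
  have hβ : IsContravariantForm ρ c τ (contravariantForm ρ c τ) :=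
    ⟨contravariantForm_mulOp_left ρ c τ, contravariantForm_mulOp_right ρ c τ, fun v w => by
      simp [contravariantForm_tmul, constTerm]⟩
  refine ⟨fun h => ?_, fun h => h ▸ hβ⟩
  refine LinearMap.ext fun F => LinearMap.ext fun H => ?_
  induction H using verma_induction generalizing F with
  | hadd H H' h h' => simp only [map_add, h, h']
  | hX i H ih => rw [h.y_right, hβ.y_right, ih]
  | h1 w =>
    induction F using verma_induction with
    | h1 v => rw [h.one_one, hβ.one_one]
    | hadd F F' h h' => simp only [map_add, LinearMap.add_apply, h, h']
    | hX j F _ => rw [h.x_left, hβ.x_left, dunkl_one_tmul, map_zero, map_zero]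
/-- The parameters are generic: the values `cₛ` at the conjugacy classes of reflections are
algebraically independent over the prime subfield of `K`. -/
def IsGeneric (ρ : G →* Matrix (Fin n) (Fin n) K) (c : ConjClasses G → K) : Prop :=
  AlgebraicIndependent (⊥ : Subfield K)
    fun C : {C : ConjClasses G // ∃ s, IsReflection ρ s ∧ ConjClasses.mk s = C} => c C

/-- The kernel in `M_c(G, 𝔥, τ)` of the contravariant form. -/
def formKernel [Finite G] (ρ : G →* Matrix (Fin n) (Fin n) K) (c : ConjClasses G → K)
    (τ : Representation K G V) : Submodule K (MvPolynomial (Fin n) K ⊗[K] V) :=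
  LinearMap.ker (contravariantForm ρ c τ)

/-- The `Sym(𝔥*)`-submodule generated by the elements of `J` after substituting `xᵢ ↦ xᵢ^q`. -/
def powSubmodule (q : ℕ) (J : Submodule K (MvPolynomial (Fin n) K ⊗[K] V)) :
    Submodule (MvPolynomial (Fin n) K) (MvPolynomial (Fin n) K ⊗[K] V) :=
  Submodule.span _
    (TensorProduct.map (MvPolynomial.expand q).toLinearMap (LinearMap.id (M := V)) '' J)

/-- The projection of `Sym(𝔥*) ⊗ τ` to its component of degree `d`. -/
def component (K : Type*) [Field K] (n : ℕ) (V : Type*) [AddCommGroup V] [Module K V] (d : ℕ) :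
    Module.End K (MvPolynomial (Fin n) K ⊗[K] V) :=
  TensorProduct.map (MvPolynomial.homogeneousComponent d) LinearMap.id

/-- `J` is a graded subspace of `Sym(𝔥*) ⊗ τ`. -/
def IsGraded (J : Submodule K (MvPolynomial (Fin n) K ⊗[K] V)) : Prop :=
  ∀ F ∈ J, ∀ d, component K n V d F ∈ J

/-- The Hilbert series of `M / J`, where `M = Sym(𝔥*) ⊗ τ` and `J` is a graded subspace: the
coefficient of `t^d` is the dimension of the image of the degree `d` part of `M`. -/
def hilbertSeries (J : Submodule K (MvPolynomial (Fin n) K ⊗[K] V)) : PowerSeries ℤ :=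
  PowerSeries.mk fun d =>
    (Module.finrank K ((LinearMap.range (component K n V d)).map J.mkQ) : ℤ)

end General

section ImprimitiveGroups

variable {K : Type*} [Field K] {n : ℕ}

/-- The monomial matrix with entry `ε j` at the place `(σ j, j)` and zeros elsewhere. -/
def monomialMatrix (σ : Equiv.Perm (Fin n)) (ε : Fin n → Kˣ) : Matrix (Fin n) (Fin n) K :=
  Matrix.of fun i j => if i = σ j then (ε j : K) else 0

theorem monomialMatrix_mul (σ σ' : Equiv.Perm (Fin n)) (ε ε' : Fin n → Kˣ) :
    monomialMatrix σ ε * monomialMatrix σ' ε' =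
      monomialMatrix (σ * σ') fun j => ε (σ' j) * ε' j := by
  ext i j
  simp [monomialMatrix, Matrix.mul_apply]
  congr

theorem monomialMatrix_one : monomialMatrix (1 : Equiv.Perm (Fin n)) (fun _ => (1 : Kˣ)) = 1 := by
  ext i j
  simp [monomialMatrix, Matrix.one_apply]
  congr

theorem monomialMatrix_map_pow (σ : Equiv.Perm (Fin n)) (ε : Fin n → Kˣ) {q : ℕ} (hq : q ≠ 0) :
    (monomialMatrix σ ε).map (· ^ q) = monomialMatrix σ fun j => ε j ^ q := by
  ext i j
  by_cases h : i = σ j <;> simp [monomialMatrix, h, hq]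

/-- The group `G(m, r, n)` of monomial `n × n` matrices whose nonzero entries are `m`-th roots of
unity with product an `(m/r)`-th root of unity. -/
def imprimitiveGroup (K : Type*) [Field K] (m r n : ℕ) :
    Subgroup (Matrix.GeneralLinearGroup (Fin n) K) where
  carrier := {g | ∃ (σ : Equiv.Perm (Fin n)) (ε : Fin n → Kˣ),
    (g : Matrix (Fin n) (Fin n) K) = monomialMatrix σ ε ∧ (∀ i, ε i ^ m = 1) ∧
      (∏ i, ε i) ^ (m / r) = 1}
  one_mem' := ⟨1, fun _ => 1, monomialMatrix_one.symm, by simp, by simp⟩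
  mul_mem' := by
    rintro g h ⟨σ, ε, hg, hε, hp⟩ ⟨σ', ε', hh, hε', hp'⟩
    refine ⟨σ * σ', fun j => ε (σ' j) * ε' j, ?_, fun i => ?_, ?_⟩
    · rw [Units.val_mul, hg, hh, monomialMatrix_mul]
    · rw [mul_pow, hε, hε', one_mul]
    · rw [Finset.prod_mul_distrib, Equiv.prod_comp σ' ε, mul_pow, hp, hp', one_mul]
  inv_mem' := by
    rintro g ⟨σ, ε, hg, hε, hp⟩
    refine ⟨σ⁻¹, fun j => (ε (σ⁻¹ j))⁻¹, ?_, fun i => ?_, ?_⟩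
    · refine Units.inv_eq_of_mul_eq_one_right ?_
      rw [hg, monomialMatrix_mul, mul_inv_cancel, ← monomialMatrix_one]
      congr 1
      funext j
      simp
    · rw [inv_pow, hε, inv_one]
    · rw [Finset.prod_inv_distrib, Equiv.prod_comp σ⁻¹ ε, inv_pow, hp, inv_one]

instance (m r : ℕ) [NeZero m] : Finite (imprimitiveGroup K m r n) := by
  choose σ ε h hε _ using fun g : imprimitiveGroup K m r n => g.2
  refine Finite.of_injective (β := Equiv.Perm (Fin n) × (Fin n → rootsOfUnity m K))
    (fun g => (σ g, fun i => ⟨ε g i, (mem_rootsOfUnity m _).mpr (hε g i)⟩)) fun g g' hgg => ?_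
  rw [Prod.mk.injEq] at hgg
  have h2 : ε g = ε g' := funext fun i => congrArg Subtype.val (congrFun hgg.2 i)
  exact Subtype.ext (Units.ext (by rw [h, h, hgg.1, h2]))

/-- The defining representation of `G(m, r, n)` on `𝔥 = Kⁿ`. -/
def stdRep (K : Type*) [Field K] (m r n : ℕ) :
    imprimitiveGroup K m r n →* Matrix (Fin n) (Fin n) K :=
  (Units.coeHom _).comp (imprimitiveGroup K m r n).subtype

theorem exists_monomial {m r : ℕ} (g : imprimitiveGroup K m r n) :
    ∃ (σ : Equiv.Perm (Fin n)) (ε : Fin n → Kˣ), stdRep K m r n g = monomialMatrix σ ε ∧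
      (∀ i, ε i ^ m = 1) ∧ (∏ i, ε i) ^ (m / r) = 1 := g.2

theorem stdRep_injective (m r : ℕ) : Function.Injective (stdRep K m r n) :=
  Units.val_injective.comp Subtype.val_injective

theorem map_pow_mul {m r : ℕ} {q : ℕ} (hq : q ≠ 0) (g h : imprimitiveGroup K m r n) :
    (stdRep K m r n (g * h)).map (· ^ q) =
      (stdRep K m r n g).map (· ^ q) * (stdRep K m r n h).map (· ^ q) := by
  obtain ⟨σ, ε, hg, -⟩ := exists_monomial g
  obtain ⟨σ', ε', hh, -⟩ := exists_monomial h
  rw [map_mul, hg, hh, monomialMatrix_mul, monomialMatrix_map_pow _ _ hq,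
    monomialMatrix_map_pow _ _ hq, monomialMatrix_map_pow _ _ hq, monomialMatrix_mul]
  simp only [mul_pow]

theorem map_pow_one {m r : ℕ} {q : ℕ} (hq : q ≠ 0) :
    (stdRep K m r n 1).map (· ^ q) = 1 := by
  rw [map_one, ← monomialMatrix_one, monomialMatrix_map_pow _ _ hq]
  simp

theorem div_ne_zero_of_dvd {m r : ℕ} [NeZero m] (hr : r ∣ m) : m / r ≠ 0 :=
  (Nat.div_pos (Nat.le_of_dvd (NeZero.pos m) hr)
    (Nat.pos_of_dvd_of_pos hr (NeZero.pos m))).ne'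

/-- The homomorphism `G(m, r, n) → G(r, r, n)` raising each matrix entry to the power `m / r`. -/
def powHom {m r : ℕ} [NeZero m] (hr : r ∣ m) :
    imprimitiveGroup K m r n →* imprimitiveGroup K r r n where
  toFun g := ⟨⟨(stdRep K m r n g).map (· ^ (m / r)), (stdRep K m r n g⁻¹).map (· ^ (m / r)),
      by rw [← map_pow_mul (div_ne_zero_of_dvd hr), mul_inv_cancel,
        map_pow_one (div_ne_zero_of_dvd hr)],
      by rw [← map_pow_mul (div_ne_zero_of_dvd hr), inv_mul_cancel,
        map_pow_one (div_ne_zero_of_dvd hr)]⟩, by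
    obtain ⟨σ, ε, hg, hε, hp⟩ := exists_monomial g
    refine ⟨σ, fun j => ε j ^ (m / r), ?_, fun i => ?_, ?_⟩
    · change (stdRep K m r n g).map (· ^ (m / r)) = _
      rw [hg, monomialMatrix_map_pow _ _ (div_ne_zero_of_dvd hr)]
    · rw [← pow_mul, Nat.div_mul_cancel hr, hε]
    · rw [Finset.prod_pow, hp, one_pow]⟩
  map_one' := Subtype.ext (Units.ext (map_pow_one (div_ne_zero_of_dvd hr)))
  map_mul' g h := Subtype.ext (Units.ext (map_pow_mul (div_ne_zero_of_dvd hr) g h))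

open Classical in
/-- The parameter of `G(r, r, n)` corresponding to a parameter `c` of `G(m, r, n)`: its value at the
class of a reflection `s'` is `cₛ` for any reflection `s` of `G(m, r, n)` lying over `s'` (these
reflections `s` are all conjugate). -/
def inducedParam {m r : ℕ} [NeZero m] (hr : r ∣ m)
    (c : ConjClasses (imprimitiveGroup K m r n) → K) :
    ConjClasses (imprimitiveGroup K r r n) → K := fun C' =>
  if h : ∃ s, IsReflection (stdRep K m r n) s ∧ ConjClasses.mk (powHom hr s) = C' then
    c (ConjClasses.mk h.choose)
  else 0

end ImprimitiveGroups

end Cherednik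

end

/-! Every F in M has a unique expansion F = ∑ x^a F_a(x_1^q, …, x_n^q) over exponents a with 0 ≤ a_l
< q, and the proof works with the coefficients F_a. Since J^1 is stable under multiplication by the
x_j, J^q consists exactly of the F whose coefficients all lie in J^1 (`mem_powSubmodule_iff`). Hence
M/J^q is a sum of q^n copies of M/J^1, the copy at a having its degrees multiplied by q and shifted
by |a|; this gives the grading and the Hilbert series (`hilbertSeries_powSubmodule`).

The Dunkl operators respect this expansion: D_i (x^a F(x^q)) = x^b (T F)(x^q), where b is a with its
i-th entry lowered modulo q (`dunkl_monOp`). Write D'_i for the Dunkl operator of G'. If a_i = 0,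
then T = q D'_i. Otherwise T = t + B with B = q (x_i D'_i - ∑ c'_s s), the sum being over the
reflections of G' that exchange i with some j such that a_j < a_i, and with t a scalar coming from
the diagonal reflections of G. The formula is obtained by summing the divided differences over the q
reflections of G above one reflection of G'; orthogonality of q-th roots of unity leaves a single
power of the variables (`sum_rootDiff_swapElem`). All these T preserve J^1, and the substitution x_i
↦ x_i^q is equivariant along π, so J^q is a submodule.

For irreducibility it is enough that an F without constant term, all of whose images D_i F lie in
J^q, lies in J^q (`isSimpleModule_quotient_vermaSubmodule`). For such an F each T F_a is in J^1. If
a = 0, then D'_i F_0 ∈ J^1 for all i, q being invertible in K, and the contravariant form gives F_0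
∈ J^1. If some a_i ≠ 0, genericity is needed: there is a subfield L containing the matrix entries of
G' and the values of c' over which t is not integral (`exists_subfield_of_isGeneric`). The operator
B preserves finitely generated L-lattices that exhaust M after extension of scalars, so by
Cayley–Hamilton t + B is injective modulo the B-stable subspace J^1 (`mem_of_smul_add_mem`), and F_a
∈ J^1. -/

open scoped TensorProduct

noncomputable section

namespace Cherednik

/-! ### The grading of the Verma module and its compatibility with the operators. -/

section Grading

variable {K : Type*} [Field K] {G : Type*} [Group G] {n : ℕ}
variable {V : Type*} [AddCommGroup V] [Module K V]

theorem homogeneousComponent_succ_X_mul (d : ℕ) (j : Fin n) (f : MvPolynomial (Fin n) K) :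
    MvPolynomial.homogeneousComponent (d + 1) (MvPolynomial.X j * f) =
      MvPolynomial.X j * MvPolynomial.homogeneousComponent d f := by
  classical
  ext b
  rw [MvPolynomial.coeff_homogeneousComponent, MvPolynomial.coeff_X_mul',
    MvPolynomial.coeff_X_mul']
  by_cases h : j ∈ b.support
  · obtain ⟨a, rfl⟩ : ∃ a, b = Finsupp.single j 1 + a :=
      ⟨b - Finsupp.single j 1, (add_tsub_cancel_of_le (by
        rw [Finsupp.single_le_iff]
        exact Nat.one_le_iff_ne_zero.mpr (Finsupp.mem_support_iff.mp h))).symm⟩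
    rw [if_pos h, if_pos h, MvPolynomial.coeff_homogeneousComponent, add_tsub_cancel_left]
    simp only [map_add, Finsupp.degree_single, add_comm 1, add_left_inj]
  · rw [if_neg h, if_neg h, ite_self]

theorem homogeneousComponent_zero_X_mul (j : Fin n) (f : MvPolynomial (Fin n) K) :
    MvPolynomial.homogeneousComponent 0 (MvPolynomial.X j * f) = 0 := by
  classical
  rw [MvPolynomial.homogeneousComponent_zero, MvPolynomial.coeff_X_mul']
  simp

theorem component_succ_mulOp (d : ℕ) (j : Fin n) (F : MvPolynomial (Fin n) K ⊗[K] V) :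
    component K n V (d + 1) (mulOp K V j F) = mulOp K V j (component K n V d F) := by
  induction F using TensorProduct.induction_on with
  | zero => simp
  | add F H hF hH => simp only [map_add, hF, hH]
  | tmul f v =>
    simp only [mulOp_tmul, component, TensorProduct.map_tmul, homogeneousComponent_succ_X_mul]

theorem component_zero_mulOp (j : Fin n) (F : MvPolynomial (Fin n) K ⊗[K] V) :
    component K n V 0 (mulOp K V j F) = 0 := by
  induction F using TensorProduct.induction_on with
  | zero => simp
  | add F H hF hH => simp only [map_add, hF, hH, add_zero]
  | tmul f v =>
    simp only [mulOp_tmul, component, TensorProduct.map_tmul, homogeneousComponent_zero_X_mul,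
      TensorProduct.zero_tmul]

theorem component_one_tmul (d : ℕ) (v : V) :
    component K n V d (1 ⊗ₜ v) = if d = 0 then 1 ⊗ₜ v else 0 := by
  have h : MvPolynomial.homogeneousComponent d (1 : MvPolynomial (Fin n) K) =
      if d = 0 then 1 else 0 := by
    rw [MvPolynomial.homogeneousComponent_of_mem (MvPolynomial.isHomogeneous_one (Fin n) K)]
  simp only [component, TensorProduct.map_tmul, h, LinearMap.id_apply]
  split_ifs <;> simp

theorem groupOp_one_tmul (ρ : G →* Matrix (Fin n) (Fin n) K) (τ : Representation K G V) (g : G)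
    (v : V) : groupOp ρ τ g (1 ⊗ₜ v) = 1 ⊗ₜ τ g v := by
  simp [groupOp]

theorem groupOp_mulOp_apply (ρ : G →* Matrix (Fin n) (Fin n) K) (τ : Representation K G V)
    (g : G) (j : Fin n) (F : MvPolynomial (Fin n) K ⊗[K] V) :
    groupOp ρ τ g (mulOp K V j F) = ∑ l, ρ g⁻¹ j l • mulOp K V l (groupOp ρ τ g F) := by
  have h := congrArg (· F) (groupOp_mulOp ρ τ g j)
  simpa only [Module.End.mul_apply, LinearMap.sum_apply, LinearMap.smul_apply] using h

theorem dunkl_mulOp_apply [Finite G] (ρ : G →* Matrix (Fin n) (Fin n) K)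
    (c : ConjClasses G → K) (τ : Representation K G V) (i j : Fin n)
    (F : MvPolynomial (Fin n) K ⊗[K] V) :
    dunkl ρ c τ i (mulOp K V j F) = mulOp K V j (dunkl ρ c τ i F) -
      ∑ s ∈ reflections ρ,
        (c (ConjClasses.mk s) * root ρ s i * coroot ρ s j) • groupOp ρ τ s F := by
  have h := congrArg (· F) (dunkl_mulOp ρ c τ i j)
  simp only [Module.End.mul_apply, LinearMap.sum_apply, LinearMap.smul_apply, LinearMap.sub_apply,
    LinearMap.neg_apply] at h
  rw [sub_eq_iff_eq_add] at h
  rw [h, neg_add_eq_sub]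

theorem component_groupOp (ρ : G →* Matrix (Fin n) (Fin n) K) (τ : Representation K G V) (g : G)
    (d : ℕ) (F : MvPolynomial (Fin n) K ⊗[K] V) :
    component K n V d (groupOp ρ τ g F) = groupOp ρ τ g (component K n V d F) := by
  induction F using verma_induction generalizing d with
  | h1 v =>
    rw [groupOp_one_tmul, component_one_tmul, component_one_tmul]
    split_ifs
    · rw [groupOp_one_tmul]
    · rw [map_zero]
  | hadd F H hF hH => simp only [map_add, hF, hH]
  | hX j F hF =>
    rw [groupOp_mulOp_apply]
    cases d with
    | zero => simp only [map_sum, map_smul, component_zero_mulOp, smul_zero,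
        Finset.sum_const_zero, map_zero]
    | succ d =>
      simp only [map_sum, map_smul, component_succ_mulOp, hF, groupOp_mulOp_apply]

theorem dunkl_component_zero [Finite G] (ρ : G →* Matrix (Fin n) (Fin n) K)
    (c : ConjClasses G → K) (τ : Representation K G V) (i : Fin n)
    (F : MvPolynomial (Fin n) K ⊗[K] V) : dunkl ρ c τ i (component K n V 0 F) = 0 := by
  induction F using verma_induction with
  | h1 v => rw [component_one_tmul, if_pos rfl, dunkl_one_tmul]
  | hadd F H hF hH => simp only [map_add, hF, hH, add_zero]
  | hX j F hF => rw [component_zero_mulOp, map_zero]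

/-- Dunkl operators lower the degree by one. -/
theorem component_dunkl [Finite G] (ρ : G →* Matrix (Fin n) (Fin n) K)
    (c : ConjClasses G → K) (τ : Representation K G V) (i : Fin n) (d : ℕ)
    (F : MvPolynomial (Fin n) K ⊗[K] V) :
    component K n V d (dunkl ρ c τ i F) = dunkl ρ c τ i (component K n V (d + 1) F) := by
  induction F using verma_induction generalizing d with
  | h1 v => rw [component_one_tmul, if_neg d.succ_ne_zero, dunkl_one_tmul, map_zero, map_zero]
  | hadd F H hF hH => simp only [map_add, hF, hH]
  | hX j F hF =>
    rw [component_succ_mulOp, dunkl_mulOp_apply, dunkl_mulOp_apply, map_sub]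
    simp only [map_sum, map_smul, component_groupOp]
    congr 1
    cases d with
    | zero => rw [component_zero_mulOp, dunkl_component_zero, map_zero]
    | succ d => rw [component_succ_mulOp, hF]

theorem constTerm_one_tmul (v : V) : constTerm K n V (1 ⊗ₜ v) = v := by
  simp [constTerm]

theorem constTerm_component (d : ℕ) (F : MvPolynomial (Fin n) K ⊗[K] V) :
    constTerm K n V (component K n V d F) = if d = 0 then constTerm K n V F else 0 := by
  induction F using verma_induction with
  | h1 v => rw [component_one_tmul]; split_ifs <;> simp
  | hadd F H hF hH => rw [map_add, map_add, map_add, hF, hH]; split_ifs <;> simp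
  | hX j F hF =>
    rw [constTerm_mulOp, ite_self]
    cases d with
    | zero => rw [component_zero_mulOp, map_zero]
    | succ d => rw [component_succ_mulOp, constTerm_mulOp]

theorem exists_component_eq_zero (F : MvPolynomial (Fin n) K ⊗[K] V) :
    ∃ d, ∀ e, d ≤ e → component K n V e F = 0 := by
  induction F using verma_induction with
  | h1 v => exact ⟨1, fun e he => by rw [component_one_tmul, if_neg (by lia)]⟩
  | hadd F H hF hH =>
    obtain ⟨d, hd⟩ := hF
    obtain ⟨d', hd'⟩ := hH
    exact ⟨max d d', fun e he => by
      rw [map_add, hd e (le_trans (le_max_left _ _) he), hd' e (le_trans (le_max_right _ _) he),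
        add_zero]⟩
  | hX j F hF =>
    obtain ⟨d, hd⟩ := hF
    refine ⟨d + 1, fun e he => ?_⟩
    obtain ⟨e, rfl⟩ : ∃ e', e = e' + 1 := ⟨e - 1, by lia⟩
    rw [component_succ_mulOp, hd e (by lia), map_zero]

theorem eq_zero_of_component_eq_zero {F : MvPolynomial (Fin n) K ⊗[K] V}
    (h : ∀ d, component K n V d F = 0) : F = 0 := by
  -- The expansion is claimed for every larger cutoff e, so that two summands can share one range.
  have key : ∀ F : MvPolynomial (Fin n) K ⊗[K] V, ∃ d, ∀ e, d ≤ e →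
      F = ∑ i ∈ Finset.range e, component K n V i F := fun F => by
    induction F using TensorProduct.induction_on with
    | zero => exact ⟨0, by simp⟩
    | add F H hF hH =>
      obtain ⟨d, hd⟩ := hF
      obtain ⟨d', hd'⟩ := hH
      refine ⟨max d d', fun e he => ?_⟩
      simp only [map_add, Finset.sum_add_distrib]
      rw [← hd e (le_trans (le_max_left _ _) he), ← hd' e (le_trans (le_max_right _ _) he)]
    | tmul f v =>
      refine ⟨f.totalDegree + 1, fun e he => ?_⟩
      simp only [component, TensorProduct.map_tmul, LinearMap.id_apply, ← TensorProduct.sum_tmul]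
      congr 1
      conv_lhs => rw [← MvPolynomial.sum_homogeneousComponent f]
      refine Finset.sum_subset (by simpa using he) fun x _ hx => ?_
      exact MvPolynomial.homogeneousComponent_eq_zero _ _ (by simpa using hx)
  obtain ⟨d, hd⟩ := key F
  rw [hd d le_rfl]
  exact Finset.sum_eq_zero fun i _ => h i

end Grading

/-! ### The kernel of the contravariant form. -/

section FormKernel

variable {K : Type*} [Field K] {G : Type*} [Group G] [Finite G] {n : ℕ}
variable {V : Type*} [AddCommGroup V] [Module K V]
variable {ρ : G →* Matrix (Fin n) (Fin n) K} {c : ConjClasses G → K} {τ : Representation K G V}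

theorem mem_formKernel_iff {F : MvPolynomial (Fin n) K ⊗[K] V} :
    F ∈ formKernel ρ c τ ↔ ∀ H, contravariantForm ρ c τ F H = 0 := by
  rw [formKernel, LinearMap.mem_ker, LinearMap.ext_iff]
  rfl

theorem dunkl_mem_formKernel {F : MvPolynomial (Fin n) K ⊗[K] V} (hF : F ∈ formKernel ρ c τ)
    (i : Fin n) : dunkl ρ c τ i F ∈ formKernel ρ c τ := by
  rw [mem_formKernel_iff] at *
  intro H
  rw [← contravariantForm_mulOp_right, hF]

theorem mulOp_mem_formKernel {F : MvPolynomial (Fin n) K ⊗[K] V} (hF : F ∈ formKernel ρ c τ)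
    (j : Fin n) : mulOp K V j F ∈ formKernel ρ c τ := by
  rw [mem_formKernel_iff] at *
  intro H
  rw [contravariantForm_mulOp_left, hF]

theorem groupOp_mem_formKernel {F : MvPolynomial (Fin n) K ⊗[K] V} (hF : F ∈ formKernel ρ c τ)
    (g : G) : groupOp ρ τ g F ∈ formKernel ρ c τ := by
  rw [mem_formKernel_iff] at *
  intro H
  rw [contravariantForm_groupOp_left, hF]

theorem constTerm_eq_zero_of_mem_formKernel {F : MvPolynomial (Fin n) K ⊗[K] V}
    (hF : F ∈ formKernel ρ c τ) : constTerm K n V F = 0 := by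
  rw [mem_formKernel_iff] at hF
  refine (Module.forall_dual_apply_eq_zero_iff K _).mp fun w => ?_
  have h := hF (1 ⊗ₜ w)
  rwa [contravariantForm_tmul, map_one, Module.End.one_apply] at h

/-- Sym(𝔥) is generated in degree one and the form moves y to the left as a Dunkl operator, so
pairing with F involves only its constant term and its Dunkl images. This says that M modulo the
kernel has no singular vectors in positive degree. -/
theorem mem_formKernel_of_dunkl {F : MvPolynomial (Fin n) K ⊗[K] V}
    (h0 : constTerm K n V F = 0) (hF : ∀ i, dunkl ρ c τ i F ∈ formKernel ρ c τ) :
    F ∈ formKernel ρ c τ := by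
  rw [mem_formKernel_iff]
  intro H
  induction H using verma_induction with
  | h1 w => rw [contravariantForm_tmul, map_one, Module.End.one_apply, h0, map_zero]
  | hadd H H' h h' => rw [map_add, h, h', add_zero]
  | hX i H _ => rw [contravariantForm_mulOp_right, mem_formKernel_iff.mp (hF i)]

/-- Dunkl operators lower degrees by one and preserve the kernel, so the degree of the second
argument can be peeled off one y at a time until only a constant term is left. -/
theorem isGraded_formKernel : IsGraded (formKernel ρ c τ) := by
  intro F hF d
  rw [mem_formKernel_iff]
  intro H
  induction H using verma_induction generalizing F d with
  | h1 w =>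
    rw [contravariantForm_tmul, map_one, Module.End.one_apply, constTerm_component,
      constTerm_eq_zero_of_mem_formKernel hF, ite_self, map_zero]
  | hadd H H' h h' => rw [map_add, h F hF, h' F hF, add_zero]
  | hX i H h =>
    rw [contravariantForm_mulOp_right]
    cases d with
    | zero => rw [dunkl_component_zero, map_zero, LinearMap.zero_apply]
    | succ d => rw [← component_dunkl, h _ (dunkl_mem_formKernel hF i)]

end FormKernel

/-! ### Irreducibility of a quotient from the absence of singular vectors. -/

section Irreducible

variable {K : Type*} [Field K] {G : Type*} [Group G] {n : ℕ}
variable {V : Type*} [AddCommGroup V] [Module K V]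

theorem eq_top_of_isIrreducible {τ : Representation K G V} (hτ : τ.IsIrreducible)
    (W : Submodule K V) (hW : ∀ g, ∀ v ∈ W, τ g v ∈ W) (h0 : W ≠ ⊥) : W = ⊤ := by
  have h := hτ.eq_bot_or_eq_top ⟨W, fun g v hv => hW g v hv⟩
  rcases h with h | h
  · exact absurd (congrArg Subrepresentation.toSubmodule h) h0
  · exact congrArg Subrepresentation.toSubmodule h

variable [Finite G]
variable {ρ : G →* Matrix (Fin n) (Fin n) K} {c : ConjClasses G → K} {τ : Representation K G V}

/-- A subspace stable under the generators is a submodule of the Verma module. -/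
def vermaSubmodule (ρ : G →* Matrix (Fin n) (Fin n) K) (c : ConjClasses G → K)
    (τ : Representation K G V) (J : Submodule K (MvPolynomial (Fin n) K ⊗[K] V))
    (hJ : ∀ a, ∀ F ∈ J, genOp ρ c τ a F ∈ J) :
    Submodule (CherednikAlgebra ρ c) (Verma ρ c τ) where
  carrier := {F | (Verma.of ρ c τ).symm F ∈ J}
  add_mem' := fun {F H} hF hH => J.add_mem hF hH
  zero_mem' := J.zero_mem
  smul_mem' := fun h => by
    induction h using CherednikAlgebra.induction with
    | hK t =>
      intro F hF
      rw [algebraMap_smul]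
      exact J.smul_mem t hF
    | hof a => intro F hF; exact (Verma.of_smul ρ c τ a F).symm ▸ hJ a _ hF
    | hadd a b ha hb => intro F hF; rw [add_smul]; exact J.add_mem (ha hF) (hb hF)
    | hmul a b ha hb => intro F hF; rw [mul_smul]; exact ha (hb hF)

theorem of_mem_vermaSubmodule {J : Submodule K (MvPolynomial (Fin n) K ⊗[K] V)}
    {hJ : ∀ a, ∀ F ∈ J, genOp ρ c τ a F ∈ J} {F : MvPolynomial (Fin n) K ⊗[K] V} :
    Verma.of ρ c τ F ∈ vermaSubmodule ρ c τ J hJ ↔ F ∈ J := Iff.rfl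

/-- If the only singular vectors of `M / J` are those of `τ`, then `M / J` is irreducible. -/
theorem isSimpleModule_quotient_vermaSubmodule (hτ : τ.IsIrreducible)
    {J : Submodule K (MvPolynomial (Fin n) K ⊗[K] V)}
    (hJ : ∀ a, ∀ F ∈ J, genOp ρ c τ a F ∈ J)
    (hV : ∀ v, (1 : MvPolynomial (Fin n) K) ⊗ₜ[K] v ∈ J → v = 0)
    (hsing : ∀ F, constTerm K n V F = 0 → (∀ i, dunkl ρ c τ i F ∈ J) → F ∈ J) :
    IsSimpleModule (CherednikAlgebra ρ c) (Verma ρ c τ ⧸ vermaSubmodule ρ c τ J hJ) := by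
  rw [isSimpleModule_iff_isCoatom]
  have hnt : Nontrivial V := by
    by_contra hV'
    rw [not_nontrivial_iff_subsingleton] at hV'
    refine hτ.bot_ne_top ?_
    exact Subrepresentation.toSubmodule_injective (Subsingleton.elim _ _)
  constructor
  · intro h
    obtain ⟨v, hv⟩ := exists_ne (0 : V)
    refine hv (hV v ?_)
    rw [← of_mem_vermaSubmodule (hJ := hJ), h]
    trivial
  · intro N hN
    obtain ⟨hle, F, hFN, hFJ⟩ := SetLike.lt_iff_le_and_exists.mp hN
    obtain ⟨F, rfl⟩ := (Verma.of ρ c τ).surjective F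
    rw [of_mem_vermaSubmodule] at hFJ
    have hgen : ∀ a F, Verma.of ρ c τ F ∈ N → Verma.of ρ c τ (genOp ρ c τ a F) ∈ N :=
      fun a F hF => by
        rw [← Verma.of_smul]
        exact N.smul_mem _ hF
    let N' : Submodule K (MvPolynomial (Fin n) K ⊗[K] V) :=
      (N.restrictScalars K).comap (Verma.of ρ c τ).toLinearMap
    -- Descent on a degree bound: if some Dunkl operator keeps F outside J, apply it and the bound
    -- drops; otherwise F minus its constant term is in J, so the constant term is a nonzero vector
    -- of τ lying in N.
    have hex : ∀ d F, (∀ e, d ≤ e → component K n V e F = 0) → F ∈ N' → F ∉ J →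
        ∃ v, v ≠ 0 ∧ (1 : MvPolynomial (Fin n) K) ⊗ₜ[K] v ∈ N' := by
      intro d
      induction d with
      | zero =>
        intro F hF _ hFJ
        rw [eq_zero_of_component_eq_zero fun e => hF e e.zero_le] at hFJ
        exact absurd J.zero_mem hFJ
      | succ d ih =>
        intro F hF hFN hFJ
        by_cases h : ∀ i, dunkl ρ c τ i F ∈ J
        · have hF0 : F - 1 ⊗ₜ constTerm K n V F ∈ J := by
            refine hsing _ ?_ fun i => ?_
            · rw [map_sub, constTerm_one_tmul, sub_self]
            · rw [map_sub, dunkl_one_tmul, sub_zero]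
              exact h i
          refine ⟨constTerm K n V F, fun h0 => ?_, ?_⟩
          · rw [h0, TensorProduct.tmul_zero, sub_zero] at hF0
            exact hFJ hF0
          · have h1 : F - 1 ⊗ₜ constTerm K n V F ∈ N' :=
              hle (of_mem_vermaSubmodule (hJ := hJ).mpr hF0)
            have h2 := N'.sub_mem hFN h1
            rwa [sub_sub_cancel] at h2
        · push Not at h
          obtain ⟨i, hi⟩ := h
          refine ih (dunkl ρ c τ i F) (fun e he => ?_) (hgen (.y i) F hFN) hi
          rw [component_dunkl, hF (e + 1) (by lia), map_zero]
    obtain ⟨d, hd⟩ := exists_component_eq_zero F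
    obtain ⟨v, hv, hvN⟩ := hex d F hd hFN hFJ
    -- The vectors of τ contained in N form a nonzero G-stable subspace, hence all of τ, which
    -- generates the Verma module.
    have hW := eq_top_of_isIrreducible hτ
      (N'.comap (TensorProduct.mk K (MvPolynomial (Fin n) K) V 1))
      (fun g w hw => by
        have := hgen (.g g) _ hw
        rwa [genOp, TensorProduct.mk_apply, groupOp_one_tmul] at this)
      (fun h => hv ((Submodule.mem_bot K).mp (h ▸ hvN)))
    refine (Submodule.eq_top_iff').mpr fun H => ?_
    obtain ⟨H, rfl⟩ := (Verma.of ρ c τ).surjective H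
    change H ∈ N'
    induction H using verma_induction with
    | h1 w => exact (hW ▸ Submodule.mem_top : w ∈ N'.comap _)
    | hadd H H' h h' => exact N'.add_mem h h'
    | hX j H h => exact hgen (.x j) H h

end Irreducible

/-! ### The expansion of M over the polynomials in the q-th powers, and Hilbert series. -/

section PowerBasis

variable {K : Type*} [Field K] {n q : ℕ}
variable {V : Type*} [AddCommGroup V] [Module K V]

/-- The exponent vector with entries `aₗ < q`. -/
def smallExp (a : Fin n → Fin q) : Fin n →₀ ℕ :=
  Finsupp.equivFunOnFinite.symm fun l => (a l : ℕ)

@[simp]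
theorem smallExp_apply (a : Fin n → Fin q) (l : Fin n) : smallExp a l = a l := rfl

/-- The quotients of the entries of an exponent vector by `q`. -/
def expDiv (q : ℕ) (b : Fin n →₀ ℕ) : Fin n →₀ ℕ := b.mapRange (· / q) (Nat.zero_div q)

@[simp]
theorem expDiv_apply (b : Fin n →₀ ℕ) (l : Fin n) : expDiv q b l = b l / q := rfl

/-- The coefficient of `x^a` in the expansion `f = ∑ₐ x^a fₐ(x₁^q, …, xₙ^q)`, with
`0 ≤ aₗ < q`. -/
def powCoeff (K : Type*) [Field K] (a : Fin n → Fin q) :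
    MvPolynomial (Fin n) K →ₗ[K] MvPolynomial (Fin n) K :=
  (MvPolynomial.basisMonomials (Fin n) K).constr K fun b =>
    if ∀ l, b l % q = a l then MvPolynomial.monomial (expDiv q b) 1 else 0

theorem powCoeff_monomial (a : Fin n → Fin q) (b : Fin n →₀ ℕ) (t : K) :
    powCoeff K a (MvPolynomial.monomial b t) =
      if ∀ l, b l % q = a l then MvPolynomial.monomial (expDiv q b) t else 0 := by
  have h : powCoeff K a (MvPolynomial.monomial b 1) =
      if ∀ l, b l % q = a l then MvPolynomial.monomial (expDiv q b) 1 else 0 := by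
    have := (MvPolynomial.basisMonomials (Fin n) K).constr_basis K (fun b =>
      if ∀ l, b l % q = a l then MvPolynomial.monomial (expDiv q b) (1 : K) else 0) b
    rwa [MvPolynomial.coe_basisMonomials] at this
  have h1 : MvPolynomial.monomial b t = t • MvPolynomial.monomial b (1 : K) := by
    rw [MvPolynomial.smul_monomial, smul_eq_mul, mul_one]
  rw [h1, map_smul, h, smul_ite, smul_zero, MvPolynomial.smul_monomial, smul_eq_mul, mul_one]

theorem eq_smallExp_add {a : Fin n → Fin q} {b : Fin n →₀ ℕ} (h : ∀ l, b l % q = a l) :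
    b = smallExp a + q • expDiv q b := by
  ext l
  simp only [Finsupp.add_apply, smallExp_apply, Finsupp.smul_apply, expDiv_apply, smul_eq_mul,
    ← h l, Nat.mod_add_div]

/-- Uniqueness of the expansion, from uniqueness of division with remainder by q in each exponent.
-/
theorem powCoeff_mul_expand [NeZero q] (a b : Fin n → Fin q) (f : MvPolynomial (Fin n) K) :
    powCoeff K a (MvPolynomial.monomial (smallExp b) 1 * MvPolynomial.expand q f) =
      if a = b then f else 0 := by
  induction f using MvPolynomial.induction_on' with
  | monomial e t =>
    have h1 : ∀ l, (smallExp b + q • e) l % q = b l := fun l => by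
      simp [Nat.add_mul_mod_self_left, Nat.mod_eq_of_lt (b l).isLt]
    rw [MvPolynomial.expand_monomial, MvPolynomial.monomial_mul, one_mul, powCoeff_monomial]
    simp only [h1, Fin.val_inj, ← funext_iff, eq_comm (a := b)]
    refine if_congr Iff.rfl ?_ rfl
    refine congrArg (fun e => MvPolynomial.monomial e t) (Finsupp.ext fun l => ?_)
    simp [Nat.add_mul_div_left _ _ (NeZero.pos q), Nat.div_eq_of_lt (b l).isLt]
  | add f g hf hg =>
    simp only [map_add, mul_add, hf, hg]
    split_ifs <;> simp

theorem monomial_mul_expand_powCoeff (a : Fin n → Fin q) (b : Fin n →₀ ℕ) (t : K) :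
    MvPolynomial.monomial (smallExp a) 1 *
        MvPolynomial.expand q (powCoeff K a (MvPolynomial.monomial b t)) =
      if ∀ l, b l % q = a l then MvPolynomial.monomial b t else 0 := by
  rw [powCoeff_monomial]
  split_ifs with h
  · rw [MvPolynomial.expand_monomial, MvPolynomial.monomial_mul, one_mul, ← eq_smallExp_add h]
  · rw [map_zero, mul_zero]

theorem sum_monomial_mul_expand_powCoeff [NeZero q] (f : MvPolynomial (Fin n) K) :
    ∑ a : Fin n → Fin q,
      MvPolynomial.monomial (smallExp a) 1 * MvPolynomial.expand q (powCoeff K a f) = f := by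
  induction f using MvPolynomial.induction_on' with
  | monomial b t =>
    simp only [monomial_mul_expand_powCoeff]
    rw [Finset.sum_eq_single (fun l => ⟨b l % q, Nat.mod_lt _ (NeZero.pos q)⟩)]
    · simp
    · intro a _ ha
      rw [if_neg]
      exact fun h => ha (funext fun l => Fin.ext (h l).symm)
    · simp
  | add f g hf hg => simp only [map_add, mul_add, Finset.sum_add_distrib, hf, hg]

/-- Lower the `j`-th entry by one, modulo `q`. -/
def lowerExp [NeZero q] (j : Fin n) (a : Fin n → Fin q) : Fin n → Fin q :=
  Function.update a j (a j - 1)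

theorem lowerExp_injective [NeZero q] (j : Fin n) :
    Function.Injective (lowerExp j : (Fin n → Fin q) → _) := by
  intro a b h
  funext l
  have hl := congrFun h l
  by_cases hlj : l = j
  · subst hlj
    simpa [lowerExp] using hl
  · simpa [lowerExp, hlj] using hl

theorem Fin.val_sub_one_eq [NeZero q] (a : Fin q) :
    ((a - 1 : Fin q) : ℕ) = if (a : ℕ) = 0 then q - 1 else a - 1 := by
  obtain ⟨q, rfl⟩ : ∃ k, q = k + 1 := ⟨q - 1, by have := NeZero.pos q; lia⟩
  rw [Fin.coe_sub_one]
  exact if_congr Fin.ext_iff rfl rfl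

/-- Multiplication by x_j shifts the residue of the j-th exponent cyclically. Passing from q - 1 to
0 completes a factor x_j^q, which shows up as an extra x_j in the coefficient. -/
theorem powCoeff_X_mul [NeZero q] (j : Fin n) (a : Fin n → Fin q) (f : MvPolynomial (Fin n) K) :
    powCoeff K a (MvPolynomial.X j * f) =
      (if (a j : ℕ) = 0 then MvPolynomial.X j else 1) * powCoeff K (lowerExp j a) f := by
  induction f using MvPolynomial.induction_on' with
  | monomial b t =>
    have hq := NeZero.pos q
    have hiff : (∀ l, (Finsupp.single j 1 + b : Fin n →₀ ℕ) l % q = a l) ↔ ∀ l, b l % q = lowerExp j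
        a l := by
      refine forall_congr' fun l => ?_
      by_cases hl : l = j
      · subst hl
        have h1 := (a l).isLt
        have h2 := Nat.mod_lt (b l) hq
        simp only [lowerExp, Finsupp.add_apply, Finsupp.single_eq_same, Function.update_self,
          Fin.val_sub_one_eq]
        rw [Nat.add_comm, Nat.add_mod_eq_ite]
        -- For q = 1 the remainder of 1 modulo q is 0 rather than 1.
        rcases Nat.lt_or_ge 1 q with h | h
        · rw [Nat.mod_eq_of_lt h]
          split_ifs <;> lia
        · obtain rfl : q = 1 := by lia
          simp only [Nat.mod_one] at *
          split_ifs <;> lia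
      · simp [lowerExp, hl]
    rw [MvPolynomial.X, MvPolynomial.monomial_mul, one_mul, powCoeff_monomial, powCoeff_monomial,
      mul_ite, mul_zero, if_congr hiff rfl rfl]
    refine ite_congr rfl (fun h => ?_) fun _ => rfl
    have hj := h j
    have hd := Nat.mod_add_div (b j) q
    have hlt := Nat.mod_lt (b j) hq
    simp only [lowerExp, Function.update_self, Fin.val_sub_one_eq] at hj
    split_ifs with h0
    · rw [MvPolynomial.monomial_mul, one_mul]
      refine congrArg (fun e => MvPolynomial.monomial e t) (Finsupp.ext fun l => ?_)
      by_cases hl : l = j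
      · subst hl
        rw [if_pos h0] at hj
        simp only [expDiv_apply, Finsupp.add_apply, Finsupp.single_eq_same]
        rw [show 1 + b l = q * (1 + b l / q) by rw [mul_add]; lia, Nat.mul_div_cancel_left _ hq]
      · simp [Ne.symm hl]
    · rw [one_mul]
      refine congrArg (fun e => MvPolynomial.monomial e t) (Finsupp.ext fun l => ?_)
      by_cases hl : l = j
      · subst hl
        rw [if_neg h0] at hj
        have h1 := (a l).isLt
        simp only [expDiv_apply, Finsupp.add_apply, Finsupp.single_eq_same]
        have hb : 1 + b l = (1 + b l % q) + q * (b l / q) := by lia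
        conv_lhs => rw [hb, Nat.add_mul_div_left _ _ hq, Nat.div_eq_of_lt (by lia), zero_add]
      · simp [Ne.symm hl]
  | add f g hf hg => simp only [map_add, mul_add, hf, hg]

theorem homogeneousComponent_monomial (d : ℕ) (b : Fin n →₀ ℕ) (t : K) :
    MvPolynomial.homogeneousComponent d (MvPolynomial.monomial b t) =
      if b.degree = d then MvPolynomial.monomial b t else 0 := by
  classical
  ext e
  rw [MvPolynomial.coeff_homogeneousComponent, MvPolynomial.coeff_monomial]
  by_cases h : b = e
  · subst h
    split_ifs <;> simp_all
  · split_ifs <;> simp [h]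

theorem degree_eq_of_mod {a : Fin n → Fin q} {b : Fin n →₀ ℕ} (h : ∀ l, b l % q = a l) :
    b.degree = (smallExp a).degree + q * (expDiv q b).degree := by
  conv_lhs => rw [eq_smallExp_add h]
  rw [map_add, map_nsmul, smul_eq_mul]

theorem powCoeff_homogeneousComponent [NeZero q] (a : Fin n → Fin q) (e : ℕ)
    (f : MvPolynomial (Fin n) K) :
    powCoeff K a (MvPolynomial.homogeneousComponent ((smallExp a).degree + q * e) f) =
      MvPolynomial.homogeneousComponent e (powCoeff K a f) := by
  induction f using MvPolynomial.induction_on' with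
  | monomial b t =>
    rw [homogeneousComponent_monomial, powCoeff_monomial]
    by_cases h : ∀ l, b l % q = a l
    · have hq := NeZero.ne q
      rw [if_pos h, homogeneousComponent_monomial, degree_eq_of_mod h]
      simp only [add_right_inj, mul_eq_mul_left_iff, hq, or_false]
      split_ifs
      · rw [powCoeff_monomial, if_pos h]
      · rw [map_zero]
    · rw [if_neg h, map_zero]
      split_ifs
      · rw [powCoeff_monomial, if_neg h]
      · rw [map_zero]
  | add f g hf hg => simp only [map_add, hf, hg]

theorem powCoeff_homogeneousComponent_eq_zero {a : Fin n → Fin q} {d : ℕ}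
    (hd : ∀ e, d ≠ (smallExp a).degree + q * e) (f : MvPolynomial (Fin n) K) :
    powCoeff K a (MvPolynomial.homogeneousComponent d f) = 0 := by
  induction f using MvPolynomial.induction_on' with
  | monomial b t =>
    rw [homogeneousComponent_monomial]
    split_ifs with h
    · rw [powCoeff_monomial, if_neg]
      intro h'
      exact hd _ (h.symm.trans (degree_eq_of_mod h'))
    · rw [map_zero]
  | add f g hf hg => simp only [map_add, hf, hg, add_zero]

theorem monomial_mul_expand_powCoeff_homogeneousComponent (a : Fin n → Fin q) (d : ℕ)
    (f : MvPolynomial (Fin n) K) :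
    MvPolynomial.monomial (smallExp a) 1 *
        MvPolynomial.expand q (powCoeff K a (MvPolynomial.homogeneousComponent d f)) =
      MvPolynomial.homogeneousComponent d (MvPolynomial.monomial (smallExp a) 1 *
        MvPolynomial.expand q (powCoeff K a f)) := by
  induction f using MvPolynomial.induction_on' with
  | monomial b t =>
    rw [monomial_mul_expand_powCoeff, homogeneousComponent_monomial]
    split_ifs with h1 h2 h2
    · rw [monomial_mul_expand_powCoeff, if_pos h2, homogeneousComponent_monomial, if_pos h1]
    · rw [monomial_mul_expand_powCoeff, if_neg h2, map_zero]
    · rw [homogeneousComponent_monomial, if_neg h1, map_zero, map_zero, mul_zero]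
    · simp
  | add f g hf hg => simp only [map_add, mul_add, hf, hg]

/-- The substitution `xᵢ ↦ xᵢ^q` on `Sym(𝔥*) ⊗ τ`. -/
def powOp (K : Type*) [Field K] (n : ℕ) (V : Type*) [AddCommGroup V] [Module K V] (q : ℕ) :
    Module.End K (MvPolynomial (Fin n) K ⊗[K] V) :=
  TensorProduct.map (MvPolynomial.expand q).toLinearMap LinearMap.id

/-- The coefficient of `x^a` on `Sym(𝔥*) ⊗ τ`. -/
def coeffOp (K : Type*) [Field K] (V : Type*) [AddCommGroup V] [Module K V] (a : Fin n → Fin q) :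
    Module.End K (MvPolynomial (Fin n) K ⊗[K] V) :=
  TensorProduct.map (powCoeff K a) LinearMap.id

/-- The element `x^a F(x₁^q, …, xₙ^q)`. -/
def monOp (K : Type*) [Field K] (V : Type*) [AddCommGroup V] [Module K V] (a : Fin n → Fin q) :
    Module.End K (MvPolynomial (Fin n) K ⊗[K] V) :=
  Algebra.lsmul K K (MvPolynomial (Fin n) K ⊗[K] V)
    (MvPolynomial.monomial (smallExp a) (1 : K)) * powOp K n V q

theorem monOp_apply (a : Fin n → Fin q) (F : MvPolynomial (Fin n) K ⊗[K] V) :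
    monOp K V a F = MvPolynomial.monomial (smallExp a) (1 : K) • powOp K n V q F := rfl

theorem monOp_tmul (a : Fin n → Fin q) (f : MvPolynomial (Fin n) K) (v : V) :
    monOp K V a (f ⊗ₜ v) =
      (MvPolynomial.monomial (smallExp a) 1 * MvPolynomial.expand q f) ⊗ₜ v := rfl

theorem coeffOp_monOp [NeZero q] (a b : Fin n → Fin q) (F : MvPolynomial (Fin n) K ⊗[K] V) :
    coeffOp K V a (monOp K V b F) = if a = b then F else 0 := by
  induction F using TensorProduct.induction_on with
  | zero => simp
  | add F H hF hH =>
    simp only [map_add, hF, hH]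
    split_ifs <;> simp
  | tmul f v =>
    rw [monOp_tmul, coeffOp, TensorProduct.map_tmul, powCoeff_mul_expand]
    split_ifs <;> simp

theorem sum_monOp_coeffOp [NeZero q] (F : MvPolynomial (Fin n) K ⊗[K] V) :
    ∑ a : Fin n → Fin q, monOp K V a (coeffOp K V a F) = F := by
  induction F using TensorProduct.induction_on with
  | zero => simp
  | add F H hF hH => simp only [map_add, Finset.sum_add_distrib, hF, hH]
  | tmul f v =>
    simp only [coeffOp, TensorProduct.map_tmul, monOp_tmul, LinearMap.id_apply]
    rw [← TensorProduct.sum_tmul, sum_monomial_mul_expand_powCoeff]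

theorem coeffOp_sum_monOp [NeZero q] (a : Fin n → Fin q)
    (F : (Fin n → Fin q) → MvPolynomial (Fin n) K ⊗[K] V) :
    coeffOp K V a (∑ b, monOp K V b (F b)) = F a := by
  simp [map_sum, coeffOp_monOp]

theorem coeffOp_mulOp [NeZero q] (j : Fin n) (a : Fin n → Fin q)
    (F : MvPolynomial (Fin n) K ⊗[K] V) :
    coeffOp K V a (mulOp K V j F) = if (a j : ℕ) = 0 then
      mulOp K V j (coeffOp K V (lowerExp j a) F) else coeffOp K V (lowerExp j a) F := by
  induction F using TensorProduct.induction_on with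
  | zero => simp
  | add F H hF hH =>
    simp only [map_add, hF, hH]
    split_ifs <;> rfl
  | tmul f v =>
    simp only [coeffOp, TensorProduct.map_tmul, mulOp_tmul, powCoeff_X_mul, ite_mul, one_mul]
    split_ifs <;> rfl

theorem coeffOp_component [NeZero q] (a : Fin n → Fin q) (e : ℕ)
    (F : MvPolynomial (Fin n) K ⊗[K] V) :
    coeffOp K V a (component K n V ((smallExp a).degree + q * e) F) =
      component K n V e (coeffOp K V a F) := by
  induction F using TensorProduct.induction_on with
  | zero => simp
  | add F H hF hH => simp only [map_add, hF, hH]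
  | tmul f v =>
    simp only [coeffOp, component, TensorProduct.map_tmul, powCoeff_homogeneousComponent]

theorem coeffOp_component_eq_zero {a : Fin n → Fin q} {d : ℕ}
    (hd : ∀ e, d ≠ (smallExp a).degree + q * e) (F : MvPolynomial (Fin n) K ⊗[K] V) :
    coeffOp K V a (component K n V d F) = 0 := by
  induction F using TensorProduct.induction_on with
  | zero => simp
  | add F H hF hH => simp only [map_add, hF, hH, add_zero]
  | tmul f v =>
    simp only [coeffOp, component, TensorProduct.map_tmul,
      powCoeff_homogeneousComponent_eq_zero hd, TensorProduct.zero_tmul]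

theorem monOp_coeffOp_component (a : Fin n → Fin q) (d : ℕ)
    (F : MvPolynomial (Fin n) K ⊗[K] V) :
    monOp K V a (coeffOp K V a (component K n V d F)) =
      component K n V d (monOp K V a (coeffOp K V a F)) := by
  induction F using TensorProduct.induction_on with
  | zero => simp
  | add F H hF hH => simp only [map_add, hF, hH]
  | tmul f v =>
    simp only [coeffOp, component, TensorProduct.map_tmul, monOp_tmul, LinearMap.id_apply,
      monomial_mul_expand_powCoeff_homogeneousComponent]

theorem smul_mem_of_mulOp_mem {J : Submodule K (MvPolynomial (Fin n) K ⊗[K] V)}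
    (hJ : ∀ j, ∀ F ∈ J, mulOp K V j F ∈ J) (p : MvPolynomial (Fin n) K)
    {F : MvPolynomial (Fin n) K ⊗[K] V} (hF : F ∈ J) : p • F ∈ J := by
  induction p using MvPolynomial.induction_on with
  | C t =>
    rw [← MvPolynomial.algebraMap_eq, algebraMap_smul]
    exact J.smul_mem t hF
  | add p p' h h' => rw [add_smul]; exact J.add_mem h h'
  | mul_X p j h => rw [mul_comm, mul_smul]; exact hJ j _ h

variable {J : Submodule K (MvPolynomial (Fin n) K ⊗[K] V)}

theorem monOp_mem_powSubmodule (a : Fin n → Fin q) {F : MvPolynomial (Fin n) K ⊗[K] V}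
    (hF : F ∈ J) : monOp K V a F ∈ powSubmodule q J := by
  rw [monOp_apply]
  exact Submodule.smul_mem _ _ (Submodule.subset_span ⟨F, hF, rfl⟩)

theorem monomial_smallExp_zero [NeZero q] :
    MvPolynomial.monomial (smallExp (0 : Fin n → Fin q)) (1 : K) = 1 := by
  have : smallExp (0 : Fin n → Fin q) = 0 := by ext l; simp
  rw [this, MvPolynomial.monomial_zero', MvPolynomial.C_1]

/-- The condition on the right cuts out a Sym(𝔥*)-submodule, because multiplication by x_j permutes
the coefficients up to factors x_j and J is stable under these. It contains the generators, and the
converse is the expansion itself. -/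
theorem mem_powSubmodule_iff [NeZero q] (hJ : ∀ j, ∀ F ∈ J, mulOp K V j F ∈ J)
    {F : MvPolynomial (Fin n) K ⊗[K] V} :
    F ∈ powSubmodule q J ↔ ∀ a : Fin n → Fin q, coeffOp K V a F ∈ J := by
  constructor
  · intro hF
    let J' : Submodule K (MvPolynomial (Fin n) K ⊗[K] V) := ⨅ a : Fin n → Fin q,
      J.comap (coeffOp K V a)
    have hJ' : ∀ j, ∀ F ∈ J', mulOp K V j F ∈ J' := fun j F hF => by
      simp only [J', Submodule.mem_iInf, Submodule.mem_comap] at hF ⊢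
      intro a
      rw [coeffOp_mulOp]
      split_ifs
      · exact hJ j _ (hF _)
      · exact hF _
    suffices h : F ∈ J' by simpa only [J', Submodule.mem_iInf, Submodule.mem_comap] using h
    induction hF using Submodule.span_induction with
    | mem _ h =>
      obtain ⟨H, hH, rfl⟩ := h
      simp only [J', Submodule.mem_iInf, Submodule.mem_comap]
      intro a
      -- A generator H(x^q) has only one possibly nonzero coefficient, namely H at a = 0.
      have h1 : monOp K V (0 : Fin n → Fin q) H = powOp K n V q H := by
        rw [monOp_apply, monomial_smallExp_zero, one_smul]
      change coeffOp K V a (powOp K n V q H) ∈ J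
      rw [← h1, coeffOp_monOp]
      split_ifs
      · exact hH
      · exact J.zero_mem
    | zero => exact J'.zero_mem
    | add F H _ _ hF hH => exact J'.add_mem hF hH
    | smul p F _ hF => exact smul_mem_of_mulOp_mem hJ' p hF
  · intro h
    rw [← sum_monOp_coeffOp (q := q) F]
    exact Submodule.sum_mem _ fun a _ => monOp_mem_powSubmodule a (h a)

theorem isGraded_powSubmodule [NeZero q] (hJ : ∀ j, ∀ F ∈ J, mulOp K V j F ∈ J)
    (hg : IsGraded J) : IsGraded ((powSubmodule q J).restrictScalars K) := by
  intro F hF d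
  rw [Submodule.restrictScalars_mem, mem_powSubmodule_iff hJ] at hF ⊢
  intro a
  by_cases h : ∃ e, d = (smallExp a).degree + q * e
  · obtain ⟨e, rfl⟩ := h
    rw [coeffOp_component]
    exact hg _ (hF a) e
  · rw [coeffOp_component_eq_zero (not_exists.mp h)]
    exact J.zero_mem

/-- The coefficients of `F`, modulo `J`. -/
def coeffQuot (J : Submodule K (MvPolynomial (Fin n) K ⊗[K] V)) (q : ℕ) :
    MvPolynomial (Fin n) K ⊗[K] V →ₗ[K]
      ((Fin n → Fin q) → (MvPolynomial (Fin n) K ⊗[K] V) ⧸ J) :=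
  LinearMap.pi fun a => J.mkQ.comp (coeffOp K V a)

theorem ker_coeffQuot [NeZero q] (hJ : ∀ j, ∀ F ∈ J, mulOp K V j F ∈ J) :
    LinearMap.ker (coeffQuot J q) = (powSubmodule q J).restrictScalars K := by
  ext F
  rw [Submodule.restrictScalars_mem, mem_powSubmodule_iff hJ, LinearMap.mem_ker, funext_iff]
  simp [coeffQuot]

theorem finrank_map_mkQ_ker {M N : Type*} [AddCommGroup M] [Module K M] [AddCommGroup N]
    [Module K N] (T : M →ₗ[K] N) (R : Submodule K M) :
    Module.finrank K (R.map (LinearMap.ker T).mkQ) = Module.finrank K (R.map T) := by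
  have h : (R.map (LinearMap.ker T).mkQ).map ((LinearMap.ker T).liftQ T le_rfl) = R.map T := by
    rw [← Submodule.map_comp, Submodule.liftQ_mkQ]
  rw [← h]
  refine (Submodule.equivMapOfInjective _ ?_ _).finrank_eq
  rw [← LinearMap.ker_eq_bot, Submodule.ker_liftQ_eq_bot _ _ _ le_rfl]

theorem finrank_pi_submodule {ι : Type*} [Fintype ι] {M : Type*} [AddCommGroup M] [Module K M]
    (W : ι → Submodule K M) [∀ i, Module.Finite K (W i)] :
    Module.finrank K (Submodule.pi Set.univ W) = ∑ i, Module.finrank K (W i) := by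
  rw [← Module.finrank_pi_fintype]
  exact LinearEquiv.finrank_eq
    { toFun := fun w i => ⟨w.1 i, w.2 i trivial⟩
      map_add' := fun _ _ => rfl
      map_smul' := fun _ _ => rfl
      invFun := fun w => ⟨fun i => w i, fun i _ => (w i).2⟩
      left_inv := fun _ => rfl
      right_inv := fun _ => rfl }

/-- The coefficients of an element of degree d can be prescribed independently: extracting the part
x^a F_a(x^q) commutes with taking components, so parts of different degree d elements reassemble to
one of degree d. -/
theorem map_coeffQuot [NeZero q] (J : Submodule K (MvPolynomial (Fin n) K ⊗[K] V)) (d : ℕ) :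
    (LinearMap.range (component K n V d)).map (coeffQuot J q) =
      Submodule.pi Set.univ fun a : Fin n → Fin q =>
        (LinearMap.range (coeffOp K V a ∘ₗ component K n V d)).map J.mkQ := by
  ext w
  simp only [Submodule.mem_map, LinearMap.mem_range, Submodule.mem_pi, Set.mem_univ, forall_const,
    exists_exists_eq_and, LinearMap.comp_apply]
  constructor
  · rintro ⟨F, rfl⟩ a
    exact ⟨F, rfl⟩
  · intro h
    choose F hF using h
    refine ⟨∑ a, monOp K V a (coeffOp K V a (F a)), funext fun a => ?_⟩
    rw [← hF a, map_sum]
    simp only [← monOp_coeffOp_component]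
    simp only [coeffQuot, LinearMap.pi_apply, LinearMap.comp_apply]
    rw [coeffOp_sum_monOp a fun b => coeffOp K V b (component K n V d (F b))]

theorem range_coeffOp_comp_component [NeZero q] (a : Fin n → Fin q) (e : ℕ) :
    LinearMap.range (coeffOp K V a ∘ₗ component K n V ((smallExp a).degree + q * e)) =
      LinearMap.range (component K n V e) := by
  have h : coeffOp K V a ∘ₗ component K n V ((smallExp a).degree + q * e) =
      component K n V e ∘ₗ coeffOp K V a := LinearMap.ext fun F => coeffOp_component a e F
  rw [h, LinearMap.range_comp, LinearMap.range_eq_top.mpr, LinearMap.range_eq_map]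
  exact fun F => ⟨monOp K V a F, by rw [coeffOp_monOp, if_pos rfl]⟩

instance finite_range_component [Module.Finite K V] (d : ℕ) :
    Module.Finite K (LinearMap.range (component K n V d)) := by
  have h1 : (MvPolynomial.homogeneousComponent d : MvPolynomial (Fin n) K →ₗ[K] _) =
      (MvPolynomial.homogeneousSubmodule (Fin n) K d).subtype ∘ₗ
        LinearMap.codRestrict _ (MvPolynomial.homogeneousComponent d)
          (MvPolynomial.homogeneousComponent_mem d) := rfl
  have h2 : Module.Finite K (MvPolynomial.homogeneousSubmodule (Fin n) K d) :=
    Module.Finite.of_fg (MvPolynomial.homogeneousSubmodule_fg (Fin n) K d)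
  -- The degree d projection factors through the finite-dimensional space of homogeneous polynomials
  -- tensored with V.
  rw [component, h1, ← LinearMap.id_comp (LinearMap.id : V →ₗ[K] V), TensorProduct.map_comp]
  exact Module.Finite.of_fg ((Module.Finite.fg_top.map _).of_le
    (LinearMap.range_comp_le_range _ _ |>.trans (LinearMap.range_eq_map _).le))

/-- M/J^q is the sum over a of copies of M/J. An element of degree d has a coefficient of degree e
at a when d = |a| + q e, so the copy at a contributes t^|a| h(t^q), and ∑ t^|a| factors as (1 + ⋯ +
t^(q-1))^n. -/
theorem hilbertSeries_powSubmodule [NeZero q] [Module.Finite K V]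
    (hJ : ∀ j, ∀ F ∈ J, mulOp K V j F ∈ J) :
    hilbertSeries ((powSubmodule q J).restrictScalars K) =
      (hilbertSeries J).subst (PowerSeries.X ^ q : PowerSeries ℤ) *
        (∑ i ∈ Finset.range q, PowerSeries.X ^ i) ^ n := by
  have hprod : (∑ i ∈ Finset.range q, (PowerSeries.X : PowerSeries ℤ) ^ i) ^ n =
      ∑ a : Fin n → Fin q, PowerSeries.X ^ (smallExp a).degree := by
    rw [Finset.sum_range, ← Fin.prod_const, Finset.prod_univ_sum]
    refine Finset.sum_congr (by simp) fun a _ => ?_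
    rw [Finset.prod_pow_eq_pow_sum, Finsupp.degree_eq_sum]
    rfl
  ext d
  rw [hprod, mul_comm, Finset.sum_mul, map_sum, hilbertSeries, PowerSeries.coeff_mk,
    ← ker_coeffQuot hJ, finrank_map_mkQ_ker, map_coeffQuot]
  have hW : ∀ a : Fin n → Fin q, Module.Finite K
      ((LinearMap.range (coeffOp K V a ∘ₗ component K n V d)).map J.mkQ) := fun a => by
    rw [LinearMap.range_comp]
    infer_instance
  rw [finrank_pi_submodule, Nat.cast_sum]
  refine Finset.sum_congr rfl fun a _ => ?_
  rw [PowerSeries.coeff_X_pow_mul', PowerSeries.coeff_subst_X_pow (NeZero.ne q), hilbertSeries]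
  by_cases h : ∃ e, d = (smallExp a).degree + q * e
  · obtain ⟨e, rfl⟩ := h
    rw [if_pos (Nat.le_add_right _ _), Nat.add_sub_cancel_left, if_pos (Nat.dvd_mul_right _ _),
      Nat.mul_div_cancel_left _ (NeZero.pos q), range_coeffOp_comp_component,
      PowerSeries.coeff_mk]
    simp
  · have h0 : coeffOp K V a ∘ₗ component K n V d = 0 :=
      LinearMap.ext fun F => coeffOp_component_eq_zero (not_exists.mp h) F
    rw [h0, LinearMap.range_zero, Submodule.map_bot, finrank_bot, Nat.cast_zero]
    split_ifs with h1 h2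
    · obtain ⟨e, he⟩ := h2
      exact absurd ⟨e, by lia⟩ h
    · rfl
    · rfl

end PowerBasis

/-! ### Divided differences independent of the choice of roots. -/

section RootDiff

variable {K : Type*} [Field K] {G : Type*} [Group G] {n : ℕ}
variable {V : Type*} [AddCommGroup V] [Module K V]

/-- The operator `f ↦ (yᵢ, αₛ) (f - s · f) / αₛ`, which does not depend on the scaling of `αₛ`. -/
def rootDiff (ρ : G →* Matrix (Fin n) (Fin n) K) (s : G) (i : Fin n) :
    MvPolynomial (Fin n) K →ₗ[K] MvPolynomial (Fin n) K :=
  root ρ s i • divDiff ρ s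

/-- The root of s comes from an arbitrary choice, but two factorizations of the same rank one matrix
have proportional factors. This allows computing with an explicit root a. -/
theorem linForm_mul_rootDiff (ρ : G →* Matrix (Fin n) (Fin n) K) {s : G}
    (hs : IsReflection ρ s) {a b : Fin n → K} (hab : 1 - ρ s⁻¹ = Matrix.vecMulVec b a)
    (i : Fin n) (f : MvPolynomial (Fin n) K) :
    linForm a * rootDiff ρ s i f = a i • (f - polyAct ρ s f) := by
  have h := one_sub_eq_root ρ hs
  rw [hab] at h
  have hb : b ≠ 0 := by
    rintro rfl
    rw [Matrix.zero_vecMulVec] at h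
    unfold IsReflection at hs
    have h2 : 1 - ρ s = -(ρ s * (1 - ρ s⁻¹)) := by
      rw [mul_sub, ← map_mul]; simp
    rw [h2, hab, Matrix.zero_vecMulVec, mul_zero, neg_zero, Matrix.rank_zero] at hs
    exact zero_ne_one hs
  obtain ⟨j, hj⟩ := Function.ne_iff.mp hb
  have hprop : root ρ s i • a = a i • root ρ s := by
    funext l
    have h1 := congrFun (congrFun h j) l
    have h2 := congrFun (congrFun h j) i
    simp only [Matrix.vecMulVec_apply] at h1 h2
    refine mul_left_cancel₀ hj ?_
    simp only [Pi.smul_apply, smul_eq_mul]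
    linear_combination root ρ s i * h1 - root ρ s l * h2
  rw [rootDiff, LinearMap.smul_apply, mul_smul_comm, ← smul_mul_assoc, ← linForm_smul, hprop,
    linForm_smul, smul_mul_assoc, root_mul_divDiff ρ hs]

theorem isReflection_of_one_sub_inv (ρ : G →* Matrix (Fin n) (Fin n) K) {s : G}
    {a b : Fin n → K} (hab : 1 - ρ s⁻¹ = Matrix.vecMulVec b a) (hs : ρ s ≠ 1) :
    IsReflection ρ s := by
  have h : 1 - ρ s = Matrix.vecMulVec (-(ρ s).mulVec b) a := by
    have h2 : 1 - ρ s = -(ρ s * (1 - ρ s⁻¹)) := by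
      rw [mul_sub, ← map_mul]; simp
    rw [h2, hab, Matrix.mul_vecMulVec, Matrix.neg_vecMulVec]
  refine le_antisymm (h ▸ Matrix.rank_vecMulVec_le _ _) ?_
  rw [Nat.one_le_iff_ne_zero]
  intro h0
  rw [Matrix.rank, Submodule.finrank_eq_zero, LinearMap.range_eq_bot] at h0
  refine hs (sub_eq_zero.mp (Matrix.ext fun k l => ?_)).symm
  have := congrFun (LinearMap.congr_fun h0 (Pi.single l 1)) k
  simpa [Matrix.one_apply, Pi.single_apply] using this

theorem dunkl_apply_eq_sum_rootDiff [Finite G] (ρ : G →* Matrix (Fin n) (Fin n) K)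
    (c : ConjClasses G → K) (τ : Representation K G V) (i : Fin n) :
    dunkl ρ c τ i = -∑ s ∈ reflections ρ,
      c (ConjClasses.mk s) • TensorProduct.map (rootDiff ρ s i) (τ s) := by
  simp only [dunkl, rootDiff, TensorProduct.map_smul_left, mul_smul]

end RootDiff

/-! ### Roots of unity and sums of quotients over the fibres of ζ ↦ ζ^q. -/

section RootsOfUnity

variable {K : Type*} [Field K]

instance fintypeRootsOfUnity (k : ℕ) [NeZero k] : Fintype (rootsOfUnity k K) := Fintype.ofFinite _

/-- Translating the summation by ξ multiplies the sum by ξ^(k-l), which is not 1. The exponent k - l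
is kept as a pair of natural numbers. -/
theorem sum_rootsOfUnity_pow {q : ℕ} [NeZero q] {ξ : K} (hξ : IsPrimitiveRoot ξ q) (k l : ℕ)
    (hkl : ¬ k ≡ l [MOD q]) :
    ∑ η : rootsOfUnity q K, ((η : Kˣ) : K) ^ k * (((η : Kˣ) : K)⁻¹) ^ l = 0 := by
  set S := ∑ η : rootsOfUnity q K, ((η : Kˣ) : K) ^ k * (((η : Kˣ) : K)⁻¹) ^ l with hS
  have hξ0 : ξ ≠ 0 := hξ.ne_zero (NeZero.ne q)
  have h : ξ ^ k * (ξ⁻¹) ^ l * S = S := by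
    conv_rhs => rw [hS, ← Equiv.sum_comp (Equiv.mulLeft hξ.toRootsOfUnity)]
    rw [hS, Finset.mul_sum]
    refine Finset.sum_congr rfl fun η _ => ?_
    simp only [Equiv.coe_mulLeft, Subgroup.coe_mul, Units.val_mul,
      IsPrimitiveRoot.val_toRootsOfUnity_coe]
    rw [mul_inv, mul_pow, mul_pow]
    ring
  by_contra hS0
  have h1 : ξ ^ k * (ξ⁻¹) ^ l = 1 := mul_right_cancel₀ hS0 (h.trans (one_mul S).symm)
  rw [inv_pow, mul_inv_eq_one₀ (pow_ne_zero _ hξ0)] at h1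
  refine hkl ?_
  rw [hξ.eq_orderOf]
  exact (hξ.isOfFinOrder (NeZero.ne q)).pow_eq_pow_iff_modEq.mp h1

/-- The map `ζ ↦ ζ^(m/r)` from `m`-th to `r`-th roots of unity. -/
def powRoot {m r : ℕ} (hr : r ∣ m) : rootsOfUnity m K →* rootsOfUnity r K where
  toFun ζ := ⟨(ζ : Kˣ) ^ (m / r), by
    rw [mem_rootsOfUnity, ← pow_mul, Nat.div_mul_cancel hr]
    exact ζ.2⟩
  map_one' := by ext; simp
  map_mul' _ _ := by ext; simp [mul_pow]

variable {m r : ℕ} [NeZero m]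

/-- The fibre through ζ₀ is its coset under the (m/r)-th roots of unity. -/
theorem sum_powRoot_fiber [NeZero (m / r)] {E : Type*} [AddCommMonoid E] (hr : r ∣ m)
    (ζ₀ : rootsOfUnity m K)
    (f : Kˣ → E) [DecidablePred fun ζ : rootsOfUnity m K => powRoot hr ζ = powRoot hr ζ₀] :
    ∑ ζ : rootsOfUnity m K with powRoot hr ζ = powRoot hr ζ₀, f ζ =
      ∑ η : rootsOfUnity (m / r) K, f (ζ₀ * η) := by
  have hq : ∀ η : rootsOfUnity (m / r) K, (η : Kˣ) ∈ rootsOfUnity m K := fun η =>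
    rootsOfUnity_le_of_dvd (Nat.div_dvd_of_dvd hr) η.2
  symm
  refine Finset.sum_bij (fun η _ => ζ₀ * ⟨η, hq η⟩) (fun η _ => ?_) (fun η _ η' _ h => ?_)
    (fun ζ hζ => ?_) fun η _ => rfl
  · rw [Finset.mem_filter, map_mul]
    refine ⟨Finset.mem_univ _, ?_⟩
    rw [mul_eq_left]
    exact Subtype.ext η.2
  · have := mul_left_cancel h
    exact Subtype.ext (Subtype.mk.inj this)
  · rw [Finset.mem_filter] at hζ
    have h1 : powRoot hr (ζ₀⁻¹ * ζ) = 1 := by rw [map_mul, map_inv, hζ.2, inv_mul_cancel]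
    refine ⟨⟨(ζ₀⁻¹ * ζ : rootsOfUnity m K), congrArg Subtype.val h1⟩, Finset.mem_univ _, ?_⟩
    exact Subtype.ext (mul_inv_cancel_left (ζ₀ : Kˣ) ζ)

theorem powRoot_surjective [NeZero r] (hr : r ∣ m) {ξ : K} (hξ : IsPrimitiveRoot ξ m) :
    Function.Surjective (powRoot hr : rootsOfUnity m K →* rootsOfUnity r K) := by
  intro ω
  have h1 : IsPrimitiveRoot (ξ ^ (m / r)) r :=
    hξ.pow (NeZero.pos m) (Nat.div_mul_cancel hr).symm
  obtain ⟨k, -, hk⟩ := h1.eq_pow_of_pow_eq_one (ξ := ((ω : Kˣ) : K)) (by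
    rw [← Units.val_pow_eq_pow_val, (mem_rootsOfUnity r _).mp ω.2, Units.val_one])
  refine ⟨hξ.toRootsOfUnity ^ k, ?_⟩
  ext
  rw [← hk]
  simp [powRoot, ← pow_mul, mul_comm]

theorem sum_powRoot_fiber_pow [NeZero r] [NeZero (m / r)] (hr : r ∣ m) {ξ : K}
    (hξ : IsPrimitiveRoot ξ m)
    (ω : rootsOfUnity r K) [DecidablePred fun ζ : rootsOfUnity m K => powRoot hr ζ = ω]
    (k l : ℕ) (hkl : ¬ k ≡ l [MOD m / r]) :
    ∑ ζ : rootsOfUnity m K with powRoot hr ζ = ω,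
      ((ζ : Kˣ) : K) ^ k * (((ζ : Kˣ) : K)⁻¹) ^ l = 0 := by
  obtain ⟨ζ₀, rfl⟩ := powRoot_surjective hr hξ ω
  have hξ' : IsPrimitiveRoot (ξ ^ r) (m / r) :=
    hξ.pow (NeZero.pos m) (Nat.mul_div_cancel' hr).symm
  rw [sum_powRoot_fiber hr ζ₀ fun ζ : Kˣ => (ζ : K) ^ k * ((ζ : K)⁻¹) ^ l]
  have h := sum_rootsOfUnity_pow hξ' k l hkl
  rw [← mul_zero (((ζ₀ : Kˣ) : K) ^ k * (((ζ₀ : Kˣ) : K)⁻¹) ^ l), ← h, Finset.mul_sum]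
  refine Finset.sum_congr rfl fun η _ => ?_
  rw [Units.val_mul, mul_inv, mul_pow, mul_pow]
  ring

theorem card_powRoot_fiber [NeZero r] [NeZero (m / r)] (hr : r ∣ m) {ξ : K}
    (hξ : IsPrimitiveRoot ξ m)
    (ω : rootsOfUnity r K) [DecidablePred fun ζ : rootsOfUnity m K => powRoot hr ζ = ω] :
    (Finset.univ.filter fun ζ : rootsOfUnity m K => powRoot hr ζ = ω).card = m / r := by
  obtain ⟨ζ₀, rfl⟩ := powRoot_surjective hr hξ ω
  have hξ' : IsPrimitiveRoot (ξ ^ r) (m / r) :=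
    hξ.pow (NeZero.pos m) (Nat.mul_div_cancel' hr).symm
  have h := sum_powRoot_fiber hr ζ₀ fun _ : Kˣ => 1
  rw [← Finset.card_eq_sum_ones] at h
  rw [h, ← Finset.card_eq_sum_ones, Finset.card_univ, ← Nat.card_eq_fintype_card,
    hξ'.card_rootsOfUnity]

/-- Since z^q = ω on S, every X - z Y divides X^q - ω Y^q with a geometric sum as quotient, so one
factor clears all denominators. The trivial factor with exponent 0 puts both coefficient sums into
the form to which orthogonality applies. -/
theorem mul_sum_quotient {A ι : Type*} [CommRing A] [Algebra K A] {q : ℕ} {ω : K}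
    (S : Finset ι) (z : ι → K) (hz : ∀ s ∈ S, z s ^ q = ω) {X Y P P' : A} {d : ι → A} {a b : ℕ}
    (hd : ∀ s ∈ S, (X - z s • Y) * d s =
      X ^ a * Y ^ b * P - (z s ^ a * (z s)⁻¹ ^ b) • (Y ^ a * X ^ b * P')) :
    (X ^ q - ω • Y ^ q) * ∑ s ∈ S, d s =
      ∑ k ∈ Finset.range q, (∑ s ∈ S, z s ^ (q - 1 - k) * (z s)⁻¹ ^ 0) •
          (X ^ k * Y ^ (q - 1 - k) * (X ^ a * Y ^ b * P)) -
        ∑ k ∈ Finset.range q, (∑ s ∈ S, z s ^ (q - 1 - k + a) * (z s)⁻¹ ^ b) •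
          (X ^ k * Y ^ (q - 1 - k) * (Y ^ a * X ^ b * P')) := by
  simp only [Finset.sum_smul]
  rw [Finset.sum_comm, Finset.sum_comm (s := Finset.range q) (t := S), ← Finset.sum_sub_distrib,
    Finset.mul_sum]
  refine Finset.sum_congr rfl fun s hs => ?_
  have h : X ^ q - ω • Y ^ q = (∑ k ∈ Finset.range q, X ^ k * (z s • Y) ^ (q - 1 - k)) *
      (X - z s • Y) := by
    rw [geom_sum₂_mul, smul_pow, hz s hs]
  rw [h, mul_assoc, hd s hs, Finset.sum_mul, ← Finset.sum_sub_distrib]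
  refine Finset.sum_congr rfl fun k _ => ?_
  rw [smul_pow, pow_zero, mul_one, pow_add]
  simp only [Algebra.smul_def, map_mul]
  ring

/-- The sum over `ζ^q = ω` of `(X^a Y^b P - ζ^(a-b) Y^a X^b P') / (X - ζ Y)`, for `a ≤ b < q`. -/
theorem sum_quotient_of_le {A ι : Type*} [CommRing A] [Algebra K A] {q : ℕ} {ω : K}
    (S : Finset ι) (z : ι → K) (hz : ∀ s ∈ S, z s ^ q = ω) (hz0 : ∀ s ∈ S, z s ≠ 0)
    (hcard : S.card = q)
    (hsum : ∀ k l, ¬ k ≡ l [MOD q] → ∑ s ∈ S, z s ^ k * (z s)⁻¹ ^ l = 0)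
    {X Y P P' : A} {d : ι → A} {a b : ℕ} (hab : a ≤ b) (hb : b < q)
    (hd : ∀ s ∈ S, (X - z s • Y) * d s =
      X ^ a * Y ^ b * P - (z s ^ a * (z s)⁻¹ ^ b) • (Y ^ a * X ^ b * P')) :
    (X ^ q - ω • Y ^ q) * ∑ s ∈ S, d s = (q : K) • (X ^ (q - 1 + a) * Y ^ b * (P - P')) := by
  have hdiag : ∀ k, ∑ s ∈ S, z s ^ k * (z s)⁻¹ ^ k = q := fun k => by
    rw [← hcard, Finset.cast_card]
    refine Finset.sum_congr rfl fun s hs => ?_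
    rw [← mul_pow, mul_inv_cancel₀ (hz0 s hs), one_pow]
  have hmod : ∀ k l, k < q → l < q → k ≠ l → ¬ k ≡ l [MOD q] := fun k l hk hl hkl h =>
    hkl (Nat.ModEq.eq_of_lt_of_lt h hk hl)
  -- By orthogonality only those k survive for which the net exponent of z is divisible by q: q - 1
  -- - k in the first sum, q - 1 - k + a - b in the second. As a ≤ b, the latter then vanishes
  -- exactly.
  rw [mul_sum_quotient S z hz hd, Finset.sum_eq_single (q - 1), Finset.sum_eq_single
    (q - 1 + a - b)]
  · rw [show q - 1 - (q - 1) = 0 by lia, show q - 1 - (q - 1 + a - b) + a = b by lia, hdiag, hdiag,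
      show q - 1 - (q - 1 + a - b) = b - a by lia, ← smul_sub]
    congr 1
    have h1 : X ^ (q - 1 + a) = X ^ (q - 1 + a - b) * X ^ b := by
      rw [← pow_add]; congr 1; lia
    have h2 : Y ^ b = Y ^ (b - a) * Y ^ a := by rw [← pow_add]; congr 1; lia
    rw [mul_sub]
    congr 1
    · rw [pow_add]; ring
    · rw [h1, h2]; ring
  · intro k hk hne
    rw [Finset.mem_range] at hk
    rw [hsum, zero_smul]
    intro h
    have h' : q - 1 - k ≡ b - a [MOD q] := by
      refine Nat.ModEq.add_right_cancel' a ?_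
      rwa [Nat.sub_add_cancel hab]
    exact hmod _ _ (by lia) (by lia) (by lia) h'
  · intro h
    exact absurd (Finset.mem_range.mpr (by lia)) h
  · intro k hk hne
    rw [Finset.mem_range] at hk
    rw [hsum _ _ (hmod _ _ (by lia) (by lia) (by lia)), zero_smul]
  · intro h
    exact absurd (Finset.mem_range.mpr (by lia)) h

/-- The sum over `ζ^q = ω` of `(X^a Y^b P - ζ^(a-b) Y^a X^b P') / (X - ζ Y)`, for `b < a < q`. -/
theorem sum_quotient_of_lt {A ι : Type*} [CommRing A] [Algebra K A] {q : ℕ} {ω : K}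
    (S : Finset ι) (z : ι → K) (hz : ∀ s ∈ S, z s ^ q = ω) (hz0 : ∀ s ∈ S, z s ≠ 0)
    (hcard : S.card = q)
    (hsum : ∀ k l, ¬ k ≡ l [MOD q] → ∑ s ∈ S, z s ^ k * (z s)⁻¹ ^ l = 0)
    {X Y P P' : A} {d : ι → A} {a b : ℕ} (hab : b < a) (ha : a < q)
    (hd : ∀ s ∈ S, (X - z s • Y) * d s =
      X ^ a * Y ^ b * P - (z s ^ a * (z s)⁻¹ ^ b) • (Y ^ a * X ^ b * P')) :
    (X ^ q - ω • Y ^ q) * ∑ s ∈ S, d s =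
      (q : K) • (X ^ (a - 1) * Y ^ b * (X ^ q * P - ω • (Y ^ q * P'))) := by
  have hdiag : ∀ k, ∑ s ∈ S, z s ^ k * (z s)⁻¹ ^ k = q := fun k => by
    rw [← hcard, Finset.cast_card]
    refine Finset.sum_congr rfl fun s hs => ?_
    rw [← mul_pow, mul_inv_cancel₀ (hz0 s hs), one_pow]
  have hdiag' : ∀ k, ∑ s ∈ S, z s ^ (q + k) * (z s)⁻¹ ^ k = q * ω := fun k => by
    rw [← hdiag k, Finset.sum_mul]
    refine Finset.sum_congr rfl fun s hs => ?_
    rw [pow_add, hz s hs]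
    ring
  have hmod : ∀ k l, k < q → l < q → k ≠ l → ¬ k ≡ l [MOD q] := fun k l hk hl hkl h =>
    hkl (Nat.ModEq.eq_of_lt_of_lt h hk hl)
  -- Here b < a, so the surviving net exponent in the second sum is q instead of 0; this produces
  -- the factor ω.
  rw [mul_sum_quotient S z hz hd, Finset.sum_eq_single (q - 1), Finset.sum_eq_single (a - b - 1)]
  · rw [show q - 1 - (q - 1) = 0 by lia, show q - 1 - (a - b - 1) + a = q + b by lia, hdiag, hdiag',
      show q - 1 - (a - b - 1) = q + b - a by lia, mul_smul, ← smul_sub]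
    congr 1
    have h1 : X ^ (a - 1) = X ^ (a - b - 1) * X ^ b := by
      rw [← pow_add]; congr 1; lia
    have h2 : Y ^ (q + b) = Y ^ (q + b - a) * Y ^ a := by rw [← pow_add]; congr 1; lia
    have h3 : X ^ (q - 1) * X ^ a = X ^ (a - 1) * X ^ q := by
      rw [← pow_add, ← pow_add]; congr 1; lia
    have h4 : X ^ (a - 1) * Y ^ b * (Y ^ q * P') =
        X ^ (a - b - 1) * Y ^ (q + b - a) * (Y ^ a * X ^ b * P') := by
      rw [show X ^ (a - 1) * Y ^ b * (Y ^ q * P') = X ^ (a - 1) * Y ^ (q + b) * P' by ring, h1, h2]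
      ring
    rw [mul_sub, mul_smul_comm, h4]
    congr 1
    linear_combination Y ^ b * P * h3
  · intro k hk hne
    rw [Finset.mem_range] at hk
    rw [hsum, zero_smul]
    intro h
    have h' : q - 1 - k + (a - b) ≡ 0 [MOD q] := by
      refine Nat.ModEq.add_right_cancel' b ?_
      rwa [zero_add, add_assoc, Nat.sub_add_cancel hab.le]
    rw [Nat.modEq_zero_iff_dvd] at h'
    obtain ⟨t, ht⟩ := h'
    -- The number q - 1 - k + (a - b) is positive and less than 2q, so as a multiple of q it equals
    -- q.
    have ht1 : t = 1 := by
      have : t < 2 := by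
        by_contra hcon
        have := Nat.mul_le_mul_left q (not_lt.mp hcon)
        lia
      rcases Nat.lt_or_ge 0 t with h0 | h0
      · lia
      · obtain rfl : t = 0 := by lia
        lia
    subst ht1
    lia
  · intro h
    exact absurd (Finset.mem_range.mpr (by lia)) h
  · intro k hk hne
    rw [Finset.mem_range] at hk
    rw [hsum _ _ (hmod _ _ (by lia) (by lia) (by lia)), zero_smul]
  · intro h
    exact absurd (Finset.mem_range.mpr (by lia)) h

end RootsOfUnity

/-! ### The reflections of G(m, r, n). -/

section Elements

variable {K : Type*} [Field K] {m r n : ℕ}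

/-- The element of `G(m, r, n)` given by a monomial matrix. -/
def monomialElem (σ : Equiv.Perm (Fin n)) (ε : Fin n → Kˣ) (h1 : ∀ i, ε i ^ m = 1)
    (h2 : (∏ i, ε i) ^ (m / r) = 1) : imprimitiveGroup K m r n :=
  ⟨⟨monomialMatrix σ ε, monomialMatrix σ⁻¹ fun j => (ε (σ⁻¹ j))⁻¹, by
      rw [monomialMatrix_mul, mul_inv_cancel, ← monomialMatrix_one]
      congr 1
      funext j
      simp, by
      rw [monomialMatrix_mul, inv_mul_cancel, ← monomialMatrix_one]
      congr 1
      funext j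
      simp⟩, σ, ε, rfl, h1, h2⟩

theorem stdRep_monomialElem (σ : Equiv.Perm (Fin n)) (ε : Fin n → Kˣ) (h1 : ∀ i, ε i ^ m = 1)
    (h2 : (∏ i, ε i) ^ (m / r) = 1) :
    stdRep K m r n (monomialElem σ ε h1 h2) = monomialMatrix σ ε := rfl

theorem monomialMatrix_apply (σ : Equiv.Perm (Fin n)) (ε : Fin n → Kˣ) (k l : Fin n) :
    monomialMatrix σ ε k l = if k = σ l then (ε l : K) else 0 := rfl

/-- The diagonal matrix with entry `η` at the place `i` and `1` elsewhere. -/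
def scaleElem (hr : r ∣ m) (i : Fin n) (η : rootsOfUnity (m / r) K) : imprimitiveGroup K m r n :=
  monomialElem 1 (Pi.mulSingle i (η : Kˣ))
    (fun k => by
      have h : (η : Kˣ) ∈ rootsOfUnity m K := rootsOfUnity_le_of_dvd (Nat.div_dvd_of_dvd hr) η.2
      rw [← Pi.pow_apply, ← Pi.mulSingle_pow, (mem_rootsOfUnity m _).mp h]
      simp)
    (by rw [Fintype.prod_pi_mulSingle']; exact η.2)

/-- The element with `xᵢ ↦ ζ xⱼ`, `xⱼ ↦ ζ⁻¹ xᵢ`. -/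
def swapElem (r : ℕ) (i j : Fin n) (ζ : rootsOfUnity m K) : imprimitiveGroup K m r n :=
  monomialElem (Equiv.swap i j) (Pi.mulSingle j (ζ : Kˣ) * Pi.mulSingle i (ζ : Kˣ)⁻¹)
    (fun k => by
      have h := (mem_rootsOfUnity m _).mp ζ.2
      rw [← Pi.pow_apply, mul_pow, ← Pi.mulSingle_pow, ← Pi.mulSingle_pow, inv_pow, h]
      simp)
    (by
      simp only [Pi.mul_apply]
      rw [Finset.prod_mul_distrib]
      simp)

theorem stdRep_scaleElem_apply (hr : r ∣ m) (i : Fin n) (η : rootsOfUnity (m / r) K)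
    (k l : Fin n) : stdRep K m r n (scaleElem hr i η) k l =
      if k = l then if l = i then ((η : Kˣ) : K) else 1 else 0 := by
  rw [scaleElem, stdRep_monomialElem, monomialMatrix_apply, Equiv.Perm.one_apply,
    Pi.mulSingle_apply]
  split_ifs <;> rfl

theorem scaleElem_mul (hr : r ∣ m) (i : Fin n) (η η' : rootsOfUnity (m / r) K) :
    scaleElem (n := n) hr i η * scaleElem hr i η' = scaleElem hr i (η * η') := by
  refine stdRep_injective m r ?_
  rw [map_mul]
  simp only [scaleElem, stdRep_monomialElem, monomialMatrix_mul]
  rw [one_mul]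
  congr 1
  funext k
  simp [Pi.mulSingle_mul]

theorem scaleElem_one (hr : r ∣ m) (i : Fin n) :
    scaleElem (K := K) hr i 1 = 1 := by
  refine stdRep_injective m r ?_
  rw [map_one]
  ext k l
  rw [stdRep_scaleElem_apply, Matrix.one_apply]
  split_ifs <;> simp

theorem scaleElem_inv (hr : r ∣ m) (i : Fin n) (η : rootsOfUnity (m / r) K) :
    (scaleElem (n := n) hr i η)⁻¹ = scaleElem hr i η⁻¹ := by
  rw [inv_eq_iff_mul_eq_one, scaleElem_mul, mul_inv_cancel, scaleElem_one]

variable {i j : Fin n}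

theorem stdRep_swapElem_left (r : ℕ) (hij : j ≠ i) (ζ : rootsOfUnity m K) (k : Fin n) :
    stdRep K m r n (swapElem r i j ζ) k i = if k = j then ((ζ : Kˣ) : K)⁻¹ else 0 := by
  rw [swapElem, stdRep_monomialElem, monomialMatrix_apply, Equiv.swap_apply_left]
  simp [hij.symm]

theorem stdRep_swapElem_right (r : ℕ) (hij : j ≠ i) (ζ : rootsOfUnity m K) (k : Fin n) :
    stdRep K m r n (swapElem r i j ζ) k j = if k = i then ((ζ : Kˣ) : K) else 0 := by
  rw [swapElem, stdRep_monomialElem, monomialMatrix_apply, Equiv.swap_apply_right]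
  simp [hij]

theorem stdRep_swapElem_of_ne (r : ℕ) (ζ : rootsOfUnity m K) (k : Fin n)
    {l : Fin n} (hi : l ≠ i) (hj : l ≠ j) :
    stdRep K m r n (swapElem r i j ζ) k l = if k = l then 1 else 0 := by
  rw [swapElem, stdRep_monomialElem, monomialMatrix_apply, Equiv.swap_apply_of_ne_of_ne hi hj]
  simp [hi, hj]

theorem swapElem_inv (r : ℕ) (hij : j ≠ i) (ζ : rootsOfUnity m K) :
    (swapElem r i j ζ)⁻¹ = swapElem r i j ζ := by
  rw [inv_eq_iff_mul_eq_one]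
  refine stdRep_injective m r ?_
  rw [map_mul, map_one]
  simp only [swapElem, stdRep_monomialElem, monomialMatrix_mul]
  rw [Equiv.swap_mul_self, ← monomialMatrix_one]
  congr 1
  funext k
  by_cases hi : k = i
  · subst hi
    simp [hij, hij.symm]
  · by_cases hj : k = j
    · subst hj
      simp [hij, hij.symm]
    · simp [hi, hj, Equiv.swap_apply_of_ne_of_ne hi hj]

theorem swapElem_inj {r : ℕ} (hij : j ≠ i) {j' : Fin n} {ζ ζ' : rootsOfUnity m K}
    (h : swapElem r i j ζ = swapElem r i j' ζ') : j = j' ∧ ζ = ζ' := by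
  have h1 := congrArg (fun g => stdRep K m r n g i j) h
  simp only [stdRep_swapElem_right r hij, if_true] at h1
  have hj : j = j' := by
    by_contra hne
    rw [stdRep_swapElem_of_ne r ζ' i hij hne, if_neg hij.symm] at h1
    exact Units.ne_zero _ h1
  rw [← hj, stdRep_swapElem_right r hij, if_pos rfl] at h1
  exact ⟨hj, Subtype.ext (Units.ext h1)⟩

theorem one_sub_scaleElem_inv (hr : r ∣ m) (i : Fin n) (η : rootsOfUnity (m / r) K) :
    1 - stdRep K m r n (scaleElem hr i η)⁻¹ =
      Matrix.vecMulVec ((1 - ((η : Kˣ) : K)⁻¹) • Pi.single i 1) (Pi.single i 1) := by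
  ext k l
  rw [scaleElem_inv, Matrix.sub_apply, stdRep_scaleElem_apply, Matrix.vecMulVec_apply,
    Matrix.one_apply]
  by_cases hl : l = i
  · subst hl
    by_cases hk : k = l <;> simp [hk]
  · simp [hl]

theorem one_sub_swapElem_inv (r : ℕ) (hij : j ≠ i) (ζ : rootsOfUnity m K) :
    1 - stdRep K m r n (swapElem r i j ζ)⁻¹ =
      Matrix.vecMulVec (Pi.single i 1 - ((ζ : Kˣ) : K)⁻¹ • Pi.single j 1)
        (Pi.single i 1 - ((ζ : Kˣ) : K) • Pi.single j 1) := by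
  ext k l
  rw [swapElem_inv r hij, Matrix.sub_apply, Matrix.vecMulVec_apply, Matrix.one_apply]
  by_cases hi : l = i
  · subst hi
    rw [stdRep_swapElem_left r hij]
    by_cases hk : k = l
    · subst hk; simp [hij.symm]
    · by_cases hk' : k = j
      · subst hk'; simp [hij, hij.symm]
      · simp [hk, hk']
  · by_cases hj : l = j
    · subst hj
      rw [stdRep_swapElem_right r hij]
      by_cases hk : k = l
      · subst hk; simp [hij]
      · by_cases hk' : k = i
        · subst hk'; simp [hij, hij.symm]
        · simp [hk, hk', hi]
    · rw [stdRep_swapElem_of_ne r ζ k hi hj]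
      simp [hi, hj]

theorem isReflection_scaleElem (hr : r ∣ m) (i : Fin n) {η : rootsOfUnity (m / r) K}
    (hη : η ≠ 1) : IsReflection (stdRep K m r n) (scaleElem hr i η) := by
  refine isReflection_of_one_sub_inv _ (one_sub_scaleElem_inv hr i η) fun h => hη ?_
  have := congrFun (congrFun h i) i
  rw [stdRep_scaleElem_apply, if_pos rfl, if_pos rfl, Matrix.one_apply_eq] at this
  exact Subtype.ext (Units.ext this)

theorem isReflection_swapElem (r : ℕ) (hij : j ≠ i) (ζ : rootsOfUnity m K) :
    IsReflection (stdRep K m r n) (swapElem r i j ζ) := by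
  refine isReflection_of_one_sub_inv _ (one_sub_swapElem_inv r hij ζ) fun h => ?_
  have := congrFun (congrFun h i) i
  rw [stdRep_swapElem_left r hij, if_neg hij.symm, Matrix.one_apply_eq] at this
  exact zero_ne_one this

/-- Write 1 - s⁻¹ as b times a with a_i ≠ 0. Its i-th column is a_i b, and s⁻¹ is monomial, so b is
supported on i and σ i; outside this set s⁻¹ agrees with the identity. Thus s⁻¹ is diagonal or
exchanges i and σ i, according to whether σ fixes i. -/
theorem eq_scaleElem_or_swapElem (hr : r ∣ m) {s : imprimitiveGroup K m r n}
    (hs : IsReflection (stdRep K m r n) s) (hi : root (stdRep K m r n) s i ≠ 0) :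
    (∃ η : rootsOfUnity (m / r) K, η ≠ 1 ∧ scaleElem hr i η = s) ∨
      ∃ j, j ≠ i ∧ ∃ ζ : rootsOfUnity m K, swapElem r i j ζ = s := by
  obtain ⟨σ, ε, hg, hε, hp⟩ := exists_monomial s⁻¹
  have h := one_sub_eq_root _ hs
  rw [hg] at h
  have he : ∀ k l, (1 : Matrix (Fin n) (Fin n) K) k l - (if k = σ l then (ε l : K) else 0) =
      coroot (stdRep K m r n) s k * root (stdRep K m r n) s l := fun k l =>
    congrFun (congrFun h k) l
  clear h
  set a := root (stdRep K m r n) s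
  set b := coroot (stdRep K m r n) s
  -- Where b vanishes, the matrix 1 - s⁻¹ has a zero row.
  have hfix : ∀ k, b k = 0 → σ k = k ∧ ε k = 1 := fun k hk => by
    have h1 := he k k
    rw [hk, zero_mul, Matrix.one_apply_eq] at h1
    by_cases hσ : k = σ k
    · rw [if_pos hσ, sub_eq_zero] at h1
      exact ⟨hσ.symm, Units.ext h1.symm⟩
    · rw [if_neg hσ, sub_zero] at h1
      exact absurd h1 one_ne_zero
  by_cases hσ : σ i = i
  · left
    have hb : ∀ k, k ≠ i → b k = 0 := fun k hk => by
      have h1 := he k i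
      rw [Matrix.one_apply_ne hk, hσ, if_neg hk, sub_zero] at h1
      exact (mul_eq_zero.mp h1.symm).resolve_right hi
    have hprod : ∏ k, ε k = ε i :=
      Finset.prod_eq_single i (fun k _ hk => (hfix k (hb k hk)).2) (by simp)
    have hη : ε i ∈ rootsOfUnity (m / r) K := by rw [mem_rootsOfUnity, ← hprod, hp]
    have hsc : scaleElem hr i ⟨ε i, hη⟩ = s⁻¹ := by
      refine stdRep_injective m r ?_
      rw [hg]
      ext k l
      rw [stdRep_scaleElem_apply, monomialMatrix_apply]
      by_cases hl : l = i
      · subst hl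
        rw [hσ, if_pos rfl]
      · rw [(hfix l (hb l hl)).1, (hfix l (hb l hl)).2, if_neg hl, Units.val_one]
    have hsc' : scaleElem hr i (⟨ε i, hη⟩⁻¹ : rootsOfUnity (m / r) K) = s := by
      rw [← scaleElem_inv, hsc, inv_inv]
    refine ⟨_, fun h1 => ?_, hsc'⟩
    rw [h1, scaleElem_one] at hsc'
    rw [← hsc', IsReflection, map_one, sub_self, Matrix.rank_zero] at hs
    exact zero_ne_one hs
  · right
    have hσ' : i ≠ σ i := fun h => hσ h.symm
    have hb : ∀ k, k ≠ i → k ≠ σ i → b k = 0 := fun k hk hk' => by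
      have h1 := he k i
      rw [Matrix.one_apply_ne hk, if_neg hk', sub_zero] at h1
      exact (mul_eq_zero.mp h1.symm).resolve_right hi
    have hσσ : σ (σ i) = i := by
      by_contra hne
      have h2 : σ (σ i) ≠ σ i := fun h => hσ (σ.injective h)
      exact h2 (σ.injective (hfix _ (hb _ hne h2)).1)
    have hswap : σ = Equiv.swap i (σ i) := by
      ext k : 1
      by_cases h1 : k = i
      · rw [h1, Equiv.swap_apply_left]
      · by_cases h2 : k = σ i
        · rw [h2, Equiv.swap_apply_right, hσσ]
        · rw [(hfix k (hb k h1 h2)).1, Equiv.swap_apply_of_ne_of_ne h1 h2]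
    have e1 := he i i
    have e2 := he i (σ i)
    have e3 := he (σ i) i
    have e4 := he (σ i) (σ i)
    rw [Matrix.one_apply_eq, if_neg hσ'] at e1
    rw [Matrix.one_apply_ne hσ', hσσ, if_pos rfl] at e2
    rw [Matrix.one_apply_ne hσ, if_pos rfl] at e3
    rw [Matrix.one_apply_eq, hσσ, if_neg hσ] at e4
    -- The minor of the rank one matrix 1 - s⁻¹ on the rows and columns i and σ i vanishes.
    have hmul : (ε i : K) * ε (σ i) = 1 := by
      calc (ε i : K) * ε (σ i) = (0 - (ε (σ i) : K)) * (0 - (ε i : K)) := by ring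
        _ = (b i * a i) * (b (σ i) * a (σ i)) := by rw [e2, e3]; ring
        _ = 1 := by rw [← e1, ← e4]; ring
    have hinv : ε i = (ε (σ i))⁻¹ := by
      rw [eq_inv_iff_mul_eq_one]
      exact Units.ext hmul
    refine ⟨σ i, hσ, ⟨ε (σ i), hε _⟩, ?_⟩
    rw [← inv_inj, swapElem_inv r hσ]
    refine stdRep_injective m r ?_
    rw [hg, swapElem, stdRep_monomialElem, ← hswap]
    congr 1
    funext k
    by_cases h1 : k = i
    · subst h1
      simp [hσ', hinv]
    · by_cases h2 : k = σ i
      · subst h2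
        simp [hσ]
      · simp [h1, h2, (hfix k (hb k h1 h2)).2]

variable [NeZero m] [NeZero (m / r)]

/-- A sum over the reflections moving `yᵢ`. -/
theorem sum_reflections {E : Type*} [AddCommMonoid E] (hr : r ∣ m) (i : Fin n)
    (f : imprimitiveGroup K m r n → E)
    (hf : ∀ s, root (stdRep K m r n) s i = 0 → f s = 0) [DecidableEq (rootsOfUnity (m / r) K)] :
    ∑ s ∈ reflections (stdRep K m r n), f s =
      ∑ η : rootsOfUnity (m / r) K with η ≠ 1, f (scaleElem hr i η) +
        ∑ j with j ≠ i, ∑ ζ : rootsOfUnity m K, f (swapElem r i j ζ) := by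
  rw [← Finset.sum_product']
  refine Eq.trans ?_ (Finset.sum_disjSum _ _ (Sum.elim (fun η => f (scaleElem hr i η))
    fun p : Fin n × rootsOfUnity m K => f (swapElem r i p.1 p.2)))
  symm
  refine Finset.sum_of_injOn (Sum.elim (fun η => scaleElem hr i η)
    fun p : Fin n × rootsOfUnity m K => swapElem r i p.1 p.2) ?_ ?_ ?_ ?_
  -- The entry at (i, i) is a unit for the diagonal elements and 0 for the others.
  · have hss : ∀ (η : rootsOfUnity (m / r) K) (p : Fin n × rootsOfUnity m K), p.1 ≠ i →
        scaleElem hr i η ≠ swapElem r i p.1 p.2 := fun η p hp h => by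
      have := congrArg (fun g => stdRep K m r n g i i) h
      simp only [stdRep_scaleElem_apply, stdRep_swapElem_left r hp] at this
      simp [hp.symm] at this
    rintro (η | p) hx (η' | p') hy h
    · have := congrArg (fun g => stdRep K m r n g i i) h
      simp only [Sum.elim_inl, stdRep_scaleElem_apply, if_true] at this
      rw [Subtype.ext (Units.ext this)]
    · simp at hy
      exact absurd h (hss η p' hy)
    · simp at hx
      exact absurd h.symm (hss η' p hx)
    · simp at hx hy
      obtain ⟨h1, h2⟩ := swapElem_inj hx h
      exact congrArg Sum.inr (Prod.ext h1 h2)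
  · rintro (η | p) hx
    · simp at hx
      simpa [mem_reflections] using isReflection_scaleElem hr i hx
    · simp at hx
      simpa [mem_reflections] using isReflection_swapElem r hx p.2
  · intro s hs hne
    refine hf s ?_
    by_contra hi
    refine hne ?_
    rcases eq_scaleElem_or_swapElem hr (mem_reflections.mp hs) hi with ⟨η, hη, rfl⟩ |
      ⟨j, hj, ζ, rfl⟩
    · exact ⟨Sum.inl η, by simpa using hη, rfl⟩
    · exact ⟨Sum.inr (j, ζ), by simpa using hj, rfl⟩
  · rintro (η | p) _ <;> rfl

end Elements

/-! ### Equivariance of the substitution along π, and reflections in the fibres of π. -/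

section PowHom

variable {K : Type*} [Field K] {m r n : ℕ}
variable {V : Type*} [AddCommGroup V] [Module K V]

theorem stdRep_powHom [NeZero m] (hr : r ∣ m) (g : imprimitiveGroup K m r n) :
    stdRep K r r n (powHom hr g) = (stdRep K m r n g).map (· ^ (m / r)) := rfl

theorem powHom_scaleElem [NeZero m] (hr : r ∣ m) (i : Fin n) (η : rootsOfUnity (m / r) K) :
    powHom hr (scaleElem hr i η) = 1 := by
  refine stdRep_injective r r ?_
  rw [map_one, stdRep_powHom]
  ext k l
  have hη : ((η : Kˣ) : K) ^ (m / r) = 1 := by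
    rw [← Units.val_pow_eq_pow_val, (mem_rootsOfUnity _ _).mp η.2, Units.val_one]
  rw [Matrix.map_apply, stdRep_scaleElem_apply, Matrix.one_apply]
  split_ifs <;> simp [hη, div_ne_zero_of_dvd hr]

theorem powHom_swapElem [NeZero m] (hr : r ∣ m) {i j : Fin n} (hij : j ≠ i) (ζ : rootsOfUnity m K) :
    powHom hr (swapElem r i j ζ) = swapElem r i j (powRoot hr ζ) := by
  refine stdRep_injective r r ?_
  rw [stdRep_powHom]
  have hq := div_ne_zero_of_dvd hr
  ext k l
  rw [Matrix.map_apply]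
  by_cases hi : l = i
  · subst hi
    rw [stdRep_swapElem_left r hij, stdRep_swapElem_left r hij]
    split_ifs <;> simp [powRoot, hq]
  · by_cases hj : l = j
    · subst hj
      rw [stdRep_swapElem_right r hij, stdRep_swapElem_right r hij]
      split_ifs <;> simp [powRoot, hq]
    · rw [stdRep_swapElem_of_ne r ζ k hi hj, stdRep_swapElem_of_ne r _ k hi hj]
      split_ifs <;> simp [hq]

theorem powHom_surjective [NeZero m] [NeZero r] (hr : r ∣ m) {ξ : K} (hξ : IsPrimitiveRoot ξ m) :
    Function.Surjective (powHom hr : imprimitiveGroup K m r n →* imprimitiveGroup K r r n) := by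
  intro g
  obtain ⟨σ, ε, hg, hε, hp⟩ := exists_monomial g
  choose ζ hζ using fun k => powRoot_surjective hr hξ ⟨ε k, hε k⟩
  have hp' : (∏ k, (ζ k : Kˣ)) ^ (m / r) = 1 := by
    rw [← Finset.prod_pow]
    have : ∀ k, (ζ k : Kˣ) ^ (m / r) = ε k := fun k => congrArg Subtype.val (hζ k)
    simp only [this]
    rwa [Nat.div_self (NeZero.pos r), pow_one] at hp
  refine ⟨monomialElem σ (fun k => (ζ k : Kˣ)) (fun k => (mem_rootsOfUnity m _).mp (ζ k).2) hp', ?_⟩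
  refine stdRep_injective r r ?_
  rw [stdRep_powHom, stdRep_monomialElem, monomialMatrix_map_pow _ _ (div_ne_zero_of_dvd hr), hg]
  congr 1
  funext k
  exact congrArg Subtype.val (hζ k)

/-- A row of a monomial matrix has a single nonzero entry, so raising its linear form to the power q
creates no cross terms. This is what makes x_i ↦ x_i^q equivariant along π. -/
theorem linForm_pow_expand [NeZero m] (hr : r ∣ m) (g : imprimitiveGroup K m r n) (j : Fin n) :
    linForm (stdRep K m r n g j) ^ (m / r) =
      MvPolynomial.expand (m / r) (linForm (stdRep K r r n (powHom hr g) j)) := by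
  obtain ⟨σ, ε, hg, -, -⟩ := exists_monomial g
  have h : ∀ ε : Fin n → Kˣ, linForm (monomialMatrix σ ε j) =
      MvPolynomial.C (ε (σ⁻¹ j) : K) * MvPolynomial.X (σ⁻¹ j) := fun ε => by
    rw [linForm, Finset.sum_eq_single (σ⁻¹ j)]
    · rw [monomialMatrix_apply, if_pos (by simp)]
    · intro l _ hl
      rw [monomialMatrix_apply, if_neg, MvPolynomial.C_0, zero_mul]
      rintro rfl
      simp at hl
    · simp
  rw [stdRep_powHom, hg, monomialMatrix_map_pow _ _ (div_ne_zero_of_dvd hr), h, h, map_mul,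
    MvPolynomial.expand_C, MvPolynomial.expand_X, mul_pow, Units.val_pow_eq_pow_val, map_pow]

theorem polyAct_expand [NeZero m] (hr : r ∣ m) (g : imprimitiveGroup K m r n)
    (f : MvPolynomial (Fin n) K) :
    polyAct (stdRep K m r n) g (MvPolynomial.expand (m / r) f) =
      MvPolynomial.expand (m / r) (polyAct (stdRep K r r n) (powHom hr g) f) := by
  rw [← AlgHom.comp_apply, ← AlgHom.comp_apply]
  congr 1
  refine MvPolynomial.algHom_ext fun j => ?_
  rw [AlgHom.comp_apply, AlgHom.comp_apply, MvPolynomial.expand_X, map_pow, polyAct_X, polyAct_X,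
    linForm_pow_expand hr, map_inv]

theorem groupOp_smul {G : Type*} [Group G] (ρ : G →* Matrix (Fin n) (Fin n) K)
    (τ : Representation K G V) (g : G) (p : MvPolynomial (Fin n) K)
    (F : MvPolynomial (Fin n) K ⊗[K] V) :
    groupOp ρ τ g (p • F) = polyAct ρ g p • groupOp ρ τ g F := by
  induction F using TensorProduct.induction_on with
  | zero => simp
  | add F H hF hH => simp only [smul_add, map_add, hF, hH]
  | tmul f v =>
    simp only [groupOp, TensorProduct.smul_tmul', smul_eq_mul, TensorProduct.map_tmul,
      AlgHom.toLinearMap_apply, map_mul]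

theorem groupOp_powOp [NeZero m] (hr : r ∣ m) (τ' : Representation K (imprimitiveGroup K r r n) V)
    (g : imprimitiveGroup K m r n) (F : MvPolynomial (Fin n) K ⊗[K] V) :
    groupOp (stdRep K m r n) (τ'.comp (powHom hr)) g (powOp K n V (m / r) F) =
      powOp K n V (m / r) (groupOp (stdRep K r r n) τ' (powHom hr g) F) := by
  induction F using TensorProduct.induction_on with
  | zero => simp
  | add F H hF hH => simp only [map_add, hF, hH]
  | tmul f v =>
    simp only [groupOp, powOp, TensorProduct.map_tmul, AlgHom.toLinearMap_apply,
      polyAct_expand hr, LinearMap.id_apply]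
    rfl

theorem groupOp_mem_powSubmodule [NeZero m] (hr : r ∣ m)
    (τ' : Representation K (imprimitiveGroup K r r n) V)
    {J : Submodule K (MvPolynomial (Fin n) K ⊗[K] V)}
    (hJ : ∀ g, ∀ F ∈ J, groupOp (stdRep K r r n) τ' g F ∈ J) (g : imprimitiveGroup K m r n)
    {F : MvPolynomial (Fin n) K ⊗[K] V} (hF : F ∈ powSubmodule (m / r) J) :
    groupOp (stdRep K m r n) (τ'.comp (powHom hr)) g F ∈ powSubmodule (m / r) J := by
  induction hF using Submodule.span_induction with
  | mem _ h =>
    obtain ⟨H, hH, rfl⟩ := h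
    exact (groupOp_powOp hr τ' g H).symm ▸ Submodule.subset_span ⟨_, hJ _ _ hH, rfl⟩
  | zero => rw [map_zero]; exact Submodule.zero_mem _
  | add F H _ _ hF hH => rw [map_add]; exact Submodule.add_mem _ hF hH
  | smul p F _ hF => rw [groupOp_smul]; exact Submodule.smul_mem _ _ hF

theorem scaleElem_conj_swapElem (hr : r ∣ m) {i j : Fin n} (hij : j ≠ i)
    (η : rootsOfUnity (m / r) K) (ζ ζ' : rootsOfUnity m K) (h : (ζ' : Kˣ) = η * ζ) :
    scaleElem hr i η * swapElem r i j ζ * (scaleElem hr i η)⁻¹ = swapElem r i j ζ' := by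
  refine stdRep_injective m r ?_
  rw [scaleElem_inv, map_mul, map_mul]
  simp only [scaleElem, swapElem, stdRep_monomialElem, monomialMatrix_mul]
  rw [one_mul, mul_one]
  congr 1
  funext k
  by_cases hi : k = i
  · subst hi
    simp [hij, hij.symm, h, mul_comm]
  · by_cases hj : k = j
    · subst hj
      simp [hij, h]
    · simp [hi, hj, Equiv.swap_apply_of_ne_of_ne hi hj]

theorem powRoot_eq_iff (hr : r ∣ m) {ζ ζ' : rootsOfUnity m K}
    (h : powRoot hr ζ' = powRoot hr ζ) : ∃ η : rootsOfUnity (m / r) K, (ζ' : Kˣ) = η * ζ := by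
  have h1 : powRoot hr (ζ' * ζ⁻¹) = 1 := by rw [map_mul, map_inv, h, mul_inv_cancel]
  exact ⟨⟨(ζ' * ζ⁻¹ : rootsOfUnity m K), congrArg Subtype.val h1⟩,
    (inv_mul_cancel_right (ζ' : Kˣ) ζ).symm⟩

/-- All reflections over a given reflection of `G(r, r, n)` are conjugate. -/
theorem inducedParam_swapElem [NeZero m] [NeZero r] (hr : r ∣ m) {ξ : K} (hξ : IsPrimitiveRoot ξ m)
    (c : ConjClasses (imprimitiveGroup K m r n) → K) {i j : Fin n} (hij : j ≠ i)
    (ζ : rootsOfUnity m K) :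
    inducedParam hr c (ConjClasses.mk (swapElem r i j (powRoot hr ζ))) =
      c (ConjClasses.mk (swapElem r i j ζ)) := by
  have hex : ∃ s, IsReflection (stdRep K m r n) s ∧
      ConjClasses.mk (powHom hr s) = ConjClasses.mk (swapElem r i j (powRoot hr ζ)) :=
    ⟨swapElem r i j ζ, isReflection_swapElem r hij ζ, by rw [powHom_swapElem hr hij]⟩
  rw [inducedParam, dif_pos hex]
  obtain ⟨hs, hmk⟩ := hex.choose_spec
  set s := hex.choose
  rw [ConjClasses.mk_eq_mk_iff_isConj, isConj_iff] at hmk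
  obtain ⟨g', hg'⟩ := hmk
  -- Lifting the conjugating element to G replaces the chosen reflection by a conjugate t whose
  -- image is exactly the given reflection.
  obtain ⟨g, rfl⟩ := powHom_surjective hr hξ g'
  have hs1 := isReflection_conj _ g hs
  rw [← map_inv, ← map_mul, ← map_mul] at hg'
  have hconj : ConjClasses.mk s = ConjClasses.mk (g * s * g⁻¹) :=
    ConjClasses.mk_eq_mk_iff_isConj.mpr (isConj_iff.mpr ⟨g, rfl⟩)
  rw [hconj]
  congr 1
  generalize g * s * g⁻¹ = t at *
  have hii : stdRep K r r n (powHom hr t) i i = 0 := by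
    rw [hg', stdRep_swapElem_left r hij, if_neg hij.symm]
  -- Otherwise the entry of t⁻¹ at (i, i) would be 1, whereas the image of t⁻¹ under π has the entry
  -- 0 there.
  have hroot : root (stdRep K m r n) t i ≠ 0 := fun h0 => by
    have h1 := congrFun (congrFun (one_sub_eq_root _ hs1) i) i
    rw [Matrix.vecMulVec_apply, h0, mul_zero, Matrix.sub_apply, Matrix.one_apply_eq,
      sub_eq_zero] at h1
    have h2 : stdRep K r r n (powHom hr t⁻¹) i i = 1 := by
      rw [stdRep_powHom, Matrix.map_apply, ← h1, one_pow]
    rw [map_inv, hg', swapElem_inv r hij, stdRep_swapElem_left r hij, if_neg hij.symm] at h2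
    exact zero_ne_one h2
  rcases eq_scaleElem_or_swapElem hr hs1 hroot with ⟨η, -, rfl⟩ | ⟨j', hj', ζ', rfl⟩
  · rw [powHom_scaleElem, map_one, Matrix.one_apply_eq] at hii
    exact absurd hii one_ne_zero
  · rw [powHom_swapElem hr hj'] at hg'
    obtain ⟨rfl, hζ⟩ := swapElem_inj hj' hg'
    -- The two parameters differ by a q-th root of unity η, and conjugation by the diagonal element
    -- with entry η at i carries one reflection to the other.
    obtain ⟨η, hη⟩ := powRoot_eq_iff hr hζ.symm
    exact ConjClasses.mk_eq_mk_iff_isConj.mpr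
      (isConj_iff.mpr ⟨_, scaleElem_conj_swapElem hr hij η ζ' ζ hη⟩)

end PowHom

/-! ### Divided differences of x^a g(x^q). -/

section DunklFormula

variable {K : Type*} [Field K] {m r n : ℕ}
variable {V : Type*} [AddCommGroup V] [Module K V]

theorem linForm_single (i : Fin n) :
    linForm (Pi.single i (1 : K)) = MvPolynomial.X i := by
  rw [linForm, Finset.sum_eq_single i]
  · simp
  · intro l _ hl
    simp [hl]
  · simp

theorem linForm_sub (a b : Fin n → K) : linForm (a - b) = linForm a - linForm b := by
  simp [linForm, sub_mul]

theorem X_sub_polyAct_X_of_eq {G : Type*} [Group G] (ρ : G →* Matrix (Fin n) (Fin n) K) {s : G}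
    {a b : Fin n → K} (hab : 1 - ρ s⁻¹ = Matrix.vecMulVec b a) (k : Fin n) :
    MvPolynomial.X k - polyAct ρ s (MvPolynomial.X k) = b k • linForm a := by
  rw [polyAct_X, ← linForm_single, ← linForm_sub, ← linForm_smul]
  congr 1
  funext l
  have h := congrFun (congrFun hab k) l
  rw [Matrix.vecMulVec_apply, Matrix.sub_apply, Matrix.one_apply] at h
  rw [Pi.smul_apply, smul_eq_mul, ← h, Pi.sub_apply, Pi.single_apply]
  simp only [eq_comm]

theorem linForm_single_sub (i j : Fin n) (z : K) :
    linForm (Pi.single i 1 - z • Pi.single j 1) =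
      (MvPolynomial.X i - z • MvPolynomial.X j : MvPolynomial (Fin n) K) := by
  rw [linForm_sub, linForm_smul, linForm_single, linForm_single]

section Swap

variable {i j : Fin n}

theorem polyAct_swapElem_left (r : ℕ) (hij : j ≠ i) (ζ : rootsOfUnity m K) :
    polyAct (stdRep K m r n) (swapElem r i j ζ) (MvPolynomial.X i) =
      ((ζ : Kˣ) : K) • MvPolynomial.X j := by
  have h := X_sub_polyAct_X_of_eq _ (one_sub_swapElem_inv r hij ζ) i
  rw [linForm_single_sub] at h
  simp only [Pi.sub_apply, Pi.single_eq_same, Pi.smul_apply, Pi.single_eq_of_ne hij.symm,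
    smul_zero, sub_zero, one_smul, sub_right_inj] at h
  exact h

theorem polyAct_swapElem_right (r : ℕ) (hij : j ≠ i) (ζ : rootsOfUnity m K) :
    polyAct (stdRep K m r n) (swapElem r i j ζ) (MvPolynomial.X j) =
      ((ζ : Kˣ) : K)⁻¹ • MvPolynomial.X i := by
  have h := X_sub_polyAct_X_of_eq _ (one_sub_swapElem_inv r hij ζ) j
  rw [linForm_single_sub] at h
  simp only [Pi.sub_apply, Pi.single_eq_same, Pi.smul_apply, Pi.single_eq_of_ne hij, zero_sub,
    smul_eq_mul, mul_one, neg_smul, smul_sub, smul_smul] at h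
  rw [neg_mul, inv_mul_cancel₀ (Units.ne_zero _), neg_smul, one_smul] at h
  linear_combination -h

theorem polyAct_swapElem_of_ne (r : ℕ) (hij : j ≠ i) (ζ : rootsOfUnity m K) {k : Fin n}
    (hi : k ≠ i) (hj : k ≠ j) :
    polyAct (stdRep K m r n) (swapElem r i j ζ) (MvPolynomial.X k) = MvPolynomial.X k := by
  have h := X_sub_polyAct_X_of_eq _ (one_sub_swapElem_inv r hij ζ) k
  simp only [Pi.sub_apply, Pi.smul_apply, Pi.single_eq_of_ne hi, Pi.single_eq_of_ne hj, smul_zero,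
    sub_zero, zero_smul] at h
  exact (sub_eq_zero.mp h).symm

theorem sub_mul_rootDiff_swapElem (r : ℕ) (hij : j ≠ i) (ζ : rootsOfUnity m K)
    (f : MvPolynomial (Fin n) K) :
    (MvPolynomial.X i - ((ζ : Kˣ) : K) • MvPolynomial.X j) *
        rootDiff (stdRep K m r n) (swapElem r i j ζ) i f =
      f - polyAct (stdRep K m r n) (swapElem r i j ζ) f := by
  rw [← linForm_single_sub, linForm_mul_rootDiff _ (isReflection_swapElem r hij ζ)
    (one_sub_swapElem_inv r hij ζ)]
  simp [hij]

theorem monomial_smallExp_eq {q : ℕ} (hij : j ≠ i) (a : Fin n → Fin q) :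
    MvPolynomial.monomial (smallExp a) (1 : K) =
      MvPolynomial.X i ^ (a i : ℕ) * MvPolynomial.X j ^ (a j : ℕ) *
        ∏ l ∈ (Finset.univ.erase i).erase j, MvPolynomial.X l ^ (a l : ℕ) := by
  rw [MvPolynomial.monomial_eq, MvPolynomial.C_1, one_mul, Finsupp.prod_fintype _ _ (by simp),
    ← Finset.mul_prod_erase _ _ (Finset.mem_univ i),
    ← Finset.mul_prod_erase _ _ (Finset.mem_erase.mpr ⟨hij, Finset.mem_univ j⟩), mul_assoc]
  rfl

/-- Its value at the i-th basis vector is 1. It is the common denominator to be cancelled in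
`sum_rootDiff_swapElem`. -/
theorem X_pow_sub_ne_zero {q : ℕ} (hq : q ≠ 0) (hij : j ≠ i) (ω : K) :
    (MvPolynomial.X i ^ q - ω • MvPolynomial.X j ^ q : MvPolynomial (Fin n) K) ≠ 0 := by
  intro h
  have := congrArg (MvPolynomial.eval (Pi.single i (1 : K))) h
  simp [MvPolynomial.smul_eval, hij, hq] at this

-- The computational heart. After multiplication by x_i^q - ω x_j^q the left side is a combination
-- of power sums over the fibre ζ^q = ω, of which orthogonality keeps two. What remains is the
-- divided difference of G' in the variables x^q. If a_j < a_i, it is X^q P - ω Y^q P' = X^q (P -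
-- P') + (X^q - ω Y^q) P' that appears instead of P - P', and the last term is the source of the
-- reflection term.
open Classical in
theorem sum_rootDiff_swapElem [NeZero m] [NeZero r] [NeZero (m / r)] (hr : r ∣ m) {ξ : K}
    (hξ : IsPrimitiveRoot ξ m) (hij : j ≠ i) (ω : rootsOfUnity r K) (a : Fin n → Fin (m / r))
    (g : MvPolynomial (Fin n) K) :
    ∑ ζ : rootsOfUnity m K with powRoot hr ζ = ω,
        rootDiff (stdRep K m r n) (swapElem r i j ζ) i
          (MvPolynomial.monomial (smallExp a) 1 * MvPolynomial.expand (m / r) g) =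
      ((m / r : ℕ) : K) • (MvPolynomial.monomial (smallExp (lowerExp i a)) 1 *
        MvPolynomial.expand (m / r)
          (if (a i : ℕ) = 0 then rootDiff (stdRep K r r n) (swapElem r i j ω) i g
          else MvPolynomial.X i * rootDiff (stdRep K r r n) (swapElem r i j ω) i g +
            if a j < a i then polyAct (stdRep K r r n) (swapElem r i j ω) g else 0)) := by
  have hq := NeZero.ne (m / r)
  refine mul_left_cancel₀ (X_pow_sub_ne_zero hq hij ((ω : Kˣ) : K)) ?_
  set R : MvPolynomial (Fin n) K :=
    ∏ l ∈ (Finset.univ.erase i).erase j, MvPolynomial.X l ^ (a l : ℕ) with hR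
  set Δ := rootDiff (stdRep K r r n) (swapElem r i j ω) i g with hΔ
  set g' := polyAct (stdRep K r r n) (swapElem r i j ω) g with hg'
  -- The defining equation of the divided difference for G', after the substitution of q-th powers.
  have hsub : MvPolynomial.expand (m / r) g - MvPolynomial.expand (m / r) g' =
      (MvPolynomial.X i ^ (m / r) - ((ω : Kˣ) : K) • MvPolynomial.X j ^ (m / r)) *
        MvPolynomial.expand (m / r) Δ := by
    rw [hg', ← map_sub, ← sub_mul_rootDiff_swapElem r hij ω, map_mul, map_sub, map_smul,
      MvPolynomial.expand_X, MvPolynomial.expand_X]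
  have hmon : MvPolynomial.monomial (smallExp (lowerExp i a)) (1 : K) =
      MvPolynomial.X i ^ (lowerExp i a i : ℕ) * MvPolynomial.X j ^ (a j : ℕ) * R := by
    rw [monomial_smallExp_eq hij]
    have hl : ∀ l, l ≠ i → lowerExp i a l = a l := fun l hl => Function.update_of_ne hl _ _
    rw [hl j hij]
    congr 1
    refine Finset.prod_congr rfl fun l hl' => ?_
    rw [hl l (by simp at hl'; exact hl'.2)]
  have hlow : (lowerExp i a i : ℕ) = if (a i : ℕ) = 0 then m / r - 1 else a i - 1 := by
    rw [lowerExp, Function.update_self, Fin.val_sub_one_eq]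
  have hz : ∀ ζ ∈ (Finset.univ.filter fun ζ : rootsOfUnity m K => powRoot hr ζ = ω),
      ((ζ : Kˣ) : K) ^ (m / r) = ((ω : Kˣ) : K) := fun ζ hζ => by
    rw [Finset.mem_filter] at hζ
    rw [← hζ.2]
    simp [powRoot]
  -- The reflection sends x_i to ζ x_j and x_j to ζ⁻¹ x_i, fixes the remaining variables, hence R,
  -- and acts on g(x^q) through ω alone.
  have hd : ∀ ζ ∈ (Finset.univ.filter fun ζ : rootsOfUnity m K => powRoot hr ζ = ω),
      (MvPolynomial.X i - ((ζ : Kˣ) : K) • MvPolynomial.X j) *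
        rootDiff (stdRep K m r n) (swapElem r i j ζ) i
          (MvPolynomial.monomial (smallExp a) 1 * MvPolynomial.expand (m / r) g) =
      MvPolynomial.X i ^ (a i : ℕ) * MvPolynomial.X j ^ (a j : ℕ) *
          (R * MvPolynomial.expand (m / r) g) -
        (((ζ : Kˣ) : K) ^ (a i : ℕ) * (((ζ : Kˣ) : K)⁻¹) ^ (a j : ℕ)) •
          (MvPolynomial.X j ^ (a i : ℕ) * MvPolynomial.X i ^ (a j : ℕ) *
            (R * MvPolynomial.expand (m / r) g')) := fun ζ hζ => by
    rw [Finset.mem_filter] at hζ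
    have hRfix : polyAct (stdRep K m r n) (swapElem r i j ζ) R = R := by
      rw [hR, map_prod]
      refine Finset.prod_congr rfl fun l hl => ?_
      rw [Finset.mem_erase, Finset.mem_erase] at hl
      rw [map_pow, polyAct_swapElem_of_ne r hij ζ hl.2.1 hl.1]
    rw [sub_mul_rootDiff_swapElem r hij, monomial_smallExp_eq hij, ← hR, map_mul, map_mul, map_mul,
      map_pow, map_pow, polyAct_swapElem_left r hij, polyAct_swapElem_right r hij, hRfix,
      polyAct_expand hr, powHom_swapElem hr hij, hζ.2, ← hg', smul_pow, smul_pow]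
    simp only [MvPolynomial.smul_eq_C_mul, map_mul]
    ring
  have hz0 : ∀ ζ ∈ (Finset.univ.filter fun ζ : rootsOfUnity m K => powRoot hr ζ = ω),
      ((ζ : Kˣ) : K) ≠ 0 := fun ζ _ => Units.ne_zero _
  rcases Nat.lt_or_ge (a j) (a i) with hlt | hle
  · rw [sum_quotient_of_lt _ (fun ζ : rootsOfUnity m K => ((ζ : Kˣ) : K)) hz hz0
      (card_powRoot_fiber hr hξ ω) (sum_powRoot_fiber_pow hr hξ ω) hlt (a i).isLt hd]
    have h0 : (a i : ℕ) ≠ 0 := by lia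
    rw [if_neg h0, if_pos (Fin.lt_def.mpr hlt), hmon, hlow, if_neg h0, mul_smul_comm, map_add,
      map_mul, MvPolynomial.expand_X]
    refine congrArg (((m / r : ℕ) : K) • ·) ?_
    simp only [MvPolynomial.smul_eq_C_mul] at hsub ⊢
    linear_combination MvPolynomial.X i ^ ((a i : ℕ) - 1) * MvPolynomial.X j ^ (a j : ℕ) * R *
      MvPolynomial.X i ^ (m / r) * hsub
  · rw [sum_quotient_of_le _ (fun ζ : rootsOfUnity m K => ((ζ : Kˣ) : K)) hz hz0
      (card_powRoot_fiber hr hξ ω) (sum_powRoot_fiber_pow hr hξ ω) hle (a j).isLt hd]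
    rw [if_neg (fun h => absurd (Fin.lt_def.mp h) (by lia)), hmon, hlow, mul_smul_comm, ← mul_sub R,
      hsub, add_zero]
    by_cases h0 : (a i : ℕ) = 0
    · rw [if_pos h0, if_pos h0, h0, add_zero]
      refine congrArg (((m / r : ℕ) : K) • ·) ?_
      ring
    -- The exponent q - 1 + a_i splits off x_i^q, which is the factor x_i of the new coefficient.
    · rw [if_neg h0, if_neg h0, map_mul, MvPolynomial.expand_X, show m / r - 1 + (a i : ℕ) =
      (a i - 1) + m / r by lia,
        pow_add]
      refine congrArg (((m / r : ℕ) : K) • ·) ?_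
      ring

end Swap

theorem polyAct_scaleElem_self (hr : r ∣ m) (i : Fin n) (η : rootsOfUnity (m / r) K) :
    polyAct (stdRep K m r n) (scaleElem hr i η) (MvPolynomial.X i) =
      ((η : Kˣ) : K)⁻¹ • MvPolynomial.X i := by
  have h := X_sub_polyAct_X_of_eq _ (one_sub_scaleElem_inv hr i η) i
  rw [linForm_single] at h
  simp only [Pi.smul_apply, Pi.single_eq_same, smul_eq_mul, mul_one, sub_smul, one_smul,
    sub_right_inj] at h
  exact h

theorem polyAct_scaleElem_of_ne (hr : r ∣ m) {i k : Fin n} (hk : k ≠ i)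
    (η : rootsOfUnity (m / r) K) :
    polyAct (stdRep K m r n) (scaleElem hr i η) (MvPolynomial.X k) = MvPolynomial.X k := by
  have h := X_sub_polyAct_X_of_eq _ (one_sub_scaleElem_inv hr i η) k
  simp only [Pi.smul_apply, Pi.single_eq_of_ne hk, smul_zero, zero_smul] at h
  exact (sub_eq_zero.mp h).symm

/-- The diagonal reflection fixes g(x^q), because η^q = 1, and multiplies x^a by η^(-a_i). For a_i =
0 the lowered exponent wraps around to q - 1, which is harmless because the scalar is then 0. -/
theorem rootDiff_scaleElem [NeZero m] [NeZero (m / r)] (hr : r ∣ m) (i : Fin n)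
    {η : rootsOfUnity (m / r) K} (hη : η ≠ 1) (a : Fin n → Fin (m / r))
    (g : MvPolynomial (Fin n) K) :
    rootDiff (stdRep K m r n) (scaleElem hr i η) i
        (MvPolynomial.monomial (smallExp a) 1 * MvPolynomial.expand (m / r) g) =
      (1 - ((η : Kˣ) : K)⁻¹ ^ (a i : ℕ)) • (MvPolynomial.monomial (smallExp (lowerExp i a)) 1 *
        MvPolynomial.expand (m / r) g) := by
  have hmon : ∀ a : Fin n → Fin (m / r), MvPolynomial.monomial (smallExp a) (1 : K) =
      MvPolynomial.X i ^ (a i : ℕ) * ∏ l ∈ Finset.univ.erase i, MvPolynomial.X l ^ (a l : ℕ) := by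
    intro a
    rw [MvPolynomial.monomial_eq, MvPolynomial.C_1, one_mul, Finsupp.prod_fintype _ _ (by simp),
      ← Finset.mul_prod_erase _ _ (Finset.mem_univ i)]
    rfl
  set R : MvPolynomial (Fin n) K := ∏ l ∈ Finset.univ.erase i, MvPolynomial.X l ^ (a l : ℕ) with hR
  have hlow : MvPolynomial.monomial (smallExp (lowerExp i a)) (1 : K) =
      MvPolynomial.X i ^ (if (a i : ℕ) = 0 then m / r - 1 else a i - 1) * R := by
    rw [hmon, lowerExp, Function.update_self, Fin.val_sub_one_eq]
    congr 1
    refine Finset.prod_congr rfl fun l hl => ?_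
    rw [Function.update_of_ne (Finset.ne_of_mem_erase hl)]
  have hRfix : polyAct (stdRep K m r n) (scaleElem hr i η) R = R := by
    rw [hR, map_prod]
    refine Finset.prod_congr rfl fun l hl => ?_
    rw [map_pow, polyAct_scaleElem_of_ne hr (Finset.ne_of_mem_erase hl)]
  refine mul_left_cancel₀ (MvPolynomial.X_ne_zero (R := K) i) ?_
  have h := linForm_mul_rootDiff _ (isReflection_scaleElem hr i hη) (one_sub_scaleElem_inv hr i η) i
    (MvPolynomial.monomial (smallExp a) 1 * MvPolynomial.expand (m / r) g)
  rw [linForm_single, Pi.single_eq_same, one_smul] at h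
  rw [h, hlow, hmon, ← hR, map_mul, map_mul, map_pow, polyAct_scaleElem_self, hRfix,
    polyAct_expand hr, powHom_scaleElem, polyAct_one, AlgHom.id_apply, smul_pow]
  by_cases h0 : (a i : ℕ) = 0
  · simp [h0]
  · rw [if_neg h0]
    have h1 : (MvPolynomial.X i : MvPolynomial (Fin n) K) ^ (a i : ℕ) =
        MvPolynomial.X i * MvPolynomial.X i ^ ((a i : ℕ) - 1) := by
      rw [← pow_succ', Nat.sub_add_cancel (Nat.one_le_iff_ne_zero.mpr h0)]
    rw [h1, sub_smul, one_smul]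
    simp only [MvPolynomial.smul_eq_C_mul]
    ring

end DunklFormula

/-! ### Dunkl operators of G in terms of those of G'. -/

section DunklMonOp

variable {K : Type*} [Field K] {m r n : ℕ}
variable {V : Type*} [AddCommGroup V] [Module K V]

theorem neg_smul_tensor (t : K) (F : MvPolynomial (Fin n) K ⊗[K] V) : (-t) • F = -(t • F) :=
  neg_smul t F

theorem smul_neg_tensor (t : K) (F : MvPolynomial (Fin n) K ⊗[K] V) : t • (-F) = -(t • F) :=
  smul_neg t F

theorem dunkl_tmul {G : Type*} [Group G] [Finite G] (ρ : G →* Matrix (Fin n) (Fin n) K)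
    (c : ConjClasses G → K) (τ : Representation K G V) (i : Fin n) (f : MvPolynomial (Fin n) K)
    (v : V) : dunkl ρ c τ i (f ⊗ₜ v) =
      -∑ s ∈ reflections ρ, c (ConjClasses.mk s) • (rootDiff ρ s i f ⊗ₜ τ s v) := by
  simp only [dunkl_apply_eq_sum_rootDiff, LinearMap.neg_apply, LinearMap.sum_apply,
    LinearMap.smul_apply, TensorProduct.map_tmul]

open Classical in
theorem dunkl_stdRep_tmul [NeZero m] [NeZero (m / r)] (hr : r ∣ m)
    (c : ConjClasses (imprimitiveGroup K m r n) → K)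
    (τ : Representation K (imprimitiveGroup K m r n) V) (i : Fin n) (f : MvPolynomial (Fin n) K)
    (v : V) : dunkl (stdRep K m r n) c τ i (f ⊗ₜ v) =
      -(∑ η : rootsOfUnity (m / r) K with η ≠ 1, c (ConjClasses.mk (scaleElem hr i η)) •
          (rootDiff (stdRep K m r n) (scaleElem hr i η) i f ⊗ₜ τ (scaleElem hr i η) v) +
        ∑ j with j ≠ i, ∑ ζ : rootsOfUnity m K, c (ConjClasses.mk (swapElem r i j ζ)) •
          (rootDiff (stdRep K m r n) (swapElem r i j ζ) i f ⊗ₜ τ (swapElem r i j ζ) v)) := by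
  rw [dunkl_tmul, sum_reflections hr i (fun s => c (ConjClasses.mk s) •
    (rootDiff (stdRep K m r n) s i f ⊗ₜ τ s v))]
  intro s hs
  rw [rootDiff, hs, zero_smul, LinearMap.zero_apply, TensorProduct.zero_tmul, smul_zero]

/-- For `G(r, r, n)` there are no diagonal reflections. -/
theorem dunkl_stdRep_self_tmul [NeZero r] (c : ConjClasses (imprimitiveGroup K r r n) → K)
    (τ : Representation K (imprimitiveGroup K r r n) V) (i : Fin n) (f : MvPolynomial (Fin n) K)
    (v : V) : dunkl (stdRep K r r n) c τ i (f ⊗ₜ v) =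
      -∑ j with j ≠ i, ∑ ω : rootsOfUnity r K, c (ConjClasses.mk (swapElem r i j ω)) •
          (rootDiff (stdRep K r r n) (swapElem r i j ω) i f ⊗ₜ τ (swapElem r i j ω) v) := by
  classical
  have h1 : r / r = 1 := Nat.div_self (NeZero.pos r)
  have : NeZero (r / r) := ⟨by rw [h1]; exact one_ne_zero⟩
  have hsub : ∀ η : rootsOfUnity (r / r) K, η = 1 := fun η => by
    have h := (mem_rootsOfUnity _ _).mp η.2
    refine Subtype.ext ?_
    calc (η : Kˣ) = (η : Kˣ) ^ 1 := (pow_one _).symm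
      _ = 1 := by rw [← h1, h]
  rw [dunkl_stdRep_tmul dvd_rfl, Finset.filter_false_of_mem (fun η _ h => h (hsub η)),
    Finset.sum_empty, zero_add]

open Classical in
/-- The scalar by which the diagonal reflections in the Dunkl operator `Dᵢ` act on monomials of
degree `k` in `xᵢ`. -/
def scaleParam [NeZero (m / r)] (hr : r ∣ m) (c : ConjClasses (imprimitiveGroup K m r n) → K)
    (i : Fin n) (k : ℕ) : K :=
  -∑ η : rootsOfUnity (m / r) K with η ≠ 1,
    c (ConjClasses.mk (scaleElem hr i η)) * (1 - ((η : Kˣ) : K)⁻¹ ^ k)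

theorem scaleParam_zero [NeZero (m / r)] (hr : r ∣ m)
    (c : ConjClasses (imprimitiveGroup K m r n) → K) (i : Fin n) : scaleParam hr c i 0 = 0 := by
  simp [scaleParam]

/-- The sum `∑ c_s s` over the reflections of `G(r, r, n)` exchanging the coordinate `i` with a
coordinate `j` with `aⱼ < aᵢ`. -/
def lowerSwaps [NeZero r] {q : ℕ} (c : ConjClasses (imprimitiveGroup K r r n) → K)
    (τ : Representation K (imprimitiveGroup K r r n) V) (i : Fin n) (a : Fin n → Fin q) :
    Module.End K (MvPolynomial (Fin n) K ⊗[K] V) :=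
  ∑ j with j ≠ i ∧ a j < a i, ∑ ω : rootsOfUnity r K,
    c (ConjClasses.mk (swapElem r i j ω)) • groupOp (stdRep K r r n) τ (swapElem r i j ω)

variable [NeZero m] [NeZero r] [NeZero (m / r)] (hr : r ∣ m) {ξ : K} (hξ : IsPrimitiveRoot ξ m)
  (c : ConjClasses (imprimitiveGroup K m r n) → K)
  (τ : Representation K (imprimitiveGroup K r r n) V)

-- Diagonal reflections lie in the kernel of π, so they act trivially on τ and contribute only a
-- scalar. The others are grouped by their image under π, on which both the parameter and the action
-- on τ depend.
include hξ in
open Classical in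
theorem dunkl_monOp_tmul (i : Fin n) (a : Fin n → Fin (m / r)) (g : MvPolynomial (Fin n) K)
    (v : V) :
    dunkl (stdRep K m r n) c (τ.comp (powHom hr)) i (monOp K V a (g ⊗ₜ v)) =
      monOp K V (lowerExp i a) (scaleParam hr c i (a i) • (g ⊗ₜ v) - ((m / r : ℕ) : K) •
        ∑ j with j ≠ i, ∑ ω : rootsOfUnity r K,
          inducedParam hr c (ConjClasses.mk (swapElem r i j ω)) •
          ((if (a i : ℕ) = 0 then rootDiff (stdRep K r r n) (swapElem r i j ω) i g
          else MvPolynomial.X i * rootDiff (stdRep K r r n) (swapElem r i j ω) i g +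
            if a j < a i then polyAct (stdRep K r r n) (swapElem r i j ω) g else 0) ⊗ₜ
              τ (swapElem r i j ω) v)) := by
  have hτ : ∀ s v, (τ.comp (powHom hr)) s v = τ (powHom hr s) v := fun _ _ => rfl
  rw [monOp_tmul, dunkl_stdRep_tmul hr, neg_add, sub_eq_add_neg, map_add]
  congr 1
  · rw [scaleParam, neg_smul_tensor, map_neg, Finset.sum_smul, map_sum]
    congr 1
    refine Finset.sum_congr rfl fun η hη => ?_
    rw [rootDiff_scaleElem hr i (Finset.mem_filter.mp hη).2, hτ, powHom_scaleElem, map_one τ,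
      Module.End.one_apply, map_smul, monOp_tmul, mul_smul, ← TensorProduct.smul_tmul']
  · rw [map_neg, map_smul, map_sum, Finset.smul_sum]
    congr 1
    refine Finset.sum_congr rfl fun j hj => ?_
    have hij : j ≠ i := (Finset.mem_filter.mp hj).2
    -- Fibre the sum over the m-th roots of unity ζ along ω = ζ^q.
    rw [map_sum, Finset.smul_sum, ← Finset.sum_fiberwise Finset.univ (powRoot hr)]
    refine Finset.sum_congr rfl fun ω _ => ?_
    rw [map_smul, monOp_tmul, smul_comm, TensorProduct.smul_tmul', ← sum_rootDiff_swapElem hr hξ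
      hij,
      TensorProduct.sum_tmul, Finset.smul_sum]
    refine Finset.sum_congr rfl fun ζ hζ => ?_
    rw [Finset.mem_filter] at hζ
    rw [hτ, powHom_swapElem hr hij, ← hζ.2, inducedParam_swapElem hr hξ c hij]

include hξ in
theorem dunkl_monOp_of_eq_zero (i : Fin n) {a : Fin n → Fin (m / r)} (ha : (a i : ℕ) = 0)
    (F : MvPolynomial (Fin n) K ⊗[K] V) :
    dunkl (stdRep K m r n) c (τ.comp (powHom hr)) i (monOp K V a F) =
      monOp K V (lowerExp i a)
        (((m / r : ℕ) : K) • dunkl (stdRep K r r n) (inducedParam hr c) τ i F) := by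
  induction F using TensorProduct.induction_on with
  | zero => simp
  | add F H hF hH => simp only [map_add, smul_add, hF, hH]
  | tmul g v =>
    rw [dunkl_monOp_tmul hr hξ, dunkl_stdRep_self_tmul, ha, scaleParam_zero, zero_smul, zero_sub,
      smul_neg_tensor]
    simp only [if_true]

include hξ in
theorem dunkl_monOp_of_ne_zero (i : Fin n) {a : Fin n → Fin (m / r)} (ha : (a i : ℕ) ≠ 0)
    (F : MvPolynomial (Fin n) K ⊗[K] V) :
    dunkl (stdRep K m r n) c (τ.comp (powHom hr)) i (monOp K V a F) =
      monOp K V (lowerExp i a) (scaleParam hr c i (a i) • F + ((m / r : ℕ) : K) •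
        (mulOp K V i (dunkl (stdRep K r r n) (inducedParam hr c) τ i F) -
          lowerSwaps (inducedParam hr c) τ i a F)) := by
  induction F using TensorProduct.induction_on with
  | zero => simp
  | add F H hF hH =>
    simp only [map_add, hF, hH, smul_add, add_sub_add_comm]
    abel
  | tmul g v =>
    rw [dunkl_monOp_tmul hr hξ, dunkl_stdRep_self_tmul, sub_eq_add_neg, ← smul_neg_tensor]
    congr 3
    rw [map_neg, ← neg_add']
    congr 1
    simp only [if_neg ha, TensorProduct.add_tmul, smul_add, Finset.sum_add_distrib]
    congr 1
    · simp only [map_sum, map_smul, mulOp_tmul]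
    · rw [lowerSwaps, LinearMap.sum_apply, ← Finset.filter_filter, Finset.sum_filter (a · < a i)]
      refine Finset.sum_congr rfl fun j _ => ?_
      simp only [LinearMap.sum_apply, LinearMap.smul_apply, groupOp, TensorProduct.map_tmul]
      split_ifs
      · simp only [AlgHom.toLinearMap_apply]
      · simp

end DunklMonOp

/-! ### Injectivity of t + B for non-integral t. -/

section Integral

variable {K : Type*} [Field K] {L : Type*} [CommRing L] [Algebra L K]

/-- If `B` preserves a lattice over `L`, then `t + B` is injective modulo any `B`-stable subspace
for every `t` that is not integral over `L`. -/
theorem mem_of_smul_add_mem {M : Type*} [AddCommGroup M] [Module K M] [Module L M]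
    [IsScalarTower L K M] (B : Module.End K M) {U : Submodule L M} (hU : U.FG)
    (hB : ∀ F ∈ U, B F ∈ U) {J : Submodule K M} (hJ : ∀ F ∈ J, B F ∈ J) {t : K}
    (ht : ¬ IsIntegral L t) {F : M} (hF : F ∈ Submodule.span K (U : Set M))
    (h : t • F + B F ∈ J) : F ∈ J := by
  have : Module.Finite L U := Module.Finite.of_fg hU
  let BU : Module.End L U := (B.restrictScalars L).restrict hB
  -- Cayley–Hamilton over L: a monic χ with coefficients in L annihilates B on U, hence on its
  -- K-span, which contains F.
  obtain ⟨χ, hχ, hχB⟩ := LinearMap.exists_monic_and_aeval_eq_zero L BU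
  have hBU : ∀ (p : Polynomial L) (u : U),
      ((Polynomial.aeval BU p u : U) : M) = Polynomial.aeval B (p.map (algebraMap L K)) u := by
    intro p u
    induction p using Polynomial.induction_on' generalizing u with
    | add p p' h h' => simp only [map_add, Polynomial.map_add, LinearMap.add_apply,
        Submodule.coe_add, h, h']
    | monomial k a =>
      have hk : ∀ k, (((BU ^ k) u : U) : M) = (B ^ k) u := fun k => by
        induction k with
        | zero => rfl
        | succ k ih =>
          rw [pow_succ', pow_succ', Module.End.mul_apply, Module.End.mul_apply, ← ih]
          rfl
      rw [Polynomial.map_monomial, Polynomial.aeval_monomial, Polynomial.aeval_monomial,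
        Module.End.mul_apply, Module.End.mul_apply, Module.algebraMap_end_apply,
        Module.algebraMap_end_apply, Submodule.coe_smul, hk, algebraMap_smul]
  set p := χ.map (algebraMap L K) with hp
  have hker : Polynomial.aeval B p F = 0 := by
    have hle : Submodule.span K (U : Set M) ≤ LinearMap.ker (Polynomial.aeval B p) := by
      rw [Submodule.span_le]
      intro u hu
      rw [SetLike.mem_coe, LinearMap.mem_ker, hp, ← hBU χ ⟨u, hu⟩, hχB]
      rfl
    exact hle hF
  -- A zero of the monic χ at -t would make t integral over L.
  have he : p.eval (-t) ≠ 0 := fun h0 => by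
    have h1 : IsIntegral L (-t) := ⟨χ, hχ, by rwa [Polynomial.eval₂_eq_eval_map]⟩
    have h2 := h1.neg
    rw [neg_neg] at h2
    exact ht h2
  -- Write p - p(-t) = ψ (X + t). Applied to F this gives -p(-t) F = ψ(B) (t + B) F, which lies in
  -- J.
  obtain ⟨ψ, hψ⟩ := Polynomial.X_sub_C_dvd_sub_C_eval (a := -t) (p := p)
  have hψJ : ∀ (ψ : Polynomial K) (H : M), H ∈ J → Polynomial.aeval B ψ H ∈ J := by
    intro ψ H hH
    induction ψ using Polynomial.induction_on' with
    | add p p' h h' => rw [map_add, LinearMap.add_apply]; exact J.add_mem h h'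
    | monomial k a =>
      rw [Polynomial.aeval_monomial, Module.End.mul_apply, Module.algebraMap_end_apply]
      refine J.smul_mem _ ?_
      induction k with
      | zero => exact hH
      | succ k ih => rw [pow_succ', Module.End.mul_apply]; exact hJ _ ih
  have h1 := congrArg (fun P => Polynomial.aeval B P F) (hψ.trans (mul_comm _ _))
  simp only [map_sub, map_mul, Polynomial.aeval_C, Polynomial.aeval_X, LinearMap.sub_apply,
    Module.End.mul_apply, Module.algebraMap_end_apply, hker, zero_sub, neg_smul,
    sub_neg_eq_add] at h1
  have h2 : p.eval (-t) • F ∈ J := by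
    rw [← neg_neg (p.eval (-t) • F), h1]
    refine J.neg_mem (hψJ ψ _ ?_)
    rwa [add_comm]
  exact (J.smul_mem_iff he).mp h2

end Integral

/-! ### Irreducible representations are spanned by the orbit of any nonzero vector. -/

section Irreducible

variable {K : Type*} [Field K] {G : Type*} [Group G] {V : Type*} [AddCommGroup V] [Module K V]
variable {τ : Representation K G V}

theorem span_orbit_eq_top (hτ : τ.IsIrreducible) {v : V} (hv : v ≠ 0) :
    Submodule.span K (Set.range fun g => τ g v) = ⊤ := by
  refine eq_top_of_isIrreducible hτ _ (fun g w hw => ?_) fun h => hv ?_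
  · refine Submodule.span_induction
      (p := fun w _ => τ g w ∈ Submodule.span K (Set.range fun g => τ g v)) ?_ ?_ ?_ ?_ hw
    · rintro _ ⟨h, rfl⟩
      exact Submodule.subset_span ⟨g * h, by simp⟩
    · rw [map_zero]; exact Submodule.zero_mem _
    · intro w w' _ _ h h'
      rw [map_add]; exact Submodule.add_mem _ h h'
    · intro t w _ h
      rw [map_smul]; exact Submodule.smul_mem _ t h
  · have h1 : τ 1 v ∈ Submodule.span K (Set.range fun g => τ g v) :=
      Submodule.subset_span ⟨1, rfl⟩
    rw [h, Submodule.mem_bot, map_one] at h1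
    exact h1

theorem exists_ne_zero_of_isIrreducible (hτ : τ.IsIrreducible) : ∃ v : V, v ≠ 0 := by
  by_contra! h
  obtain ⟨W, W', hW⟩ := hτ.toNontrivial
  refine hW (Subrepresentation.toSubmodule_injective (Submodule.ext fun v => ?_))
  rw [h v]
  exact ⟨fun _ => Submodule.zero_mem _, fun _ => Submodule.zero_mem _⟩

theorem finite_of_isIrreducible [Finite G] (hτ : τ.IsIrreducible) : Module.Finite K V := by
  obtain ⟨v, hv⟩ := exists_ne_zero_of_isIrreducible hτ
  exact ⟨span_orbit_eq_top hτ hv ▸ Submodule.fg_span (Set.finite_range _)⟩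

end Irreducible

/-! ### Lattices in the Verma module over a ring L containing the structure constants. -/

section Lattice

variable {K : Type*} [Field K] {G : Type*} [Group G] {n : ℕ}
variable {V : Type*} [AddCommGroup V] [Module K V]
variable (L : Type*) [CommRing L] [Algebra L K]

/-- The `L`-span of the elements `f ⊗ g v`, where `f` is a monomial of degree at most `d`. -/
def orbitLattice (τ : Representation K G V) (v : V) :
    ℕ → Submodule L (MvPolynomial (Fin n) K ⊗[K] V)
  | 0 => Submodule.span L (Set.range fun g => 1 ⊗ₜ τ g v)
  | d + 1 => orbitLattice τ v d ⊔
      ⨆ j, (orbitLattice τ v d).map ((mulOp K V j).restrictScalars L)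

variable {L} {τ : Representation K G V} {v : V} {d : ℕ} {F : MvPolynomial (Fin n) K ⊗[K] V}

theorem orbitLattice_mono : Monotone (orbitLattice (n := n) L τ v) :=
  monotone_nat_of_le_succ fun _ => le_sup_left

theorem mulOp_mem_orbitLattice (j : Fin n) (hF : F ∈ orbitLattice L τ v d) :
    mulOp K V j F ∈ orbitLattice L τ v (d + 1) :=
  (le_sup_of_le_right (le_iSup (fun j => (orbitLattice L τ v d).map
    ((mulOp K V j).restrictScalars L)) j) : _ ≤ orbitLattice L τ v (d + 1)) ⟨F, hF, rfl⟩

theorem orbitLattice_induction {p : MvPolynomial (Fin n) K ⊗[K] V → Prop}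
    (hadd : ∀ F H, p F → p H → p (F + H))
    (h0 : ∀ F ∈ orbitLattice L τ v d, p F)
    (hX : ∀ j, ∀ F ∈ orbitLattice L τ v d, p (mulOp K V j F))
    (hF : F ∈ orbitLattice L τ v (d + 1)) : p F := by
  obtain ⟨F', hF', H, hH, rfl⟩ := Submodule.mem_sup.mp hF
  refine hadd _ _ (h0 F' hF') ?_
  refine Submodule.iSup_induction _ (motive := p) hH ?_ (h0 0 (Submodule.zero_mem _)) hadd
  rintro j _ ⟨H, hH, rfl⟩
  exact hX j H hH

theorem smul_mem_of_mem_range {U : Submodule L (MvPolynomial (Fin n) K ⊗[K] V)} {t : K}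
    (ht : t ∈ (algebraMap L K).range) (hF : F ∈ U) : t • F ∈ U := by
  obtain ⟨l, rfl⟩ := ht
  rw [algebraMap_smul]
  exact U.smul_mem l hF

theorem orbitLattice_fg [Finite G] (d : ℕ) : (orbitLattice (n := n) L τ v d).FG := by
  induction d with
  | zero => exact Submodule.fg_span (Set.finite_range _)
  | succ d ih => exact ih.sup (Submodule.fg_iSup _ fun j => ih.map _)

/-- By irreducibility the orbit of v spans τ over K, so no L-form of τ is needed; raising the degree
bound exhausts M. -/
theorem exists_mem_span_orbitLattice (hτ : τ.IsIrreducible) (hv : v ≠ 0)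
    (F : MvPolynomial (Fin n) K ⊗[K] V) :
    ∃ d, F ∈ Submodule.span K (orbitLattice (n := n) L τ v d : Set (MvPolynomial (Fin n) K ⊗[K] V))
        := by
  induction F using verma_induction with
  | h1 w =>
    refine ⟨0, ?_⟩
    have hw : w ∈ Submodule.span K (Set.range fun g => τ g v) :=
      span_orbit_eq_top hτ hv ▸ Submodule.mem_top
    refine Submodule.span_induction (p := fun w _ => (1 : MvPolynomial (Fin n) K) ⊗ₜ[K] w ∈
      Submodule.span K (orbitLattice (n := n) L τ v 0 : Set (MvPolynomial (Fin n) K ⊗[K] V))) ?_ ?_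
        ?_ ?_ hw
    · rintro _ ⟨h, rfl⟩
      exact Submodule.subset_span (Submodule.subset_span ⟨h, rfl⟩)
    · rw [TensorProduct.tmul_zero]; exact Submodule.zero_mem _
    · intro w w' _ _ h h'
      rw [TensorProduct.tmul_add]; exact Submodule.add_mem _ h h'
    · intro t w _ h
      rw [TensorProduct.tmul_smul]; exact Submodule.smul_mem _ t h
  | hadd F H hF hH =>
    obtain ⟨d, hd⟩ := hF
    obtain ⟨d', hd'⟩ := hH
    exact ⟨max d d', Submodule.add_mem _
      (Submodule.span_mono (orbitLattice_mono (le_max_left d d')) hd)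
      (Submodule.span_mono (orbitLattice_mono (le_max_right d d')) hd')⟩
  | hX j F hF =>
    obtain ⟨d, hd⟩ := hF
    refine ⟨d + 1, ?_⟩
    have hle : Submodule.span K
        (orbitLattice (n := n) L τ v d : Set (MvPolynomial (Fin n) K ⊗[K] V)) ≤
        (Submodule.span K (orbitLattice (n := n) L τ v (d + 1) :
          Set (MvPolynomial (Fin n) K ⊗[K] V))).comap (mulOp K V j) := by
      rw [Submodule.span_le]
      exact fun H hH => Submodule.subset_span (mulOp_mem_orbitLattice j hH)
    exact hle hd

variable {ρ : G →* Matrix (Fin n) (Fin n) K}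

theorem groupOp_mem_orbitLattice (hρ : ∀ g i j, ρ g i j ∈ (algebraMap L K).range) (g : G)
    (hF : F ∈ orbitLattice L τ v d) : groupOp ρ τ g F ∈ orbitLattice L τ v d := by
  induction d generalizing F with
  | zero =>
    refine Submodule.span_induction (p := fun F _ => groupOp ρ τ g F ∈ orbitLattice L τ v 0)
      ?_ ?_ ?_ ?_ hF
    · rintro _ ⟨h, rfl⟩
      refine Submodule.subset_span ⟨g * h, ?_⟩
      simp [groupOp_one_tmul]
    · rw [map_zero]; exact Submodule.zero_mem _
    · intro F H _ _ hF hH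
      rw [map_add]; exact Submodule.add_mem _ hF hH
    · intro l F _ hF
      rw [← algebraMap_smul K l F, map_smul, algebraMap_smul]
      exact Submodule.smul_mem _ l hF
  | succ d ih =>
    refine orbitLattice_induction (p := fun F => groupOp ρ τ g F ∈ orbitLattice L τ v (d + 1))
      (fun F H hF hH => ?_) (fun F hF => ?_) (fun j F hF => ?_) hF
    · rw [map_add]; exact Submodule.add_mem _ hF hH
    · exact orbitLattice_mono d.le_succ (ih hF)
    · rw [groupOp_mulOp_apply]
      exact Submodule.sum_mem _ fun l _ =>
        smul_mem_of_mem_range (hρ _ _ _) (mulOp_mem_orbitLattice l (ih hF))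

variable [Finite G] {c : ConjClasses G → K}

theorem dunkl_orbitLattice_zero (i : Fin n) (hF : F ∈ orbitLattice L τ v 0) :
    dunkl ρ c τ i F = 0 := by
  refine Submodule.span_induction (p := fun F _ => dunkl ρ c τ i F = 0) ?_ ?_ ?_ ?_ hF
  · rintro _ ⟨h, rfl⟩
    rw [dunkl_one_tmul]
  · rw [map_zero]
  · intro F H _ _ hF hH
    rw [map_add, hF, hH, add_zero]
  · intro l F _ hF
    rw [← algebraMap_smul K l F, map_smul, hF, smul_zero]

/-- Induction on the degree through the commutator of y_i and x_j, whose coefficients lie in L. -/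
theorem dunkl_mem_orbitLattice (hρ : ∀ g i j, ρ g i j ∈ (algebraMap L K).range)
    (hc : ∀ s, IsReflection ρ s → c (ConjClasses.mk s) ∈ (algebraMap L K).range) (i : Fin n)
    (hF : F ∈ orbitLattice L τ v (d + 1)) : dunkl ρ c τ i F ∈ orbitLattice L τ v d := by
  have hsum : ∀ (d : ℕ) (j : Fin n), ∀ F ∈ orbitLattice L τ v d, ∑ s ∈ reflections ρ,
      (c (ConjClasses.mk s) * root ρ s i * coroot ρ s j) • groupOp ρ τ s F ∈
        orbitLattice L τ v d := fun d j F hF => by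
    refine Submodule.sum_mem _ fun s hs => ?_
    rw [mem_reflections] at hs
    refine smul_mem_of_mem_range ?_ (groupOp_mem_orbitLattice hρ s hF)
    -- Roots and coroots were chosen arbitrarily and need not have entries in L, but the product
    -- that occurs is an entry of 1 - s⁻¹.
    have h1 := congrFun (congrFun (one_sub_eq_root ρ hs) j) i
    rw [Matrix.vecMulVec_apply, Matrix.sub_apply, Matrix.one_apply] at h1
    rw [mul_assoc, mul_comm (root ρ s i), ← h1]
    refine mul_mem (hc s hs) (sub_mem ?_ (hρ _ _ _))
    split_ifs
    · exact one_mem _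
    · exact zero_mem _
  have hadd : ∀ d, ∀ F H : MvPolynomial (Fin n) K ⊗[K] V, dunkl ρ c τ i F ∈ orbitLattice L τ v d →
      dunkl ρ c τ i H ∈ orbitLattice L τ v d → dunkl ρ c τ i (F + H) ∈ orbitLattice L τ v d :=
    fun d F H hF hH => by rw [map_add]; exact Submodule.add_mem _ hF hH
  induction d generalizing F with
  | zero =>
    refine orbitLattice_induction (p := fun F => dunkl ρ c τ i F ∈ orbitLattice L τ v 0)
      (hadd 0) (fun F hF => ?_) (fun j F hF => ?_) hF
    · rw [dunkl_orbitLattice_zero i hF]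
      exact Submodule.zero_mem _
    · rw [dunkl_mulOp_apply, dunkl_orbitLattice_zero i hF, map_zero]
      exact Submodule.sub_mem _ (Submodule.zero_mem _) (hsum 0 j F hF)
  | succ d ih =>
    refine orbitLattice_induction (p := fun F => dunkl ρ c τ i F ∈ orbitLattice L τ v (d + 1))
      (hadd _) (fun F hF => ?_) (fun j F hF => ?_) hF
    · exact orbitLattice_mono d.le_succ (ih hF)
    · rw [dunkl_mulOp_apply]
      exact Submodule.sub_mem _ (mulOp_mem_orbitLattice j (ih hF)) (hsum _ j F hF)

theorem mulOp_dunkl_mem_orbitLattice (hρ : ∀ g i j, ρ g i j ∈ (algebraMap L K).range)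
    (hc : ∀ s, IsReflection ρ s → c (ConjClasses.mk s) ∈ (algebraMap L K).range) (i : Fin n)
    (hF : F ∈ orbitLattice L τ v d) : mulOp K V i (dunkl ρ c τ i F) ∈ orbitLattice L τ v d := by
  cases d with
  | zero =>
    rw [dunkl_orbitLattice_zero i hF, map_zero]
    exact Submodule.zero_mem _
  | succ d => exact mulOp_mem_orbitLattice i (dunkl_mem_orbitLattice hρ hc i hF)

end Lattice

/-! ### The use of genericity: a subfield over which the scalar t is not integral. -/

section Generic

variable {K : Type*} [Field K]

/-- Take the algebraic closure in K of the algebra generated by the other x_j. Being relatively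
closed, it also contains all roots of unity of K. -/
theorem exists_subfield_of_algebraicIndependent {R : Type*} [Field R] [Algebra R K] {ι : Type*}
    {x : ι → K} (hx : AlgebraicIndependent R x) (k : ι) :
    ∃ L : Subfield K, (∀ j ≠ k, x j ∈ L) ∧ (∀ t, IsIntegral L t → t ∈ L) ∧ x k ∉ L := by
  let S := Algebra.adjoin R (x '' {k}ᶜ)
  let L : Subfield K :=
    { (Subalgebra.algebraicClosure S K).toSubring with
      inv_mem' := fun t (ht : IsAlgebraic S t) => ht.inv }
  refine ⟨L, fun j hj => ?_, fun t ht => ?_, ?_⟩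
  · exact isAlgebraic_algebraMap (⟨x j, Algebra.subset_adjoin ⟨j, hj, rfl⟩⟩ : S)
  · have h : IsIntegral (Subalgebra.algebraicClosure S K) t := ht
    exact h.isAlgebraic.restrictScalars S
  · exact hx.transcendental_adjoin (i := k) (s := {k}ᶜ) (fun h => h rfl)

variable {m r n : ℕ}

theorem stdRep_apply_mem [NeZero m] {L : Subfield K} (hL : ∀ t, IsIntegral L t → t ∈ L)
    (g : imprimitiveGroup K m r n) (i j : Fin n) : stdRep K m r n g i j ∈ L := by
  obtain ⟨σ, ε, hg, hε, -⟩ := exists_monomial g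
  rw [hg, monomialMatrix_apply]
  split_ifs
  · refine hL _ (IsIntegral.of_pow (NeZero.pos m) ?_)
    rw [← Units.val_pow_eq_pow_val, hε, Units.val_one]
    exact isIntegral_one
  · exact zero_mem _

/-- The trace recovers η. Hence the diagonal reflections at i carry independent parameters. -/
theorem isConj_scaleElem_iff (hr : r ∣ m) (i : Fin n) {η η' : rootsOfUnity (m / r) K} :
    IsConj (scaleElem hr i η) (scaleElem hr i η') ↔ η = η' := by
  refine ⟨fun h => ?_, fun h => h ▸ IsConj.refl _⟩
  have htr : ∀ η : rootsOfUnity (m / r) K, (stdRep K m r n (scaleElem hr i η)).trace =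
      ((η : Kˣ) : K) + ∑ _l ∈ Finset.univ.erase i, 1 := fun η => by
    rw [Matrix.trace, ← Finset.add_sum_erase _ _ (Finset.mem_univ i)]
    congr 1
    · rw [Matrix.diag_apply, stdRep_scaleElem_apply, if_pos rfl, if_pos rfl]
    · refine Finset.sum_congr rfl fun l hl => ?_
      rw [Matrix.diag_apply, stdRep_scaleElem_apply, if_pos rfl, if_neg (Finset.ne_of_mem_erase hl)]
  obtain ⟨g, hg⟩ := isConj_iff.mp h
  have h1 := htr η'
  rw [← hg, map_mul, map_mul, Matrix.trace_mul_comm, ← mul_assoc, ← map_mul, inv_mul_cancel,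
    map_one, one_mul, htr η] at h1
  exact Subtype.ext (Units.ext (add_right_cancel h1))

variable [NeZero m] [NeZero r] [NeZero (m / r)] (hr : r ∣ m) {ξ : K} (hξ : IsPrimitiveRoot ξ m)
  {c : ConjClasses (imprimitiveGroup K m r n) → K} (hc : IsGeneric (stdRep K m r n) c)

-- Let L omit only the parameter of the diagonal reflection with a primitive q-th root η₀. That
-- class does not lie over a reflection of G', so L keeps all of c', while the omitted parameter
-- occurs in the scalar with the coefficient 1 - η₀^(-k) up to sign, nonzero for 0 < k < q.
include hξ hc in
theorem exists_subfield_of_isGeneric (i : Fin n) {k : ℕ} (hk0 : k ≠ 0) (hk : k < m / r) :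
    ∃ L : Subfield K, (∀ g i j, stdRep K r r n g i j ∈ L) ∧
      (∀ s, IsReflection (stdRep K r r n) s → inducedParam hr c (ConjClasses.mk s) ∈ L) ∧
      ¬ IsIntegral L (scaleParam hr c i k) := by
  classical
  have hξ' : IsPrimitiveRoot (ξ ^ r) (m / r) :=
    hξ.pow (NeZero.pos m) (Nat.mul_div_cancel' hr).symm
  let η₀ : rootsOfUnity (m / r) K := hξ'.toRootsOfUnity
  have hη₀ : (1 : K) - ((η₀ : Kˣ) : K)⁻¹ ^ k ≠ 0 := fun h => by
    have h1 : ((η₀ : Kˣ) : K) ^ k = 1 := by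
      rw [inv_pow, sub_eq_zero, eq_comm, inv_eq_one] at h
      exact h
    exact hξ'.pow_ne_one_of_pos_of_lt hk0 hk h1
  have hη₀' : η₀ ≠ 1 := fun h => hη₀ (by simp [h])
  obtain ⟨L, h1, h2, h3⟩ := exists_subfield_of_algebraicIndependent hc
    ⟨ConjClasses.mk (scaleElem hr i η₀), _, isReflection_scaleElem hr i hη₀', rfl⟩
  have hLc : ∀ s, IsReflection (stdRep K m r n) s → ¬ IsConj s (scaleElem hr i η₀) →
      c (ConjClasses.mk s) ∈ L := fun s hs hs' => by
    refine h1 ⟨ConjClasses.mk s, s, hs, rfl⟩ fun h => hs' ?_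
    exact ConjClasses.mk_eq_mk_iff_isConj.mp (congrArg Subtype.val h)
  refine ⟨L, stdRep_apply_mem h2, fun s hs => ?_, fun h => h3 ?_⟩
  · rw [inducedParam]
    split_ifs with h
    · obtain ⟨hs1, hs2⟩ := h.choose_spec
      refine hLc _ hs1 fun h0 => ?_
      -- A conjugate of a diagonal reflection maps to 1 under π, so it cannot lie over the
      -- reflection s.
      have h4 := (powHom hr).map_isConj h0
      rw [powHom_scaleElem, ← ConjClasses.mk_eq_mk_iff_isConj, hs2,
        ConjClasses.mk_eq_mk_iff_isConj, isConj_comm, isConj_one_right] at h4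
      rw [IsReflection, h4, map_one, sub_self, Matrix.rank_zero] at hs
      exact zero_ne_one hs
    · exact zero_mem _
  -- If the scalar were integral it would be in L; all other terms are in L, so solving for the
  -- omitted parameter would put it into L.
  · have h5 := neg_mem (h2 _ h)
    rw [scaleParam, neg_neg, ← Finset.add_sum_erase _ _ (Finset.mem_filter.mpr
      ⟨Finset.mem_univ η₀, hη₀'⟩)] at h5
    have hroot : ∀ η : rootsOfUnity (m / r) K, (1 : K) - ((η : Kˣ) : K)⁻¹ ^ k ∈ L := fun η => by
      have hη : ((η : Kˣ) : K) ∈ L := by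
        refine h2 _ (IsIntegral.of_pow (NeZero.pos (m / r)) ?_)
        rw [← Units.val_pow_eq_pow_val, (mem_rootsOfUnity _ _).mp η.2, Units.val_one]
        exact isIntegral_one
      exact sub_mem (one_mem _) (pow_mem (inv_mem hη) k)
    rw [add_mem_cancel_right (sum_mem fun η hη => ?_)] at h5
    · have h6 := mul_mem h5 (inv_mem (hroot η₀))
      rwa [mul_inv_cancel_right₀ hη₀] at h6
    · rw [Finset.mem_erase, Finset.mem_filter] at hη
      refine mul_mem (hLc _ (isReflection_scaleElem hr i hη.2.2) fun h => hη.1 ?_) (hroot η)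
      exact (isConj_scaleElem_iff hr i).mp h

end Generic

theorem isIrreducible_comp_powHom {K : Type*} [Field K] {m r n : ℕ} [NeZero m] (hr : r ∣ m)
    {V : Type*} [AddCommGroup V] [Module K V] {τ : Representation K (imprimitiveGroup K r r n) V}
    (hτ : τ.IsIrreducible) (hsurj : Function.Surjective (powHom (n := n) (K := K) hr)) :
    Representation.IsIrreducible
      (τ.comp (powHom hr) : Representation K (imprimitiveGroup K m r n) V) := by
  refine @IsSimpleOrder.mk _ _ _ ?_ fun W => ?_
  · obtain ⟨v, hv⟩ := exists_ne_zero_of_isIrreducible hτ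
    refine ⟨⊥, ⊤, fun h => hv ?_⟩
    have h1 : (⊥ : Submodule K V) = ⊤ := congrArg Subrepresentation.toSubmodule h
    exact (Submodule.mem_bot K).mp (h1 ▸ Submodule.mem_top)
  · by_cases h0 : W.toSubmodule = ⊥
    · exact Or.inl (Subrepresentation.toSubmodule_injective h0)
    · refine Or.inr (Subrepresentation.toSubmodule_injective
        (eq_top_of_isIrreducible hτ W.toSubmodule (fun g v hv => ?_) h0))
      obtain ⟨g, rfl⟩ := hsurj g
      exact W.apply_mem_toSubmodule g hv

/-! ### Singular vectors of M/J^q, coefficient by coefficient. -/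

section CoeffDunkl

variable {K : Type*} [Field K] {m r n : ℕ} [NeZero m] [NeZero r] [NeZero (m / r)] (hr : r ∣ m)
  {ξ : K} (hξ : IsPrimitiveRoot ξ m)
variable {V : Type*} [AddCommGroup V] [Module K V]
variable (c : ConjClasses (imprimitiveGroup K m r n) → K)
  (τ : Representation K (imprimitiveGroup K r r n) V)

/-- The operators `T` with `Dᵢ (x^a F(x^q)) = x^b (T F)(x^q)`, where `b` is `a` lowered at `i`. -/
def coeffDunkl (i : Fin n) (a : Fin n → Fin (m / r)) :
    Module.End K (MvPolynomial (Fin n) K ⊗[K] V) :=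
  if (a i : ℕ) = 0 then ((m / r : ℕ) : K) • dunkl (stdRep K r r n) (inducedParam hr c) τ i
  else scaleParam hr c i (a i) • 1 + ((m / r : ℕ) : K) •
    (mulOp K V i * dunkl (stdRep K r r n) (inducedParam hr c) τ i -
      lowerSwaps (inducedParam hr c) τ i a)

include hξ in
theorem dunkl_monOp (i : Fin n) (a : Fin n → Fin (m / r)) (F : MvPolynomial (Fin n) K ⊗[K] V) :
    dunkl (stdRep K m r n) c (τ.comp (powHom hr)) i (monOp K V a F) =
      monOp K V (lowerExp i a) (coeffDunkl hr c τ i a F) := by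
  rw [coeffDunkl]
  split_ifs with h
  · exact dunkl_monOp_of_eq_zero hr hξ c τ i h F
  · exact dunkl_monOp_of_ne_zero hr hξ c τ i h F

-- Lowering at i is injective on exponents, so only one coefficient of F contributes to each
-- coefficient of its Dunkl image.
include hξ in
theorem coeffOp_lowerExp_dunkl (i : Fin n) (a : Fin n → Fin (m / r))
    (F : MvPolynomial (Fin n) K ⊗[K] V) :
    coeffOp K V (lowerExp i a) (dunkl (stdRep K m r n) c (τ.comp (powHom hr)) i F) =
      coeffDunkl hr c τ i a (coeffOp K V a F) := by
  conv_lhs => rw [← sum_monOp_coeffOp (q := m / r) F]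
  simp only [map_sum, dunkl_monOp hr hξ, coeffOp_monOp, (lowerExp_injective i).eq_iff]
  simp

variable {c τ}

theorem lowerSwaps_mem_formKernel {q : ℕ} {c : ConjClasses (imprimitiveGroup K r r n) → K}
    (i : Fin n) (a : Fin n → Fin q) {F : MvPolynomial (Fin n) K ⊗[K] V}
    (hF : F ∈ formKernel (stdRep K r r n) c τ) :
    lowerSwaps c τ i a F ∈ formKernel (stdRep K r r n) c τ := by
  simp only [lowerSwaps, LinearMap.sum_apply, LinearMap.smul_apply]
  exact Submodule.sum_mem _ fun j _ => Submodule.sum_mem _ fun ω _ =>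
    Submodule.smul_mem _ _ (groupOp_mem_formKernel hF _)

theorem coeffDunkl_mem_formKernel (i : Fin n) (a : Fin n → Fin (m / r))
    {F : MvPolynomial (Fin n) K ⊗[K] V}
    (hF : F ∈ formKernel (stdRep K r r n) (inducedParam hr c) τ) :
    coeffDunkl hr c τ i a F ∈ formKernel (stdRep K r r n) (inducedParam hr c) τ := by
  rw [coeffDunkl]
  split_ifs
  · exact Submodule.smul_mem _ _ (dunkl_mem_formKernel hF i)
  · exact Submodule.add_mem _ (Submodule.smul_mem _ _ hF) (Submodule.smul_mem _ _
      (Submodule.sub_mem _ (mulOp_mem_formKernel (dunkl_mem_formKernel hF i) i)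
        (lowerSwaps_mem_formKernel i a hF)))

include hξ in
theorem dunkl_mem_powSubmodule_formKernel (i : Fin n) {F : MvPolynomial (Fin n) K ⊗[K] V}
    (hF : F ∈ powSubmodule (m / r) (formKernel (stdRep K r r n) (inducedParam hr c) τ)) :
    dunkl (stdRep K m r n) c (τ.comp (powHom hr)) i F ∈
      powSubmodule (m / r) (formKernel (stdRep K r r n) (inducedParam hr c) τ) := by
  rw [mem_powSubmodule_iff fun j F hF => mulOp_mem_formKernel hF j] at hF
  rw [← sum_monOp_coeffOp (q := m / r) F, map_sum]
  refine Submodule.sum_mem _ fun a _ => ?_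
  rw [dunkl_monOp hr hξ]
  exact monOp_mem_powSubmodule _ (coeffDunkl_mem_formKernel hr i a (hF a))

-- The operator is t + B with t not integral over a suitable subfield L, while B has its structure
-- constants in L and preserves the kernel of the form.
include hξ in
theorem mem_formKernel_of_coeffDunkl (hc : IsGeneric (stdRep K m r n) c) (hτ : τ.IsIrreducible)
    {i : Fin n} {a : Fin n → Fin (m / r)} (ha : (a i : ℕ) ≠ 0)
    {F : MvPolynomial (Fin n) K ⊗[K] V}
    (hF : coeffDunkl hr c τ i a F ∈ formKernel (stdRep K r r n) (inducedParam hr c) τ) :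
    F ∈ formKernel (stdRep K r r n) (inducedParam hr c) τ := by
  obtain ⟨L, hL, hLc, hint⟩ := exists_subfield_of_isGeneric hr hξ hc i ha (a i).2
  have hL' : ∀ t ∈ L, t ∈ (algebraMap L K).range := fun t ht => ⟨⟨t, ht⟩, rfl⟩
  obtain ⟨v, hv⟩ := exists_ne_zero_of_isIrreducible hτ
  obtain ⟨d, hd⟩ := exists_mem_span_orbitLattice (L := L) hτ hv F
  rw [coeffDunkl, if_neg ha] at hF
  refine mem_of_smul_add_mem (L := L) _ (orbitLattice_fg (L := L) (τ := τ) (v := v) d)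
    (fun H hH => ?_) (fun H hH => ?_) hint hd hF
  · refine smul_mem_of_mem_range (hL' _ (natCast_mem L _)) (Submodule.sub_mem _
      (mulOp_dunkl_mem_orbitLattice (fun g i j => hL' _ (hL g i j))
        (fun s hs => hL' _ (hLc s hs)) i hH) ?_)
    simp only [lowerSwaps, LinearMap.sum_apply, LinearMap.smul_apply]
    exact Submodule.sum_mem _ fun j hj => Submodule.sum_mem _ fun ω _ =>
      smul_mem_of_mem_range
        (hL' _ (hLc _ (isReflection_swapElem r (Finset.mem_filter.mp hj).2.1 ω)))
        (groupOp_mem_orbitLattice (fun g i j => hL' _ (hL g i j)) _ hH)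
  · exact Submodule.smul_mem _ _ (Submodule.sub_mem _
      (mulOp_mem_formKernel (dunkl_mem_formKernel hH i) i) (lowerSwaps_mem_formKernel i a hH))

theorem constTerm_smul (p : MvPolynomial (Fin n) K) (F : MvPolynomial (Fin n) K ⊗[K] V) :
    constTerm K n V (p • F) = MvPolynomial.constantCoeff p • constTerm K n V F := by
  induction F using TensorProduct.induction_on with
  | zero => simp
  | add F H hF hH => simp only [smul_add, map_add, hF, hH]
  | tmul f v =>
    simp [TensorProduct.smul_tmul', constTerm, MvPolynomial.aeval_zero, mul_smul]

theorem constTerm_coeffOp_zero {q : ℕ} [NeZero q] (F : MvPolynomial (Fin n) K ⊗[K] V) :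
    constTerm K n V (coeffOp K V (0 : Fin n → Fin q) F) = constTerm K n V F := by
  have hpow : ∀ F : MvPolynomial (Fin n) K ⊗[K] V,
      constTerm K n V (powOp K n V q F) = constTerm K n V F := fun F => by
    induction F using TensorProduct.induction_on with
    | zero => simp
    | add F H hF hH => simp only [map_add, hF, hH]
    | tmul f v =>
      simp [powOp, constTerm, zero_pow (NeZero.ne q)]
  conv_rhs => rw [← sum_monOp_coeffOp (q := q) F]
  rw [map_sum, Finset.sum_eq_single 0]
  · rw [monOp_apply, monomial_smallExp_zero, one_smul, hpow]
  · intro a _ ha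
    rw [monOp_apply, constTerm_smul, MvPolynomial.constantCoeff_monomial, if_neg, zero_smul]
    exact fun h => ha (funext fun l => Fin.ext (by simpa using DFunLike.congr_fun h l))
  · exact fun h => absurd (Finset.mem_univ _) h

-- A coefficient F_a with some a_i ≠ 0 is settled by the single operator D_i and genericity. For a =
-- 0 all D_i and the constant term are used, which reduces the claim to the form of G'.
include hξ in
theorem mem_powSubmodule_formKernel_of_dunkl (hc : IsGeneric (stdRep K m r n) c)
    (hτ : τ.IsIrreducible) {F : MvPolynomial (Fin n) K ⊗[K] V} (h0 : constTerm K n V F = 0)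
    (hF : ∀ i, dunkl (stdRep K m r n) c (τ.comp (powHom hr)) i F ∈
      powSubmodule (m / r) (formKernel (stdRep K r r n) (inducedParam hr c) τ)) :
    F ∈ powSubmodule (m / r) (formKernel (stdRep K r r n) (inducedParam hr c) τ) := by
  simp only [mem_powSubmodule_iff fun j F hF => mulOp_mem_formKernel hF j] at hF ⊢
  intro a
  have h : ∀ i, coeffDunkl hr c τ i a (coeffOp K V a F) ∈
      formKernel (stdRep K r r n) (inducedParam hr c) τ := fun i => by
    rw [← coeffOp_lowerExp_dunkl hr hξ]
    exact hF i _
  by_cases ha : ∃ i, (a i : ℕ) ≠ 0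
  · obtain ⟨i, hi⟩ := ha
    exact mem_formKernel_of_coeffDunkl hr hξ hc hτ hi (h i)
  · push Not at ha
    have ha0 : a = 0 := funext fun l => Fin.ext (by simpa using ha l)
    -- A primitive m-th root of unity in K forces m, hence its factor q, to be nonzero in K.
    have hq : ((m / r : ℕ) : K) ≠ 0 := fun h => by
      have : NeZero ((m : ℕ) : K) := hξ.neZero'
      refine NeZero.ne (m : K) ?_
      rw [← Nat.div_mul_cancel hr, Nat.cast_mul, h, zero_mul]
    refine mem_formKernel_of_dunkl ?_ fun i => ?_
    · rw [ha0, constTerm_coeffOp_zero, h0]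
    · have h1 := h i
      rw [coeffDunkl, if_pos (ha i), LinearMap.smul_apply] at h1
      exact (Submodule.smul_mem_iff _ hq).mp h1

theorem eq_zero_of_one_tmul_mem_powSubmodule {q : ℕ} [NeZero q] {G : Type*} [Group G] [Finite G]
    {ρ : G →* Matrix (Fin n) (Fin n) K} {c : ConjClasses G → K} {τ : Representation K G V} {v : V}
    (hv : (1 : MvPolynomial (Fin n) K) ⊗ₜ[K] v ∈ powSubmodule q (formKernel ρ c τ)) : v = 0 := by
  rw [mem_powSubmodule_iff fun j F hF => mulOp_mem_formKernel hF j] at hv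
  have h := constTerm_eq_zero_of_mem_formKernel (hv 0)
  rwa [constTerm_coeffOp_zero, constTerm_one_tmul] at h

end CoeffDunkl

end Cherednik

end

/-! ### The theorem. -/

open Cherednik

theorem mainTheorem1 {K : Type*} [Field K] {m r n : ℕ} [NeZero m] [NeZero r] [NeZero n]
    (hr : r ∣ m) (hK : ∃ ξ : K, IsPrimitiveRoot ξ m)
    {V : Type*} [AddCommGroup V] [Module K V]
    (τ' : Representation K (imprimitiveGroup K r r n) V) (hτ' : τ'.IsIrreducible)
    (c : ConjClasses (imprimitiveGroup K m r n) → K) (hc : IsGeneric (stdRep K m r n) c) :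
    let q := m / r
    let τ : Representation K (imprimitiveGroup K m r n) V := τ'.comp (powHom hr)
    let J1 := formKernel (stdRep K r r n) (inducedParam hr c) τ'
    let Jq := powSubmodule q J1
    IsGraded J1 ∧ IsGraded (Jq.restrictScalars K) ∧
    (∃ N : Submodule (CherednikAlgebra (stdRep K m r n) c) (Verma (stdRep K m r n) c τ),
      (∀ F, Verma.of (stdRep K m r n) c τ F ∈ N ↔ F ∈ Jq) ∧
      IsSimpleModule (CherednikAlgebra (stdRep K m r n) c) (Verma (stdRep K m r n) c τ ⧸ N)) ∧
    hilbertSeries (Jq.restrictScalars K) =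
      (hilbertSeries J1).subst (PowerSeries.X ^ q : PowerSeries ℤ) *
        (∑ i ∈ Finset.range q, PowerSeries.X ^ i) ^ n := by
  intro q τ J1 Jq
  obtain ⟨ξ, hξ⟩ := hK
  have : NeZero (m / r) := ⟨div_ne_zero_of_dvd hr⟩
  -- Finite dimension of τ' is not assumed; it follows from irreducibility and the finiteness of G'.
  have : Module.Finite K V := finite_of_isIrreducible hτ'
  have hX : ∀ j, ∀ F ∈ J1, mulOp K V j F ∈ J1 := fun j F hF => mulOp_mem_formKernel hF j
  have hJ : ∀ a, ∀ F ∈ Jq.restrictScalars K, genOp (stdRep K m r n) c τ a F ∈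
      Jq.restrictScalars K := by
    rintro (g | j | i) F hF
    · exact groupOp_mem_powSubmodule hr τ' (fun g F hF => groupOp_mem_formKernel hF g) g hF
    · exact Jq.smul_mem _ hF
    · exact dunkl_mem_powSubmodule_formKernel hr hξ i hF
  refine ⟨isGraded_formKernel, isGraded_powSubmodule hX isGraded_formKernel,
    ⟨vermaSubmodule _ c τ (Jq.restrictScalars K) hJ, fun F => of_mem_vermaSubmodule, ?_⟩,
    hilbertSeries_powSubmodule hX⟩
  exact isSimpleModule_quotient_vermaSubmodule
    (isIrreducible_comp_powHom hr hτ' (powHom_surjective hr hξ)) hJ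
    (fun v hv => eq_zero_of_one_tmul_mem_powSubmodule hv)
    (fun F h0 hF => mem_powSubmodule_formKernel_of_dunkl hr hξ hc hτ' h0 hF)
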